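/- **Setting.** Let $d\ge 1$, $\theta^*\in\mathbb R^d$, $S_*:=\|\theta^*\|_2$, $\sigma_*\ge 0$, and let $\mathcal A_1,\mathcal A_2,\dots\subset\mathbb R^d$ be finite nonempty arm sets such that for all $t\ge1$ and $a\in\mathcal A_t$: $\|a\|_2\le 1$ and $\Delta_{a,t}:=\max_{a'\in\mathcal A_t}\langle\theta^*,a'\rangle-\langle\theta^*,a\rangle\le B$. In round $t$ the learner picks $A_t\in\mathcal A_t$ and sees $Y_t=\langle\theta^*,A_t\rangle+\eta_t$, where $\mathbb E[e^{x\eta_t}\mid A_{1:t},Y_{1:t-1}]\le e^{x^2\sigma_*^2/2}$ a.s. for every $x\in\mathbb R$. Put $\mathrm{Reg}_n=\sum_{t=1}^n\Delta_{A_t,t}$. **Design oracle.** For every nonempty finite $\mathcal B\subset\mathbb R^d$, $\mathrm{ApproxDesign}(\mathcal B)$ is a probability vector $q$ on $\mathcal B$ with $\|b\|^2_{V(q)^{-1}}\le C_{\rm opt}\,d\log d$ for all $b\in\mathcal B$, where $V(q)=\sum_{b\in\mathcal B}q_b bb^\top$ (pseudo-inverse if $V(q)$ is singular, with $b$ required to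 be in its range), and $|\mathrm{supp}(q)|\le C_{\rm supp}\,d(1+\log d)^j$. **LinMED.** Inputs: $\lambda,\sigma,S>0$ ($\sigma,S$ are arbitrary guesses of $\sigma_*,S_*$), $\alpha_{\rm opt},\alpha_{\rm emp}>0$ with $\alpha_{\rm opt}+\alpha_{\rm emp}\le1$, $\mathrm{ver}\in\{0,1\}$; $\delta_t=\frac1{t+1}$. Let $V_t=\lambda I+\sum_{s\le t}A_sA_s^\top$, $\hat\theta_t=V_t^{-1}\sum_{s\le t}A_sY_s$, and $$\beta_t=\Big(\sigma\sqrt{\log\tfrac{\det V_t}{\det V_0}+2\log\tfrac1{\delta_t}}+\sqrt\lambda S\Big)^2,\qquad \beta^*_t=\Big(\sigma_*\sqrt{\log\tfrac{\det V_t}{\det V_0}+2\log\tfrac1{\delta_t}}+\sqrt\lambda S_*\Big)^2 .$$ In round $t$ let $\hat a_t\in\arg\max_{a\in\mathcal A_t}\langle\hat\theta_{t-1},a\rangle$ and $f_t(a)=\exp\big(-\langle\hat\theta_{t-1},\hat a_t-a\rangle^2/(\beta_{t-1}\|\hat a_t-a\|^2_{V_{t-1}^{-1}})\big)$ (with $0/0=0$).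 Let $q_t^{\rm opt}$ be the output of ApproxDesign on $\{\sqrt{f_t(a)}\,a: a\in\mathcal A_t\}$ (if $\mathrm{ver}=0$; the mass of a rescaled arm is given to the corresponding arm or arms) or on $\{a\in\mathcal A_t: f_t(a)\ge 1/e\}$ (if $\mathrm{ver}=1$; the other arms have mass $0$). Let $q_t(a)=\alpha_{\rm opt}q^{\rm opt}_t(a)+\alpha_{\rm emp}\mathbf 1\{a=\hat a_t\}+(1-\alpha_{\rm opt}-\alpha_{\rm emp})/|\mathcal A_t|$, $p'_t(a)=q_t(a)f_t(a)/\sum_{b\in\mathcal A_t}q_t(b)f_t(b)$ and $\mathcal B_t=\{a\in\mathcal A_t:\|a\|^2_{V_{t-1}^{-1}}>1\}$. If $\mathcal B_t=\emptyset$ let $p_t=p'_t$; otherwise let $p_t(a)=\frac12p'_t(a)+\frac12\mathbf 1\{a=B_t\}$ with an arbitrary $B_t\in\mathcal B_t$. The choices of $\hat a_t,q_t^{\rm opt},B_t$ depend measurably on $A_1,Y_1,\dots,A_{t-1},Y_{t-1}$, and given this history $A_t\sim p_t$. **Theorem (minimax bound).** There is a universal $k\in\mathbb N$ and, for all positive $\alpha_{\rm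 opt},\alpha_{\rm emp},C_{\rm opt},C_{\rm supp}$ with $\alpha_{\rm opt}+\alpha_{\rm emp}\le 1$ and all $j\in\mathbb N$, a constant $C$ depending only on $\alpha_{\rm opt},\alpha_{\rm emp},C_{\rm opt},C_{\rm supp},j$, such that in every such setting (for $\mathrm{ver}=1$ assume in addition $\sigma_*\le\sigma$ and $S_*\le S$) and for every $n\ge1$, $\mathrm{Reg}_n$ and $H_{\max}:=\max_{1\le t\le n}\exp(\beta^*_{t-1}/\beta_{t-1})$ are integrable and $$\mathbb E\,\mathrm{Reg}_n\le C\,\Lambda^k\left[\sqrt n\left(\log^{1/2}(n)\Big(d\sigma\log n+\frac{\lambda S^2}{\sigma}\Big)+\frac{\mathbb E[H_{\max}]}{\sigma\log^{3/2}(n)}\big(d\sigma_*^2\log n+\lambda S_*^2\big)\right)+dB\log(n+1)\right],$$ where $\Lambda=\log\big(e+d+\frac1\lambda+\frac S\sigma+\frac{\sigma_*}\sigma+\frac{S_*}\sigma\big)$ (for $n=1$ the fraction with denominator $\sigma\log^{3/2}(1)=0$ is read as $0$). -/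

import Mathlib

open MeasureTheory
open scoped Matrix RealInnerProductSpace

universe u

namespace LinMED

/-- Column vectors of `ℝ^d` with the Euclidean norm. -/
abbrev Vec (d : ℕ) := EuclideanSpace ℝ (Fin d)

variable {d : ℕ}

/-- The rank-one matrix `x xᵀ`. -/
noncomputable def outer (x : Vec d) : Matrix (Fin d) (Fin d) ℝ :=
  Matrix.vecMulVec x.ofLp x.ofLp

/-- The squared Mahalanobis norm `‖x‖_M² = xᵀ M x`. -/
noncomputable def sqNorm (M : Matrix (Fin d) (Fin d) ℝ) (x : Vec d) : ℝ :=
  x.ofLp ⬝ᵥ (M *ᵥ x.ofLp)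

/-! ### Experimental designs and the design oracle -/

/-- `q` is (the mass function of) a probability measure on the finite set `B`. -/
def IsProbOn (B : Finset (Vec d)) (q : Vec d → ℝ) : Prop :=
  (∀ b ∈ B, 0 ≤ q b) ∧ ∑ b ∈ B, q b = 1

/-- The design matrix `V(q) = ∑_{b ∈ B} q_b b bᵀ`. -/
noncomputable def designCov (B : Finset (Vec d)) (q : Vec d → ℝ) :
    Matrix (Fin d) (Fin d) ℝ :=
  ∑ b ∈ B, q b • outer b

/-- `‖x‖²_{M⁻¹} ≤ c` for a positive semidefinite `M`.  If `M` is invertible, the only choice is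
`z = M⁻¹ x` (see `leverageLE_iff`).  If `M` is singular, this is the usual convention: the inverse
is the pseudo-inverse and the norm is infinite when `x` is not in the range of `M`. -/
def LeverageLE (M : Matrix (Fin d) (Fin d) ℝ) (x : Vec d) (c : ℝ) : Prop :=
  ∃ z : Fin d → ℝ, M *ᵥ z = x.ofLp ∧ x.ofLp ⬝ᵥ z ≤ c

theorem leverageLE_iff (M : Matrix (Fin d) (Fin d) ℝ) (hM : IsUnit M.det) (x : Vec d) (c : ℝ) :
    LeverageLE M x c ↔ sqNorm M⁻¹ x ≤ c := by
  constructor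
  · rintro ⟨z, hz, h⟩
    have hz' : M⁻¹ *ᵥ x.ofLp = z := by
      rw [← hz, Matrix.mulVec_mulVec, Matrix.nonsing_inv_mul M hM, Matrix.one_mulVec]
    simpa [sqNorm, hz'] using h
  · intro h
    refine ⟨M⁻¹ *ᵥ x.ofLp, ?_, h⟩
    rw [Matrix.mulVec_mulVec, Matrix.mul_nonsing_inv M hM, Matrix.one_mulVec]

/-- `q` is a `Copt`-optimal design for `B`: a probability measure on `B` with
`‖b‖²_{V(q)⁻¹} ≤ Copt · d · log d` for all `b ∈ B`. -/
def IsOptimalDesign (Copt : ℝ) (B : Finset (Vec d)) (q : Vec d → ℝ) : Prop :=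
  IsProbOn B q ∧ ∀ b ∈ B, LeverageLE (designCov B q) b (Copt * d * Real.log d)

/-- The assumptions on the oracle `ApproxDesign`: on every nonempty finite set of vectors it
returns a `Copt`-optimal design whose support has size `Õ(d)`, that is, at most
`Csupp · d · (1 + log d)^j`. -/
def IsApproxDesign (Copt Csupp : ℝ) (j : ℕ) (oracle : Finset (Vec d) → Vec d → ℝ) : Prop :=
  ∀ B : Finset (Vec d), B.Nonempty →
    IsOptimalDesign Copt B (oracle B) ∧
    (Set.ncard {b | b ∈ B ∧ oracle B b ≠ 0} : ℝ) ≤ Csupp * d * (1 + Real.log d) ^ j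

/-! ### Quantities computed from a trajectory `A_1, Y_1, A_2, Y_2, …` (index `0` is not used) -/

/-- `V_t = λ I + ∑_{s=1}^t A_s A_sᵀ`. -/
noncomputable def gram (lam : ℝ) (A : ℕ → Vec d) (t : ℕ) : Matrix (Fin d) (Fin d) ℝ :=
  lam • (1 : Matrix (Fin d) (Fin d) ℝ) + ∑ s ∈ Finset.Icc 1 t, outer (A s)

/-- The ridge estimator `θ̂_t = V_t⁻¹ ∑_{s=1}^t A_s Y_s`. -/
noncomputable def ridge (lam : ℝ) (A : ℕ → Vec d) (Y : ℕ → ℝ) (t : ℕ) : Vec d :=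
  WithLp.toLp 2 ((gram lam A t)⁻¹ *ᵥ ∑ s ∈ Finset.Icc 1 t, Y s • (A s).ofLp)

/-- The failure rates `δ_t = 1 / (t + 1)`. -/
noncomputable def failureRate (t : ℕ) : ℝ := 1 / ((t : ℝ) + 1)

/-- The confidence radius
`(s √(log (det V_t / det V_0) + 2 log (1 / δ_t)) + √λ R)²` with noise level `s` and norm bound `R`:
`β_t(δ_t)` for the guesses `s = σ`, `R = S`, and the true radius `β*_t(δ_t)` for the true values
`s = σ_*`, `R = S_* = ‖θ*‖`. -/
noncomputable def radius (lam s R : ℝ) (A : ℕ → Vec d) (t : ℕ) : ℝ :=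
  (s * √(Real.log ((gram lam A t).det / (gram lam A 0).det)
      + 2 * Real.log (1 / failureRate t)) + √lam * R) ^ 2

/-- `H_max = max_{1 ≤ t ≤ n} exp (β*_{t-1}(δ_{t-1}) / β_{t-1}(δ_{t-1}))`. -/
noncomputable def hMax (lam sig S sigStar SStar : ℝ) (A : ℕ → Vec d) (n : ℕ) : ℝ :=
  sSup ((fun t : ℕ => Real.exp (radius lam sigStar SStar A (t - 1) / radius lam sig S A (t - 1)))
    '' Set.Icc 1 n)

/-- The largest mean reward `max_{a ∈ s} ⟨θ, a⟩` over a finite set of arms. -/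
noncomputable def bestValue (θ : Vec d) (s : Finset (Vec d)) : ℝ :=
  sSup ((fun a : Vec d => ⟪θ, a⟫) '' (s : Set (Vec d)))

/-- The gap `Δ_{a,t}` of an arm `a` in the arm set `s = 𝒜_t`. -/
noncomputable def gap (θ : Vec d) (s : Finset (Vec d)) (a : Vec d) : ℝ :=
  bestValue θ s - ⟪θ, a⟫

/-- The cumulative pseudo-regret `∑_{t=1}^n (⟨θ, a*_t⟩ - ⟨θ, A_t⟩)`. -/
noncomputable def regret (θ : Vec d) (arms : ℕ → Finset (Vec d)) (A : ℕ → Vec d) (n : ℕ) : ℝ :=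
  ∑ t ∈ Finset.Icc 1 n, gap θ (arms t) (A t)

/-! ### The algorithm -/

/-- The two ways to augment the arm set: `rescale` is version 0, `eliminate` is version 1. -/
inductive Version
  | rescale
  | eliminate

/-- The numerical inputs of LinMED: the regularization `lam = λ`, the guesses `sig = σ` and
`S` for the noise level and for `‖θ*‖`, and the fractions `αopt`, `αemp`. -/
structure Input where
  ver : Version
  lam : ℝ
  sig : ℝ
  S : ℝ
  αopt : ℝ
  αemp : ℝ

/-- Admissible inputs. -/
structure Input.Valid (I : Input) : Prop where
  lam_pos : 0 < I.lam
  sig_pos : 0 < I.sig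
  S_pos : 0 < I.S
  αopt_pos : 0 < I.αopt
  αemp_pos : 0 < I.αemp
  sum_le_one : I.αopt + I.αemp ≤ 1

/-- The weight `f_t(a) = exp (-Δ̂_{a,t}² / (β_{t-1}(δ_{t-1}) ‖â_t - a‖²_{V_{t-1}⁻¹}))` of round `t`,
where `ahat = â_t`, `Δ̂_{a,t} = ⟨θ̂_{t-1}, â_t - a⟩` and `0 / 0 = 0`. -/
noncomputable def weight (I : Input) (A : ℕ → Vec d) (Y : ℕ → ℝ) (t : ℕ) (ahat a : Vec d) : ℝ :=
  Real.exp (-(⟪ridge I.lam A Y (t - 1), ahat - a⟫ ^ 2 /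
    (radius I.lam I.sig I.S A (t - 1) * sqNorm (gram I.lam A (t - 1))⁻¹ (ahat - a))))

open Classical in
/-- `qopt` (a mass function on the arm set `s`) is an output of `ApproxDesignAugmented(s, f, ver)`.

Version 0: the oracle is called on the set of the rescaled arms `√(f a) • a`, and `qopt` gives to
the arms the masses of their rescaled copies (if several arms have the same rescaled copy, they
share its mass in an arbitrary way).

Version 1: the oracle is called on the set of the arms with `f a ≥ 1 / e`; the other arms have
mass zero. -/
def IsAugmentedDesign (oracle : Finset (Vec d) → Vec d → ℝ) (ver : Version)
    (s : Finset (Vec d)) (f : Vec d → ℝ) (qopt : Vec d → ℝ) : Prop :=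
  match ver with
  | .rescale =>
      (∀ a ∈ s, 0 ≤ qopt a) ∧
      ∀ b ∈ s.image (fun a => √(f a) • a),
        ∑ a ∈ s.filter (fun a => √(f a) • a = b), qopt a
          = oracle (s.image (fun a => √(f a) • a)) b
  | .eliminate =>
      ∀ a ∈ s, qopt a =
        if 1 / Real.exp 1 ≤ f a then oracle (s.filter (fun a => 1 / Real.exp 1 ≤ f a)) a else 0

open Classical in
/-- `q_t(a) = αopt qopt_t(a) + αemp 1{a = â_t} + (1 - αopt - αemp) / |𝒜_t|`. -/
noncomputable def mixture (I : Input) (s : Finset (Vec d)) (qopt : Vec d → ℝ) (ahat a : Vec d) :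
    ℝ :=
  I.αopt * qopt a + I.αemp * (if a = ahat then 1 else 0)
    + (1 - I.αopt - I.αemp) * (1 / (s.card : ℝ))

/-- `p'_t(a) = q_t(a) f_t(a) / ∑_{b ∈ 𝒜_t} q_t(b) f_t(b)`. -/
noncomputable def baseProb (I : Input) (A : ℕ → Vec d) (Y : ℕ → ℝ) (t : ℕ) (s : Finset (Vec d))
    (qopt : Vec d → ℝ) (ahat a : Vec d) : ℝ :=
  mixture I s qopt ahat a * weight I A Y t ahat a /
    ∑ b ∈ s, mixture I s qopt ahat b * weight I A Y t ahat b

/-- `ℬ_t = {a ∈ 𝒜_t : ‖a‖²_{V_{t-1}⁻¹} > 1}`. -/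
def unexplored (lam : ℝ) (A : ℕ → Vec d) (t : ℕ) (s : Finset (Vec d)) : Set (Vec d) :=
  {a | a ∈ s ∧ 1 < sqNorm (gram lam A (t - 1))⁻¹ a}

open Classical in
/-- The sampling probability `p_t(a)`: it is `p'_t(a)` if `ℬ_t` is empty, and
`p'_t(a) / 2 + 1{a = B_t} / 2` with the chosen element `bsel = B_t` of `ℬ_t` otherwise. -/
noncomputable def sampleProb (I : Input) (A : ℕ → Vec d) (Y : ℕ → ℝ) (t : ℕ) (s : Finset (Vec d))
    (qopt : Vec d → ℝ) (ahat bsel a : Vec d) : ℝ :=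
  if (unexplored I.lam A t s).Nonempty then
    1 / 2 * baseProb I A Y t s qopt ahat a + 1 / 2 * (if a = bsel then 1 else 0)
  else baseProb I A Y t s qopt ahat a

/-! ### The bandit model and the run of the algorithm -/

variable {Ω : Type u} [mΩ : MeasurableSpace Ω]

/-- The history `ℱ_t`, the σ-algebra generated by `A_1, Y_1, …, A_t, Y_t`. -/
@[reducible] def hist (A : ℕ → Ω → Vec d) (Y : ℕ → Ω → ℝ) (t : ℕ) : MeasurableSpace Ω :=
  ⨆ s ∈ Finset.Icc 1 t,
    (MeasurableSpace.comap (A s) inferInstance ⊔ MeasurableSpace.comap (Y s) inferInstance)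

/-- The σ-algebra generated by `A_1, …, A_t` and `Y_1, …, Y_{t-1}`. -/
@[reducible] def preReward (A : ℕ → Ω → Vec d) (Y : ℕ → Ω → ℝ) (t : ℕ) : MeasurableSpace Ω :=
  hist A Y (t - 1) ⊔ MeasurableSpace.comap (A t) inferInstance

/-- The noise `η_t = Y_t - ⟨θ, A_t⟩`, so that `Y_t = ⟨θ, A_t⟩ + η_t`. -/
noncomputable def noise (θ : Vec d) (A : ℕ → Ω → Vec d) (Y : ℕ → Ω → ℝ) (t : ℕ) (ω : Ω) : ℝ :=
  Y t ω - ⟪θ, A t ω⟫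

/-- The assumptions on the sequence of (finite, nonempty) arm sets: all arms have norm at most
one and all gaps are at most `B`. -/
structure IsBoundedEnv (θ : Vec d) (arms : ℕ → Finset (Vec d)) (B : ℝ) : Prop where
  nonempty : ∀ t, 1 ≤ t → (arms t).Nonempty
  norm_le_one : ∀ t, 1 ≤ t → ∀ a ∈ arms t, ‖a‖ ≤ 1
  gap_le : ∀ t, 1 ≤ t → ∀ a ∈ arms t, gap θ (arms t) a ≤ B

/-- The stochastic linear bandit: the arms are chosen from the arm sets, and the noise is
conditionally `sigStar²`-sub-Gaussian given `A_1, …, A_t, Y_1, …, Y_{t-1}`. -/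
structure IsLinearBandit (P : Measure Ω) (θ : Vec d) (sigStar : ℝ) (arms : ℕ → Finset (Vec d))
    (A : ℕ → Ω → Vec d) (Y : ℕ → Ω → ℝ) : Prop where
  measurable_arm : ∀ t, Measurable (A t)
  measurable_reward : ∀ t, Measurable (Y t)
  mem_arms : ∀ t, 1 ≤ t → ∀ᵐ ω ∂P, A t ω ∈ arms t
  integrable_exp : ∀ t, 1 ≤ t → ∀ x : ℝ, Integrable (fun ω => Real.exp (x * noise θ A Y t ω)) P
  subgaussian : ∀ t, 1 ≤ t → ∀ x : ℝ,
    P[fun ω => Real.exp (x * noise θ A Y t ω) | preReward A Y t]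
      ≤ᵐ[P] fun _ => Real.exp (x ^ 2 * sigStar ^ 2 / 2)

/-- The arms `A_t` are chosen by LinMED with input `I` and design oracle `oracle`.  In round `t`,
`ahat t` is the empirically best arm, `qopt t` is the design and `bsel t` is the chosen element of
`ℬ_t`; they are computed from the history `ℱ_{t-1}` (ties and arbitrary choices are resolved in any
way that depends on the history), and then `A_t` is drawn from `p_t`. -/
structure IsRun (P : Measure Ω) (I : Input) (oracle : Finset (Vec d) → Vec d → ℝ)
    (arms : ℕ → Finset (Vec d)) (A : ℕ → Ω → Vec d) (Y : ℕ → Ω → ℝ)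
    (ahat : ℕ → Ω → Vec d) (qopt : ℕ → Ω → Vec d → ℝ) (bsel : ℕ → Ω → Vec d) : Prop where
  ahat_measurable : ∀ t, 1 ≤ t → Measurable[hist A Y (t - 1)] (ahat t)
  ahat_mem : ∀ t, 1 ≤ t → ∀ ω, ahat t ω ∈ arms t
  ahat_best : ∀ t, 1 ≤ t → ∀ ω, ∀ a ∈ arms t,
    ⟪ridge I.lam (fun s => A s ω) (fun s => Y s ω) (t - 1), a⟫
      ≤ ⟪ridge I.lam (fun s => A s ω) (fun s => Y s ω) (t - 1), ahat t ω⟫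
  qopt_measurable : ∀ t, 1 ≤ t → ∀ a ∈ arms t,
    Measurable[hist A Y (t - 1)] (fun ω => qopt t ω a)
  qopt_design : ∀ t, 1 ≤ t → ∀ ω,
    IsAugmentedDesign oracle I.ver (arms t)
      (weight I (fun s => A s ω) (fun s => Y s ω) t (ahat t ω)) (qopt t ω)
  bsel_measurable : ∀ t, 1 ≤ t → Measurable[hist A Y (t - 1)] (bsel t)
  bsel_mem : ∀ t, 1 ≤ t → ∀ ω, (unexplored I.lam (fun s => A s ω) t (arms t)).Nonempty →
    bsel t ω ∈ unexplored I.lam (fun s => A s ω) t (arms t)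
  sampling : ∀ t, 1 ≤ t → ∀ a ∈ arms t,
    P[Set.indicator {ω | A t ω = a} (fun _ => (1 : ℝ)) | hist A Y (t - 1)]
      =ᵐ[P] fun ω => sampleProb I (fun s => A s ω) (fun s => Y s ω) t (arms t) (qopt t ω)
        (ahat t ω) (bsel t ω) a

/-- The logarithm of the parameters other than the horizon,
`log (e + d + 1/λ + S/σ + σ_*/σ + S_*/σ)`; it is at least one. -/
noncomputable def paramLog (d : ℕ) (I : Input) (sigStar SStar : ℝ) : ℝ :=
  Real.log (Real.exp 1 + d + 1 / I.lam + I.S / I.sig + sigStar / I.sig + SStar / I.sig)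

end LinMED

/-!
The regret of a round is the gap of the sampled arm. With `ε = θ - θ̂_{t-1}`, the gap of an arm `a`
is at most its estimated gap `⟨θ̂_{t-1}, â_t - a⟩` plus `⟨ε, a*⟩ - ⟨ε, a⟩`, where `a*` is the best
arm. These quantities are averaged over `a ∼ p_t` and bounded as follows.

* *The best arm.* The design bound says that every functional `z` satisfies
  `⟨z, a*⟩² ≲ d log d · ∑ q(a) ⟨z, a⟩²`, up to the weights `f_t`
  (`IsAugmentedDesign.weighted_inner_sq_le`). It is applied to `z = ε` itself and not to the norm
  `‖·‖_{V⁻¹}`: the error at the best arm is then at most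
  `√(H_max · d log d · E ⟨ε, A_t⟩²)`. The factor `H_max` is `1 / f_t(a*)`, since inside the true
  confidence ellipsoid the weight of the best arm is at least `exp (-β*/β)` (`exp_neg_le_weight`).
* *The prediction errors* `⟨ε, A_t⟩²` are summed by the one-step identity of online ridge regression
  (`sqNorm_errVec_succ`): `‖ε‖²_V` decreases by `⟨ε, A_t⟩² / (1 + ‖A_t‖²_{V⁻¹})` up to centered noise
  and a term that sums to `σ_*² log (det V_n / det V_0)`. Hence their total expectation is at most
  `λ S_*² + 2 σ_*² d log (d + n/λ)` (`IsLinearBandit.sum_integral_predErr_sq_le`). Confidence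
  ellipsoids would lose a further factor `d` here.
* *The estimated gaps* are controlled by the exponential weights: `x exp (-x²)` is truncated at
  `x = √(log n)`, which leaves the widths `‖A_t‖_{V⁻¹}` of the played arms, summed by the elliptical
  potential `log (det V_n / det V_0)`, and a remainder of order `1 / √n`
  (`sum_baseProb_mul_estGap_le`).
* *Exceptional rounds* cost at most `B` each. If some arm has width above one, an arm that doubles
  the determinant is played with probability at least one half (`IsRun.measureReal_unexplored_le`).
  The true parameter leaves the confidence ellipsoid of round `t` with probability at most `1 / t`,
  by the method of Gaussian mixtures (`IsLinearBandit.measureReal_radius_lt_le`).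

The first two items are combined in `sum_baseProb_mul_gap_le` for a single history and in
`IsRun.integral_gap_le` in expectation. As `H_max` is not independent of the prediction errors, the
product under the square root is split by the inequality of arithmetic and geometric means with a
deterministic parameter, which is optimized after summation (`IsRun.integral_regret_le`). For
`n ≥ 2` the rest is calculus with `log (d + n/λ) ≤ Λ + log n`, and the power `k = 1` of `Λ`
suffices; `n = 1` and `d = 0` are trivial but need their own treatment, because the logarithms
`log n` and `log d` degenerate.
-/

namespace LinMED

variable {d : ℕ}

/-! ### Quadratic forms and the Gram matrices -/

theorem inner_eq_dotProduct (x y : Vec d) : ⟪x, y⟫ = x.ofLp ⬝ᵥ y.ofLp := by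
  rw [EuclideanSpace.inner_eq_star_dotProduct, dotProduct_comm]; simp

theorem norm_sq_eq_dotProduct (x : Vec d) : ‖x‖ ^ 2 = x.ofLp ⬝ᵥ x.ofLp := by
  rw [← inner_eq_dotProduct, real_inner_self_eq_norm_sq]

theorem outer_mulVec (x : Vec d) (v : Fin d → ℝ) : outer x *ᵥ v = (x.ofLp ⬝ᵥ v) • x.ofLp := by
  rw [outer, Matrix.vecMulVec_mulVec]; simp

theorem outer_posSemidef (x : Vec d) : (outer x).PosSemidef := by
  simpa [outer] using Matrix.posSemidef_vecMulVec_self_star x.ofLp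

theorem gram_zero (lam : ℝ) (A : ℕ → Vec d) : gram lam A 0 = lam • 1 := by simp [gram]

theorem gram_succ (lam : ℝ) (A : ℕ → Vec d) (t : ℕ) :
    gram lam A (t + 1) = gram lam A t + outer (A (t + 1)) := by
  rw [gram, gram, Finset.sum_Icc_succ_top (by omega), add_assoc]

theorem gram_posDef {lam : ℝ} (hl : 0 < lam) (A : ℕ → Vec d) (t : ℕ) :
    (gram lam A t).PosDef := by
  induction t with
  | zero => rw [gram_zero]; exact Matrix.PosDef.one.smul hl
  | succ t ih => rw [gram_succ]; exact ih.add_posSemidef (outer_posSemidef _)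

theorem sqNorm_nonneg {M : Matrix (Fin d) (Fin d) ℝ} (hM : M.PosSemidef) (x : Vec d) :
    0 ≤ sqNorm M x := by
  simpa [sqNorm] using hM.dotProduct_mulVec_nonneg x.ofLp

theorem sqNorm_pos {M : Matrix (Fin d) (Fin d) ℝ} (hM : M.PosDef) {x : Vec d} (hx : x ≠ 0) :
    0 < sqNorm M x := by
  have : x.ofLp ≠ 0 := fun h => hx (by ext i; simp [h])
  simpa [sqNorm] using hM.dotProduct_mulVec_pos this

theorem sqNorm_zero (M : Matrix (Fin d) (Fin d) ℝ) : sqNorm M 0 = 0 := by simp [sqNorm]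

theorem dotProduct_mulVec_comm {M : Matrix (Fin d) (Fin d) ℝ} (hM : M.IsHermitian)
    (x y : Fin d → ℝ) : x ⬝ᵥ (M *ᵥ y) = y ⬝ᵥ (M *ᵥ x) := by
  have h : Mᵀ = M := by simpa [Matrix.IsHermitian, Matrix.conjTranspose_eq_transpose_of_trivial] using hM
  rw [Matrix.dotProduct_mulVec, ← Matrix.mulVec_transpose, h, dotProduct_comm]

theorem sqNorm_add {M : Matrix (Fin d) (Fin d) ℝ} (hM : M.IsHermitian) (x y : Vec d) :
    sqNorm M (x + y) = sqNorm M x + 2 * (x.ofLp ⬝ᵥ (M *ᵥ y.ofLp)) + sqNorm M y := by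
  simp only [sqNorm, WithLp.ofLp_add, Matrix.mulVec_add, add_dotProduct, dotProduct_add]
  rw [dotProduct_mulVec_comm hM y.ofLp x.ofLp]; ring

theorem sqNorm_smul (M : Matrix (Fin d) (Fin d) ℝ) (c : ℝ) (x : Vec d) :
    sqNorm M (c • x) = c ^ 2 * sqNorm M x := by
  simp only [sqNorm, WithLp.ofLp_smul, Matrix.mulVec_smul, smul_dotProduct, dotProduct_smul,
    smul_eq_mul]; ring

theorem dotProduct_mulVec_sq_le {M : Matrix (Fin d) (Fin d) ℝ} (hM : M.PosSemidef) (x y : Vec d) :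
    (x.ofLp ⬝ᵥ (M *ᵥ y.ofLp)) ^ 2 ≤ sqNorm M x * sqNorm M y := by
  have h : ∀ r : ℝ, 0 ≤ sqNorm M y * (r * r) + 2 * (x.ofLp ⬝ᵥ (M *ᵥ y.ofLp)) * r + sqNorm M x := by
    intro r
    have := sqNorm_nonneg hM (x + r • y)
    rw [sqNorm_add hM.1, sqNorm_smul, WithLp.ofLp_smul, Matrix.mulVec_smul, dotProduct_smul,
      smul_eq_mul] at this
    linarith
  have := discrim_le_zero h
  rw [discrim] at this
  linarith

theorem sqNorm_sub_le {M : Matrix (Fin d) (Fin d) ℝ} (hM : M.PosSemidef) (x y : Vec d) :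
    sqNorm M (x - y) ≤ 2 * sqNorm M x + 2 * sqNorm M y := by
  have h1 := sqNorm_nonneg hM (x + y)
  have h2 : x - y = x + (-1 : ℝ) • y := by simp [sub_eq_add_neg]
  rw [h2, sqNorm_add hM.1, sqNorm_smul, WithLp.ofLp_smul, Matrix.mulVec_smul, dotProduct_smul,
    smul_eq_mul]
  rw [sqNorm_add hM.1] at h1
  linarith

theorem sqNorm_add_le {M : Matrix (Fin d) (Fin d) ℝ} (hM : M.PosSemidef) (x y : Vec d) :
    sqNorm M (x + y) ≤ (√(sqNorm M x) + √(sqNorm M y)) ^ 2 := by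
  have h1 := sqNorm_nonneg hM x
  have h2 := sqNorm_nonneg hM y
  have h3 : x.ofLp ⬝ᵥ (M *ᵥ y.ofLp) ≤ √(sqNorm M x) * √(sqNorm M y) := by
    rw [← Real.sqrt_mul h1]
    exact Real.le_sqrt_of_sq_le (dotProduct_mulVec_sq_le hM x y)
  rw [sqNorm_add hM.1, add_sq, Real.sq_sqrt h1, Real.sq_sqrt h2]
  linarith

theorem mulVec_inv_mulVec {V : Matrix (Fin d) (Fin d) ℝ} (hV : V.PosDef) (x : Fin d → ℝ) :
    V *ᵥ (V⁻¹ *ᵥ x) = x := by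
  rw [Matrix.mulVec_mulVec, Matrix.mul_nonsing_inv V hV.det_pos.ne'.isUnit, Matrix.one_mulVec]

theorem inv_mulVec_mulVec {V : Matrix (Fin d) (Fin d) ℝ} (hV : V.PosDef) (x : Fin d → ℝ) :
    V⁻¹ *ᵥ (V *ᵥ x) = x := by
  rw [Matrix.mulVec_mulVec, Matrix.nonsing_inv_mul V hV.det_pos.ne'.isUnit, Matrix.one_mulVec]

theorem sqNorm_inv_mulVec {V : Matrix (Fin d) (Fin d) ℝ} (hV : V.PosDef) (x : Vec d) :
    sqNorm V⁻¹ (WithLp.toLp 2 (V *ᵥ x.ofLp)) = sqNorm V x := by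
  simp only [sqNorm, inv_mulVec_mulVec hV]
  rw [dotProduct_comm]

/-- Cauchy-Schwarz for the dual pair of norms `‖·‖_V` and `‖·‖_{V⁻¹}`. -/
theorem inner_sq_le {V : Matrix (Fin d) (Fin d) ℝ} (hV : V.PosDef) (e x : Vec d) :
    ⟪e, x⟫ ^ 2 ≤ sqNorm V e * sqNorm V⁻¹ x := by
  have h := dotProduct_mulVec_sq_le hV.inv.posSemidef x (WithLp.toLp 2 (V *ᵥ e.ofLp))
  rw [sqNorm_inv_mulVec hV] at h
  simp only [inv_mulVec_mulVec hV] at h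
  rw [inner_eq_dotProduct, dotProduct_comm, mul_comm]
  exact h

theorem sqNorm_outer (a x : Vec d) : sqNorm (outer a) x = (a.ofLp ⬝ᵥ x.ofLp) ^ 2 := by
  rw [sqNorm, outer_mulVec, dotProduct_smul, smul_eq_mul, dotProduct_comm x.ofLp, sq]

theorem sqNorm_add_matrix (M N : Matrix (Fin d) (Fin d) ℝ) (x : Vec d) :
    sqNorm (M + N) x = sqNorm M x + sqNorm N x := by
  simp [sqNorm, Matrix.add_mulVec, dotProduct_add]

theorem sqNorm_gram (lam : ℝ) (A : ℕ → Vec d) (t : ℕ) (x : Vec d) :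
    sqNorm (gram lam A t) x = lam * ‖x‖ ^ 2 + ∑ s ∈ Finset.Icc 1 t, ⟪A s, x⟫ ^ 2 := by
  induction t with
  | zero => simp [gram_zero, sqNorm, Matrix.smul_mulVec, norm_sq_eq_dotProduct]
  | succ t ih =>
    rw [gram_succ, sqNorm_add_matrix, ih, sqNorm_outer, Finset.sum_Icc_succ_top (by omega),
      inner_eq_dotProduct (A (t + 1))]
    ring

theorem sqNorm_gram_inv_le {lam : ℝ} (hl : 0 < lam) (A : ℕ → Vec d) (t : ℕ) (x : Vec d) :
    sqNorm (gram lam A t)⁻¹ x ≤ ‖x‖ ^ 2 / lam := by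
  set V := gram lam A t
  have hV : V.PosDef := gram_posDef hl A t
  set h : Vec d := WithLp.toLp 2 (V⁻¹ *ᵥ x.ofLp) with hh
  have h1 : sqNorm V h = sqNorm V⁻¹ x := by
    simp only [sqNorm, hh, mulVec_inv_mulVec hV]; rw [dotProduct_comm]
  have h2 : lam * ‖h‖ ^ 2 ≤ sqNorm V h := by
    rw [sqNorm_gram]
    have : 0 ≤ ∑ s ∈ Finset.Icc 1 t, ⟪A s, h⟫ ^ 2 := Finset.sum_nonneg fun _ _ => sq_nonneg _
    linarith
  have h3 : sqNorm V⁻¹ x = ⟪x, h⟫ := by rw [inner_eq_dotProduct]; rfl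
  have h4 : ⟪x, h⟫ ≤ ‖x‖ * ‖h‖ := real_inner_le_norm x h
  rw [h1, h3] at h2
  rw [h3, le_div_iff₀ hl]
  by_cases h0 : ‖h‖ = 0
  · rw [h0, mul_zero] at h4
    nlinarith [sq_nonneg ‖x‖]
  · have hp : 0 < ‖h‖ := lt_of_le_of_ne (norm_nonneg _) (Ne.symm h0)
    have h5 : lam * ‖h‖ ≤ ‖x‖ := by
      have : lam * ‖h‖ * ‖h‖ ≤ ‖x‖ * ‖h‖ := by nlinarith
      exact le_of_mul_le_mul_right this hp
    nlinarith [norm_nonneg x]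

theorem det_gram_succ {lam : ℝ} (hl : 0 < lam) (A : ℕ → Vec d) (t : ℕ) :
    (gram lam A (t + 1)).det
      = (gram lam A t).det * (1 + sqNorm (gram lam A t)⁻¹ (A (t + 1))) := by
  rw [gram_succ, outer, Matrix.vecMulVec_eq Unit,
    Matrix.det_add_replicateCol_mul_replicateRow (gram_posDef hl A t).det_pos.ne'.isUnit]
  congr 1
  rw [Matrix.det_unique]
  simp [sqNorm, Matrix.mul_apply, dotProduct, Matrix.mulVec, Finset.sum_mul, Finset.mul_sum]
  rw [Finset.sum_comm]
  refine Finset.sum_congr rfl fun i _ => Finset.sum_congr rfl fun j _ => by ring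

/-- The logarithm `log (det V_t / det V_0)` of the volume ratio. -/
noncomputable def logDet (lam : ℝ) (A : ℕ → Vec d) (t : ℕ) : ℝ :=
  Real.log ((gram lam A t).det / (gram lam A 0).det)

theorem logDet_zero {lam : ℝ} (hl : 0 < lam) (A : ℕ → Vec d) : logDet lam A 0 = 0 := by
  rw [logDet, div_self (gram_posDef hl A 0).det_pos.ne', Real.log_one]

theorem logDet_succ {lam : ℝ} (hl : 0 < lam) (A : ℕ → Vec d) (t : ℕ) :
    logDet lam A (t + 1)
      = logDet lam A t + Real.log (1 + sqNorm (gram lam A t)⁻¹ (A (t + 1))) := by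
  have h0 := (gram_posDef hl A 0).det_pos
  have ht := (gram_posDef hl A t).det_pos
  have hw := sqNorm_nonneg (gram_posDef hl A t).inv.posSemidef (A (t + 1))
  rw [logDet, logDet, det_gram_succ hl, mul_div_right_comm, Real.log_mul (by positivity)
    (by positivity)]

theorem logDet_eq_sum {lam : ℝ} (hl : 0 < lam) (A : ℕ → Vec d) (n : ℕ) :
    logDet lam A n
      = ∑ t ∈ Finset.Icc 1 n, Real.log (1 + sqNorm (gram lam A (t - 1))⁻¹ (A t)) := by
  induction n with
  | zero => simp [logDet_zero hl]
  | succ n ih => rw [logDet_succ hl, Finset.sum_Icc_succ_top (by omega), ih]; simp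

theorem logDet_mono {lam : ℝ} (hl : 0 < lam) (A : ℕ → Vec d) : Monotone (logDet lam A) := by
  refine monotone_nat_of_le_succ fun t => ?_
  rw [logDet_succ hl]
  have hw := sqNorm_nonneg (gram_posDef hl A t).inv.posSemidef (A (t + 1))
  linarith [Real.log_nonneg (show (1 : ℝ) ≤ 1 + sqNorm (gram lam A t)⁻¹ (A (t + 1)) by linarith)]

theorem logDet_nonneg {lam : ℝ} (hl : 0 < lam) (A : ℕ → Vec d) (t : ℕ) : 0 ≤ logDet lam A t := by
  rw [← logDet_zero hl A]; exact logDet_mono hl A (Nat.zero_le t)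

theorem trace_gram_le {lam : ℝ} (A : ℕ → Vec d) (t : ℕ)
    (hA : ∀ s ∈ Finset.Icc 1 t, ‖A s‖ ≤ 1) : (gram lam A t).trace ≤ d * lam + t := by
  rw [gram, Matrix.trace_add, Matrix.trace_smul, Matrix.trace_one, Matrix.trace_sum]
  have : ∑ s ∈ Finset.Icc 1 t, (outer (A s)).trace ≤ ∑ s ∈ Finset.Icc 1 t, (1 : ℝ) := by
    refine Finset.sum_le_sum fun s hs => ?_
    rw [outer, Matrix.trace_vecMulVec, ← norm_sq_eq_dotProduct]
    have := hA s hs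
    nlinarith [norm_nonneg (A s)]
  simp at this ⊢
  linarith

/-- Every eigenvalue of `V_t` is at most the trace `dλ + t`. -/
theorem logDet_le {lam : ℝ} (hl : 0 < lam) (A : ℕ → Vec d) (t : ℕ)
    (hA : ∀ s ∈ Finset.Icc 1 t, ‖A s‖ ≤ 1) : logDet lam A t ≤ d * Real.log (d + t / lam) := by
  rcases Nat.eq_zero_or_pos d with hd | hd
  · subst hd; simp [logDet, Matrix.det_fin_zero]
  have hV := gram_posDef hl A t
  have h1 : (gram lam A t).det ≤ (d * lam + t) ^ d := by
    rw [hV.1.det_eq_prod_eigenvalues]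
    calc _ ≤ ∏ _i : Fin d, ((d : ℝ) * lam + t) := by
          refine Finset.prod_le_prod (fun i _ => (hV.posSemidef.eigenvalues_nonneg i)) fun i _ => ?_
          refine le_trans ?_ (trace_gram_le A t hA)
          rw [hV.1.trace_eq_sum_eigenvalues]
          exact Finset.single_le_sum (f := fun i => ((hV.1.eigenvalues i : ℝ)))
            (fun i _ => hV.posSemidef.eigenvalues_nonneg i) (Finset.mem_univ i)
      _ = _ := by simp
  have h0 : (gram lam A 0).det = lam ^ d := by simp [gram_zero]
  rw [logDet, h0, ← Real.log_pow]
  refine Real.log_le_log (div_pos hV.det_pos (by positivity)) ?_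
  rw [div_le_iff₀ (by positivity), ← mul_pow]
  refine h1.trans (le_of_eq ?_)
  congr 1
  field_simp

/-! ### The estimation error -/

/-- The estimation error `θ - θ̂_t` of the ridge estimator. -/
noncomputable def errVec (lam : ℝ) (θ : Vec d) (A : ℕ → Vec d) (Y : ℕ → ℝ) (t : ℕ) : Vec d :=
  θ - ridge lam A Y t

/-- The martingale part `∑_{s ≤ t} η_s A_s` of the estimation error. -/
noncomputable def noiseSum (θ : Vec d) (A : ℕ → Vec d) (Y : ℕ → ℝ) (t : ℕ) : Vec d :=
  ∑ s ∈ Finset.Icc 1 t, (Y s - ⟪θ, A s⟫) • A s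

theorem noiseSum_succ (θ : Vec d) (A : ℕ → Vec d) (Y : ℕ → ℝ) (t : ℕ) :
    noiseSum θ A Y (t + 1)
      = noiseSum θ A Y t + (Y (t + 1) - ⟪θ, A (t + 1)⟫) • A (t + 1) := by
  rw [noiseSum, noiseSum, Finset.sum_Icc_succ_top (by omega)]

theorem gram_mulVec (lam : ℝ) (A : ℕ → Vec d) (t : ℕ) (x : Vec d) :
    gram lam A t *ᵥ x.ofLp = lam • x.ofLp + ∑ s ∈ Finset.Icc 1 t, ⟪x, A s⟫ • (A s).ofLp := by
  rw [gram, Matrix.add_mulVec, Matrix.smul_mulVec, Matrix.one_mulVec, Matrix.sum_mulVec]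
  congr 1
  refine Finset.sum_congr rfl fun s _ => ?_
  rw [outer_mulVec, real_inner_comm, inner_eq_dotProduct]

theorem gram_mulVec_errVec {lam : ℝ} (hl : 0 < lam) (θ : Vec d) (A : ℕ → Vec d) (Y : ℕ → ℝ)
    (t : ℕ) :
    gram lam A t *ᵥ (errVec lam θ A Y t).ofLp = (lam • θ - noiseSum θ A Y t).ofLp := by
  rw [errVec, WithLp.ofLp_sub, Matrix.mulVec_sub, gram_mulVec, ridge]
  simp only [mulVec_inv_mulVec (gram_posDef hl A t)]
  simp [noiseSum, sub_smul, WithLp.ofLp_sum]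
  abel

/-- The estimation error is the sum of a noise part and the bias of the regularization. -/
theorem sqNorm_errVec_le {lam : ℝ} (hl : 0 < lam) (θ : Vec d) (A : ℕ → Vec d) (Y : ℕ → ℝ)
    (t : ℕ) :
    sqNorm (gram lam A t) (errVec lam θ A Y t)
      ≤ (√(sqNorm (gram lam A t)⁻¹ (noiseSum θ A Y t)) + √lam * ‖θ‖) ^ 2 := by
  have hV := gram_posDef hl A t
  have h := sqNorm_inv_mulVec hV (errVec lam θ A Y t)
  rw [gram_mulVec_errVec hl] at h
  rw [← h, WithLp.toLp_ofLp, sub_eq_add_neg, add_comm]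
  refine (sqNorm_add_le hV.inv.posSemidef _ _).trans ?_
  have h1 : sqNorm (gram lam A t)⁻¹ (-noiseSum θ A Y t)
      = sqNorm (gram lam A t)⁻¹ (noiseSum θ A Y t) := by
    rw [← neg_one_smul ℝ, sqNorm_smul]; norm_num
  have h2 : √(sqNorm (gram lam A t)⁻¹ (lam • θ)) ≤ √lam * ‖θ‖ := by
    refine Real.sqrt_le_iff.2 ⟨by positivity, (sqNorm_gram_inv_le hl A t _).trans (le_of_eq ?_)⟩
    rw [norm_smul, mul_pow, mul_pow, Real.sq_sqrt hl.le, Real.norm_of_nonneg hl.le]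
    field_simp
  rw [h1]
  gcongr

theorem sqNorm_errVec_zero {lam : ℝ} (θ : Vec d) (A : ℕ → Vec d) (Y : ℕ → ℝ) :
    sqNorm (gram lam A 0) (errVec lam θ A Y 0) = lam * ‖θ‖ ^ 2 := by
  have : ridge lam A Y 0 = 0 := by ext; simp [ridge]
  rw [sqNorm_gram, errVec, this]; simp

/-- The one-step identity of online ridge regression. With `y = ⟨ε, A⟩` the prediction error and
`w = ‖A‖²_{V⁻¹}`, the potential `‖ε‖²_V` decreases by `y² / (1 + w)` up to noise terms. -/
theorem sqNorm_errVec_succ {lam : ℝ} (hl : 0 < lam) (θ : Vec d) (A : ℕ → Vec d) (Y : ℕ → ℝ)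
    (t : ℕ) {y w η : ℝ} (hy : y = ⟪errVec lam θ A Y t, A (t + 1)⟫)
    (hw : w = sqNorm (gram lam A t)⁻¹ (A (t + 1))) (hη : η = Y (t + 1) - ⟪θ, A (t + 1)⟫) :
    sqNorm (gram lam A (t + 1)) (errVec lam θ A Y (t + 1))
      = sqNorm (gram lam A t) (errVec lam θ A Y t)
        + (-2 * η * y - y ^ 2 + η ^ 2 * w) / (1 + w) := by
  have hV := gram_posDef hl A t
  have hV' := gram_posDef hl A (t + 1)
  have hw0 : 0 ≤ w := hw ▸ sqNorm_nonneg hV.inv.posSemidef _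
  have hw1 : (1 + w) ≠ 0 := by positivity
  set V := gram lam A t with hVdef
  set V' := gram lam A (t + 1) with hV'def
  set ε := errVec lam θ A Y t with hε
  set a := A (t + 1) with ha
  set h : Fin d → ℝ := V⁻¹ *ᵥ a.ofLp with hh
  have hVh : V *ᵥ h = a.ofLp := mulVec_inv_mulVec hV _
  have hah : a.ofLp ⬝ᵥ h = w := by rw [hw]; rfl
  have hya : a.ofLp ⬝ᵥ ε.ofLp = y := by rw [hy, real_inner_comm, inner_eq_dotProduct]
  have hVε : V' *ᵥ (errVec lam θ A Y (t + 1)).ofLp = V *ᵥ ε.ofLp - η • a.ofLp := by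
    rw [hV'def, gram_mulVec_errVec hl, hVdef, hε, gram_mulVec_errVec hl, noiseSum_succ, hη]
    simp [sub_sub, ha]
  have hV'eq : V' = V + outer a := gram_succ lam A t
  have hkey : (errVec lam θ A Y (t + 1)).ofLp = ε.ofLp - ((y + η) / (1 + w)) • h := by
    have : V' *ᵥ (ε.ofLp - ((y + η) / (1 + w)) • h) = V *ᵥ ε.ofLp - η • a.ofLp := by
      rw [hV'eq, Matrix.add_mulVec, Matrix.mulVec_sub, Matrix.mulVec_smul, hVh, outer_mulVec,
        dotProduct_sub, dotProduct_smul, hya, hah]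
      ext i
      simp
      field_simp
      ring
    rw [← inv_mulVec_mulVec hV' (errVec lam θ A Y (t + 1)).ofLp, hVε, ← this,
      inv_mulVec_mulVec hV']
  rw [sqNorm, hVε, hkey]
  have hhV : h ⬝ᵥ (V *ᵥ ε.ofLp) = y := by
    rw [dotProduct_mulVec_comm hV.1, hVh, dotProduct_comm, hya]
  simp only [sub_dotProduct, dotProduct_sub, smul_dotProduct, dotProduct_smul, smul_eq_mul, hhV,
    dotProduct_comm ε.ofLp a.ofLp, dotProduct_comm h a.ofLp, hya, hah, sqNorm]
  field_simp
  ring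

/-- A pathwise bound, too weak for the regret, which makes the potential integrable. -/
theorem sqNorm_errVec_le_sum {lam : ℝ} (hl : 0 < lam) (θ : Vec d) (A : ℕ → Vec d) (Y : ℕ → ℝ)
    (t : ℕ) :
    sqNorm (gram lam A t) (errVec lam θ A Y t)
      ≤ lam * ‖θ‖ ^ 2 + ∑ s ∈ Finset.Icc 1 t, (Y s - ⟪θ, A s⟫) ^ 2 := by
  induction t with
  | zero => simp [sqNorm_errVec_zero]
  | succ t ih =>
    rw [sqNorm_errVec_succ hl θ A Y t rfl rfl rfl, Finset.sum_Icc_succ_top (by omega)]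
    set w := sqNorm (gram lam A t)⁻¹ (A (t + 1))
    set y := ⟪errVec lam θ A Y t, A (t + 1)⟫
    set η := Y (t + 1) - ⟪θ, A (t + 1)⟫
    have hw : 0 ≤ w := sqNorm_nonneg (gram_posDef hl A t).inv.posSemidef _
    have : (-2 * η * y - y ^ 2 + η ^ 2 * w) / (1 + w) ≤ η ^ 2 := by
      rw [div_le_iff₀ (by positivity)]
      nlinarith [sq_nonneg (η + y)]
    linarith

/-! ### What the design controls -/

theorem designCov_posSemidef {B : Finset (Vec d)} {q : Vec d → ℝ} (hq : ∀ b ∈ B, 0 ≤ q b) :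
    (designCov B q).PosSemidef := by
  unfold designCov
  exact Matrix.posSemidef_sum _ fun b hb => (outer_posSemidef b).smul (hq b hb)

theorem sqNorm_designCov (B : Finset (Vec d)) (q : Vec d → ℝ) (e : Vec d) :
    sqNorm (designCov B q) e = ∑ b ∈ B, q b * ⟪e, b⟫ ^ 2 := by
  rw [sqNorm, designCov, Matrix.sum_mulVec, dotProduct_sum]
  refine Finset.sum_congr rfl fun b _ => ?_
  rw [Matrix.smul_mulVec, outer_mulVec, dotProduct_smul, dotProduct_smul, inner_eq_dotProduct,
    dotProduct_comm b.ofLp]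
  simp [sq]

/-- An optimal design controls every linear functional on the design set by its second moment
under the design. -/
theorem IsOptimalDesign.inner_sq_le {Copt : ℝ} {B : Finset (Vec d)} {q : Vec d → ℝ}
    (h : IsOptimalDesign Copt B q) {b : Vec d} (hb : b ∈ B) (e : Vec d) :
    ⟪e, b⟫ ^ 2 ≤ Copt * d * Real.log d * ∑ b' ∈ B, q b' * ⟪e, b'⟫ ^ 2 := by
  obtain ⟨⟨hq, -⟩, hlev⟩ := h
  obtain ⟨z, hz, hzb⟩ := hlev b hb
  have hM := designCov_posSemidef hq
  have h1 := dotProduct_mulVec_sq_le hM e (WithLp.toLp 2 z)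
  have h2 : sqNorm (designCov B q) (WithLp.toLp 2 z) ≤ Copt * d * Real.log d := by
    simp only [sqNorm, hz]; rwa [dotProduct_comm]
  have h3 := sqNorm_nonneg hM e
  simp only [hz] at h1
  rw [← sqNorm_designCov, inner_eq_dotProduct]
  nlinarith

section Augmented

variable {Copt Csupp : ℝ} {j : ℕ} {oracle : Finset (Vec d) → Vec d → ℝ} {ver : Version}
  {s : Finset (Vec d)} {f qopt : Vec d → ℝ}

theorem IsAugmentedDesign.nonneg (hO : IsApproxDesign Copt Csupp j oracle)
    (h : IsAugmentedDesign oracle ver s f qopt) {a : Vec d} (ha : a ∈ s) : 0 ≤ qopt a := by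
  classical
  cases ver with
  | rescale => exact h.1 a ha
  | eliminate =>
    rw [h a ha]
    split_ifs with hf
    · have hm : a ∈ s.filter (fun a => 1 / Real.exp 1 ≤ f a) := Finset.mem_filter.2 ⟨ha, hf⟩
      convert (hO _ ⟨a, hm⟩).1.1.1 a hm
    · exact le_rfl

theorem IsAugmentedDesign.sum_eq_one (hO : IsApproxDesign Copt Csupp j oracle)
    (h : IsAugmentedDesign oracle ver s f qopt) {a₀ : Vec d} (ha₀ : a₀ ∈ s) (hf₀ : f a₀ = 1) :
    ∑ a ∈ s, qopt a = 1 := by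
  classical
  cases ver with
  | rescale =>
    have hne : (s.image (fun a => √(f a) • a)).Nonempty := ⟨_, Finset.mem_image_of_mem _ ha₀⟩
    rw [← (hO _ hne).1.1.2,
      ← Finset.sum_fiberwise_of_maps_to (t := s.image (fun a => √(f a) • a))
        (fun a ha => Finset.mem_image_of_mem _ ha)]
    refine Finset.sum_congr rfl fun b hb => ?_
    convert h.2 b (by convert hb)
  | eliminate =>
    have hm : a₀ ∈ s.filter (fun a => 1 / Real.exp 1 ≤ f a) := by
      refine Finset.mem_filter.2 ⟨ha₀, ?_⟩
      rw [hf₀, div_le_one (Real.exp_pos 1)]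
      exact Real.one_le_exp zero_le_one
    rw [← (hO _ ⟨a₀, hm⟩).1.1.2, Finset.sum_filter]
    refine Finset.sum_congr rfl fun a ha => ?_
    rw [h a ha]

/-- Both augmented designs control a linear functional at an arm, up to the weight of that arm, by
the weighted second moment. In the eliminating version only the surviving arms are controlled. -/
theorem IsAugmentedDesign.weighted_inner_sq_le (hO : IsApproxDesign Copt Csupp j oracle)
    (hC : 0 ≤ Copt) (h : IsAugmentedDesign oracle ver s f qopt)
    (hf : ∀ a ∈ s, 0 < f a ∧ f a ≤ 1) (e : Vec d) {a : Vec d} (ha : a ∈ s)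
    (hver : ver = Version.eliminate → 1 / Real.exp 1 ≤ f a) :
    f a * ⟪e, a⟫ ^ 2
      ≤ Real.exp 1 * (Copt * d * Real.log d) * ∑ b ∈ s, qopt b * f b * ⟪e, b⟫ ^ 2 := by
  classical
  have hK : 0 ≤ Copt * d * Real.log d :=
    mul_nonneg (mul_nonneg hC d.cast_nonneg) (Real.log_natCast_nonneg d)
  have hq : ∀ b ∈ s, 0 ≤ qopt b := fun b hb => IsAugmentedDesign.nonneg hO h hb
  have hS : 0 ≤ ∑ b ∈ s, qopt b * f b * ⟪e, b⟫ ^ 2 :=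
    Finset.sum_nonneg fun b hb => mul_nonneg (mul_nonneg (hq b hb) (hf b hb).1.le) (sq_nonneg _)
  have he : (1 : ℝ) ≤ Real.exp 1 := Real.one_le_exp zero_le_one
  have hsc : ∀ b ∈ s, ⟪e, √(f b) • b⟫ ^ 2 = f b * ⟪e, b⟫ ^ 2 := by
    intro b hb
    rw [real_inner_smul_right, mul_pow, Real.sq_sqrt (hf b hb).1.le]
  cases ver with
  | rescale =>
    have hm : √(f a) • a ∈ s.image (fun a => √(f a) • a) := Finset.mem_image_of_mem _ ha
    have h1 := (hO _ ⟨_, hm⟩).1.inner_sq_le hm e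
    rw [hsc a ha] at h1
    have h2 : ∑ b' ∈ s.image (fun a => √(f a) • a),
        oracle (s.image (fun a => √(f a) • a)) b' * ⟪e, b'⟫ ^ 2
          = ∑ b ∈ s, qopt b * f b * ⟪e, b⟫ ^ 2 := by
      rw [← Finset.sum_fiberwise_of_maps_to (s := s) (t := s.image (fun a => √(f a) • a))
        (fun a ha => Finset.mem_image_of_mem _ ha)]
      refine Finset.sum_congr rfl fun b hb => ?_
      have h3 : ∑ a ∈ s.filter (fun a => √(f a) • a = b), qopt a
          = oracle (s.image (fun a => √(f a) • a)) b := by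
        convert h.2 b (by convert hb)
      rw [← h3, Finset.sum_mul]
      refine Finset.sum_congr rfl fun c hc => ?_
      obtain ⟨hcs, rfl⟩ := Finset.mem_filter.1 hc
      rw [hsc c hcs, mul_assoc]
    rw [h2] at h1
    refine h1.trans (mul_le_mul_of_nonneg_right ?_ hS)
    nlinarith
  | eliminate =>
    have hm : a ∈ s.filter (fun a => 1 / Real.exp 1 ≤ f a) :=
      Finset.mem_filter.2 ⟨ha, hver rfl⟩
    have h1 := (hO _ ⟨_, hm⟩).1.inner_sq_le hm e
    have h2 : ∑ b' ∈ s.filter (fun a => 1 / Real.exp 1 ≤ f a),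
        oracle (s.filter (fun a => 1 / Real.exp 1 ≤ f a)) b' * ⟪e, b'⟫ ^ 2
          ≤ Real.exp 1 * ∑ b ∈ s, qopt b * f b * ⟪e, b⟫ ^ 2 := by
      rw [Finset.sum_filter, Finset.mul_sum]
      refine Finset.sum_le_sum fun b hb => ?_
      have hqb : qopt b = if 1 / Real.exp 1 ≤ f b then
          oracle (s.filter (fun a => 1 / Real.exp 1 ≤ f a)) b else 0 := by
        rw [h b hb]
      have hq0 := hq b hb
      split_ifs with hfb
      · rw [if_pos hfb] at hqb
        rw [← hqb]
        rw [div_le_iff₀' (Real.exp_pos 1)] at hfb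
        have := mul_nonneg hq0 (sq_nonneg ⟪e, b⟫)
        nlinarith
      · exact mul_nonneg (Real.exp_pos 1).le
          (mul_nonneg (mul_nonneg hq0 (hf b hb).1.le) (sq_nonneg _))
    have h3 : f a * ⟪e, a⟫ ^ 2 ≤ ⟪e, a⟫ ^ 2 :=
      mul_le_of_le_one_left (sq_nonneg _) (hf a ha).2
    calc _ ≤ _ := h3.trans h1
      _ ≤ _ := mul_le_mul_of_nonneg_left h2 hK
      _ = _ := by ring

end Augmented

/-! ### The sampling probabilities -/

theorem logDet_add_log_nonneg {lam : ℝ} (hl : 0 < lam) (A : ℕ → Vec d) (t : ℕ) :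
    0 ≤ logDet lam A t + 2 * Real.log (1 / failureRate t) := by
  have h1 := logDet_nonneg hl A t
  have h2 : 0 ≤ Real.log (1 / failureRate t) := by
    rw [failureRate, one_div_one_div]
    exact Real.log_nonneg (by linarith [(Nat.cast_nonneg t : (0 : ℝ) ≤ t)])
  linarith

theorem radius_pos {lam s R : ℝ} (hl : 0 < lam) (hs : 0 ≤ s) (hR : 0 < R) (A : ℕ → Vec d)
    (t : ℕ) : 0 < radius lam s R A t := by
  unfold radius
  positivity

theorem radius_nonneg (lam s R : ℝ) (A : ℕ → Vec d) (t : ℕ) : 0 ≤ radius lam s R A t :=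
  sq_nonneg _

theorem weight_self (I : Input) (A : ℕ → Vec d) (Y : ℕ → ℝ) (t : ℕ) (a : Vec d) :
    weight I A Y t a a = 1 := by simp [weight]

theorem weight_pos (I : Input) (A : ℕ → Vec d) (Y : ℕ → ℝ) (t : ℕ) (ahat a : Vec d) :
    0 < weight I A Y t ahat a := Real.exp_pos _

theorem weight_le_one {I : Input} (hI : I.Valid) (A : ℕ → Vec d) (Y : ℕ → ℝ) (t : ℕ)
    (ahat a : Vec d) : weight I A Y t ahat a ≤ 1 := by
  rw [weight, Real.exp_le_one_iff, neg_nonpos]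
  exact div_nonneg (sq_nonneg _) (mul_nonneg (radius_nonneg _ _ _ _ _)
    (sqNorm_nonneg (gram_posDef hI.lam_pos A _).inv.posSemidef _))

section Probabilities

variable {I : Input} {s : Finset (Vec d)} {qopt : Vec d → ℝ} {ahat : Vec d}

theorem mixture_ge_opt (hI : I.Valid) {a : Vec d} : I.αopt * qopt a ≤ mixture I s qopt ahat a := by
  have h1 := hI.sum_le_one
  have h2 := hI.αemp_pos
  have h4 : 0 ≤ (1 - I.αopt - I.αemp) * (1 / (s.card : ℝ)) :=
    mul_nonneg (by linarith) (by positivity)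
  unfold mixture
  split_ifs <;> linarith

theorem mixture_nonneg (hI : I.Valid) (hq : ∀ a ∈ s, 0 ≤ qopt a) {a : Vec d} (ha : a ∈ s) :
    0 ≤ mixture I s qopt ahat a :=
  (mul_nonneg hI.αopt_pos.le (hq a ha)).trans (mixture_ge_opt hI)

theorem mixture_self_ge (hI : I.Valid) (hq : ∀ a ∈ s, 0 ≤ qopt a) (ha : ahat ∈ s) :
    I.αemp ≤ mixture I s qopt ahat ahat := by
  have h1 := hI.sum_le_one
  have h2 := mul_nonneg hI.αopt_pos.le (hq ahat ha)
  have h4 : 0 ≤ (1 - I.αopt - I.αemp) * (1 / (s.card : ℝ)) :=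
    mul_nonneg (by linarith) (by positivity)
  unfold mixture
  rw [if_pos rfl]
  linarith

theorem sum_mixture (hq : ∑ a ∈ s, qopt a = 1) (ha : ahat ∈ s) :
    ∑ a ∈ s, mixture I s qopt ahat a = 1 := by
  have hc : (s.card : ℝ) ≠ 0 := by
    have := Finset.card_pos.2 ⟨ahat, ha⟩
    positivity
  simp only [mixture, Finset.sum_add_distrib, ← Finset.mul_sum, hq, Finset.sum_ite_eq', ha,
    if_true, Finset.sum_const, nsmul_eq_mul]
  field_simp
  ring

variable {A : ℕ → Vec d} {Y : ℕ → ℝ} {t : ℕ}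

theorem normalizer_le_one (hI : I.Valid) (hq : ∀ a ∈ s, 0 ≤ qopt a) (hq1 : ∑ a ∈ s, qopt a = 1)
    (ha : ahat ∈ s) : ∑ b ∈ s, mixture I s qopt ahat b * weight I A Y t ahat b ≤ 1 := by
  rw [← sum_mixture (I := I) hq1 ha]
  exact Finset.sum_le_sum fun b hb =>
    mul_le_of_le_one_right (mixture_nonneg hI hq hb) (weight_le_one hI _ _ _ _ _)

theorem normalizer_ge (hI : I.Valid) (hq : ∀ a ∈ s, 0 ≤ qopt a) (ha : ahat ∈ s) :
    I.αemp ≤ ∑ b ∈ s, mixture I s qopt ahat b * weight I A Y t ahat b := by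
  calc I.αemp ≤ mixture I s qopt ahat ahat * weight I A Y t ahat ahat := by
        rw [weight_self, mul_one]; exact mixture_self_ge hI hq ha
    _ ≤ _ := Finset.single_le_sum (f := fun b => mixture I s qopt ahat b * weight I A Y t ahat b)
        (fun b hb => mul_nonneg (mixture_nonneg hI hq hb) (weight_pos _ _ _ _ _ _).le) ha

theorem baseProb_nonneg (hI : I.Valid) (hq : ∀ a ∈ s, 0 ≤ qopt a) (hs : ahat ∈ s) {a : Vec d}
    (ha : a ∈ s) : 0 ≤ baseProb I A Y t s qopt ahat a :=
  div_nonneg (mul_nonneg (mixture_nonneg hI hq ha) (weight_pos _ _ _ _ _ _).le)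
    (hI.αemp_pos.le.trans (normalizer_ge hI hq hs))

theorem sum_baseProb (hI : I.Valid) (hq : ∀ a ∈ s, 0 ≤ qopt a) (hs : ahat ∈ s) :
    ∑ a ∈ s, baseProb I A Y t s qopt ahat a = 1 := by
  simp only [baseProb]
  rw [← Finset.sum_div]
  exact div_self (hI.αemp_pos.trans_le (normalizer_ge hI hq hs)).ne'

theorem baseProb_ge (hI : I.Valid) (hq : ∀ a ∈ s, 0 ≤ qopt a) (hq1 : ∑ a ∈ s, qopt a = 1)
    (hs : ahat ∈ s) {a : Vec d} (ha : a ∈ s) :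
    mixture I s qopt ahat a * weight I A Y t ahat a ≤ baseProb I A Y t s qopt ahat a := by
  rw [baseProb, le_div_iff₀ (hI.αemp_pos.trans_le (normalizer_ge hI hq hs))]
  exact mul_le_of_le_one_right (mul_nonneg (mixture_nonneg hI hq ha) (weight_pos _ _ _ _ _ _).le)
    (normalizer_le_one hI hq hq1 hs)

theorem sampleProb_eq_baseProb {bsel a : Vec d}
    (hreg : ∀ a ∈ s, sqNorm (gram I.lam A (t - 1))⁻¹ a ≤ 1) :
    sampleProb I A Y t s qopt ahat bsel a = baseProb I A Y t s qopt ahat a := by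
  rw [sampleProb, if_neg]
  rintro ⟨b, hb, hb1⟩
  exact absurd (hreg b hb) (not_le.2 hb1)

theorem sampleProb_nonneg (hI : I.Valid) (hq : ∀ a ∈ s, 0 ≤ qopt a) (hs : ahat ∈ s)
    {a bsel : Vec d} (ha : a ∈ s) : 0 ≤ sampleProb I A Y t s qopt ahat bsel a := by
  have := baseProb_nonneg (A := A) (Y := Y) (t := t) hI hq hs ha
  unfold sampleProb
  split_ifs <;> linarith

end Probabilities

/-! ### The regret of a single round -/

theorem gap_nonneg {θ : Vec d} {s : Finset (Vec d)} {a : Vec d} (ha : a ∈ s) : 0 ≤ gap θ s a := by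
  rw [gap, bestValue, sub_nonneg]
  exact le_csSup ((s.finite_toSet.image _).bddAbove) ⟨a, ha, rfl⟩

theorem exists_gap_eq (θ : Vec d) {s : Finset (Vec d)} (hs : s.Nonempty) :
    ∃ b ∈ s, ∀ a, gap θ s a = ⟪θ, b⟫ - ⟪θ, a⟫ := by
  have h : bestValue θ s ∈ (fun a : Vec d => ⟪θ, a⟫) '' (s : Set (Vec d)) :=
    (Set.Nonempty.image _ hs).csSup_mem (s.finite_toSet.image _)
  obtain ⟨b, hb, hb'⟩ := h
  exact ⟨b, hb, fun a => by rw [gap, ← hb']⟩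

/-- Truncation of `x exp (-x²)` at the level `x = √(log M)`, in homogeneous form. -/
theorem mul_exp_neg_sq_div_le {D N M : ℝ} (hN : 0 < N) (hM : 1 ≤ M) :
    D * Real.exp (-(D ^ 2 / N)) ≤ √N * (√(Real.log M) * Real.exp (-(D ^ 2 / N)) + 1 / √M) := by
  have hM0 : 0 < M := by linarith
  have hsN := Real.sqrt_pos.2 hN
  have hsM := Real.sqrt_pos.2 hM0
  rcases le_total (D ^ 2) (N * Real.log M) with h | h
  · have h1 : D ≤ √N * √(Real.log M) := by
      rw [← Real.sqrt_mul hN.le]; exact Real.le_sqrt_of_sq_le h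
    have h2 := Real.exp_pos (-(D ^ 2 / N))
    have h3 : 0 ≤ √N * (1 / √M) := by positivity
    nlinarith
  · have h1 : Real.exp (-(D ^ 2 / N))
        = Real.exp (-(D ^ 2 / N) / 2) * Real.exp (-(D ^ 2 / N) / 2) := by
      rw [← Real.exp_add]; congr 1; ring
    have h2 : D * Real.exp (-(D ^ 2 / N) / 2) ≤ √N := by
      refine Real.le_sqrt_of_sq_le ?_
      have h3 : (D * Real.exp (-(D ^ 2 / N) / 2)) ^ 2 = D ^ 2 * Real.exp (-(D ^ 2 / N)) := by
        rw [h1]; ring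
      rw [h3, Real.exp_neg, ← div_eq_mul_inv, div_le_iff₀ (Real.exp_pos _)]
      have h4 := Real.add_one_le_exp (D ^ 2 / N)
      calc D ^ 2 = N * (D ^ 2 / N) := by field_simp
        _ ≤ _ := by gcongr; linarith
    have h5 : Real.exp (-(D ^ 2 / N) / 2) ≤ 1 / √M := by
      rw [one_div, ← Real.exp_log hsM, ← Real.exp_neg, Real.exp_le_exp, Real.log_sqrt hM0.le]
      have : Real.log M ≤ D ^ 2 / N := by rw [le_div_iff₀ hN]; linarith
      linarith
    have h6 : D * Real.exp (-(D ^ 2 / N)) ≤ √N * (1 / √M) := by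
      rw [h1, ← mul_assoc]
      exact mul_le_mul h2 h5 (Real.exp_pos _).le hsN.le
    have h7 : 0 ≤ √N * (√(Real.log M) * Real.exp (-(D ^ 2 / N))) := by positivity
    linarith

section Round

variable {I : Input} {s : Finset (Vec d)} {qopt : Vec d → ℝ} {ahat : Vec d}
  {A : ℕ → Vec d} {Y : ℕ → ℝ} {t : ℕ} {θ : Vec d} {sigStar : ℝ}

/-- On the event that `θ` lies in the true confidence ellipsoid, the weight of an arm that beats
`â_t` in mean is bounded below in terms of the ratio of the radii. -/
theorem exp_neg_le_weight (hI : I.Valid)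
    (hbest : ∀ a ∈ s, ⟪ridge I.lam A Y (t - 1), a⟫ ≤ ⟪ridge I.lam A Y (t - 1), ahat⟫)
    (hgood : sqNorm (gram I.lam A (t - 1)) (errVec I.lam θ A Y (t - 1))
      ≤ radius I.lam sigStar ‖θ‖ A (t - 1))
    {a : Vec d} (ha : a ∈ s) (hbeat : ⟪θ, ahat⟫ ≤ ⟪θ, a⟫) :
    Real.exp (-(radius I.lam sigStar ‖θ‖ A (t - 1) / radius I.lam I.sig I.S A (t - 1)))
      ≤ weight I A Y t ahat a := by
  set W := (gram I.lam A (t - 1))⁻¹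
  set r := ridge I.lam A Y (t - 1) with hr
  set ε := errVec I.lam θ A Y (t - 1) with hε
  have hV := gram_posDef hI.lam_pos A (t - 1)
  have hβ := radius_pos hI.lam_pos hI.sig_pos.le hI.S_pos A (t - 1)
  have hw : 0 ≤ sqNorm W (ahat - a) := sqNorm_nonneg hV.inv.posSemidef _
  have hεθ : ε = θ - r := rfl
  have h1 : 0 ≤ ⟪r, ahat - a⟫ := by rw [inner_sub_right]; linarith [hbest a ha]
  have h2 : ⟪r, ahat - a⟫ ≤ -⟪ε, ahat - a⟫ := by
    rw [hεθ, inner_sub_left, inner_sub_right θ]; linarith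
  have h3 : ⟪r, ahat - a⟫ ^ 2 ≤ radius I.lam sigStar ‖θ‖ A (t - 1) * sqNorm W (ahat - a) := by
    calc _ ≤ ⟪ε, ahat - a⟫ ^ 2 := by nlinarith
      _ ≤ _ := inner_sq_le hV ε _
      _ ≤ _ := mul_le_mul_of_nonneg_right hgood hw
  rw [weight, Real.exp_le_exp, neg_le_neg_iff]
  rcases hw.eq_or_lt with h0 | h0
  · rw [← h0, mul_zero, div_zero]
    exact div_nonneg (radius_nonneg _ _ _ _ _) hβ.le
  · rw [div_le_div_iff₀ (by positivity) hβ]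
    nlinarith

/-- The estimated gaps of the sampled arms. -/
theorem sum_baseProb_mul_estGap_le (hI : I.Valid) (hq : ∀ a ∈ s, 0 ≤ qopt a)
    (hq1 : ∑ a ∈ s, qopt a = 1) (hs : ahat ∈ s)
    (hreg : ∀ a ∈ s, sqNorm (gram I.lam A (t - 1))⁻¹ a ≤ 1)
    {β M : ℝ} (hβ : radius I.lam I.sig I.S A (t - 1) ≤ β) (hM : 1 ≤ M) :
    ∑ a ∈ s, baseProb I A Y t s qopt ahat a * ⟪ridge I.lam A Y (t - 1), ahat - a⟫
      ≤ √β * √(Real.log M) * (√2 * (1 + 1 / I.αemp))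
          * ∑ a ∈ s, baseProb I A Y t s qopt ahat a * √(sqNorm (gram I.lam A (t - 1))⁻¹ a)
        + 2 * √β / (I.αemp * √M) := by
  set W := (gram I.lam A (t - 1))⁻¹ with hWdef
  set r := ridge I.lam A Y (t - 1) with hr
  set p := baseProb I A Y t s qopt ahat with hp
  have hW : W.PosDef := (gram_posDef hI.lam_pos A (t - 1)).inv
  have hβ0 := radius_pos hI.lam_pos hI.sig_pos.le hI.S_pos A (t - 1)
  have hαe := hI.αemp_pos
  have hM0 : 0 < M := by linarith
  have hsM := Real.sqrt_pos.2 hM0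
  have hp0 : ∀ a ∈ s, 0 ≤ p a := fun a ha => baseProb_nonneg hI hq hs ha
  have hp1 : ∑ a ∈ s, p a = 1 := sum_baseProb hI hq hs
  have hpe : I.αemp ≤ p ahat := by
    have := baseProb_ge (A := A) (Y := Y) (t := t) hI hq hq1 hs hs
    rw [weight_self, mul_one] at this
    exact (mixture_self_ge hI hq hs).trans this
  set Z := ∑ b ∈ s, mixture I s qopt ahat b * weight I A Y t ahat b with hZ
  have hZe : I.αemp ≤ Z := normalizer_ge hI hq hs
  have hZ0 : 0 < Z := hαe.trans_le hZe
  have hm0 : ∀ a ∈ s, 0 ≤ mixture I s qopt ahat a := fun a ha => mixture_nonneg hI hq ha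
  have hpoint : ∀ a ∈ s, p a * ⟪r, ahat - a⟫
      ≤ √β * √(Real.log M) * √2 * (p a * (√(sqNorm W ahat) + √(sqNorm W a)))
        + 2 * √β / √M * (mixture I s qopt ahat a / Z) := by
    intro a ha
    have hmz : 0 ≤ mixture I s qopt ahat a / Z := div_nonneg (hm0 a ha) hZ0.le
    by_cases hae : ahat - a = 0
    · rw [hae, inner_zero_right, mul_zero]
      have := hp0 a ha
      positivity
    have hw0 : 0 < sqNorm W (ahat - a) := sqNorm_pos hW hae
    set N := radius I.lam I.sig I.S A (t - 1) * sqNorm W (ahat - a) with hN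
    have hN0 : 0 < N := by positivity
    have h1 := mul_exp_neg_sq_div_le (D := ⟪r, ahat - a⟫) hN0 hM
    have hf : Real.exp (-(⟪r, ahat - a⟫ ^ 2 / N)) = weight I A Y t ahat a := rfl
    rw [hf] at h1
    have h2 : √N ≤ √β * √(sqNorm W (ahat - a)) := by
      rw [hN, Real.sqrt_mul hβ0.le]
      gcongr
    have hwle := sqNorm_sub_le hW.posSemidef ahat a
    have hnn1 := sqNorm_nonneg hW.posSemidef ahat
    have hnn2 := sqNorm_nonneg hW.posSemidef a
    have h3 : √(sqNorm W (ahat - a)) ≤ √2 * (√(sqNorm W ahat) + √(sqNorm W a)) := by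
      refine Real.sqrt_le_iff.2 ⟨by positivity, ?_⟩
      rw [mul_pow, Real.sq_sqrt zero_le_two, add_sq, Real.sq_sqrt hnn1, Real.sq_sqrt hnn2]
      have : 0 ≤ √(sqNorm W ahat) * √(sqNorm W a) := by positivity
      linarith
    have h4 : √(sqNorm W (ahat - a)) ≤ 2 := by
      refine Real.sqrt_le_iff.2 ⟨by norm_num, ?_⟩
      have := hreg ahat hs
      have := hreg a ha
      linarith
    have hpa : p a = mixture I s qopt ahat a / Z * weight I A Y t ahat a := by
      rw [hp, baseProb]; ring
    have hf0 := (weight_pos I A Y t ahat a).le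
    calc p a * ⟪r, ahat - a⟫
        = mixture I s qopt ahat a / Z * (⟪r, ahat - a⟫ * weight I A Y t ahat a) := by
          rw [hpa]; ring
      _ ≤ mixture I s qopt ahat a / Z * ((√β * √(sqNorm W (ahat - a)))
            * (√(Real.log M) * weight I A Y t ahat a + 1 / √M)) := by
          refine mul_le_mul_of_nonneg_left (h1.trans ?_) hmz
          exact mul_le_mul_of_nonneg_right h2 (by positivity)
      _ = √β * √(Real.log M) * (p a * √(sqNorm W (ahat - a)))
            + √β / √M * (mixture I s qopt ahat a / Z) * √(sqNorm W (ahat - a)) := by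
          rw [hpa]; ring
      _ ≤ √β * √(Real.log M) * (p a * (√2 * (√(sqNorm W ahat) + √(sqNorm W a))))
            + √β / √M * (mixture I s qopt ahat a / Z) * 2 := by
          have := hp0 a ha
          gcongr
      _ = _ := by ring
  have hsum := Finset.sum_le_sum hpoint
  refine hsum.trans ?_
  rw [Finset.sum_add_distrib, ← Finset.mul_sum, ← Finset.mul_sum, ← Finset.sum_div,
    sum_mixture hq1 hs]
  simp only [mul_add, Finset.sum_add_distrib]
  rw [← Finset.sum_mul, hp1, one_mul]
  have h5 : √(sqNorm W ahat) ≤ 1 / I.αemp * ∑ a ∈ s, p a * √(sqNorm W a) := by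
    rw [one_div, ← div_eq_inv_mul, le_div_iff₀ hαe]
    calc √(sqNorm W ahat) * I.αemp ≤ p ahat * √(sqNorm W ahat) := by
          rw [mul_comm]; gcongr
      _ ≤ _ := Finset.single_le_sum (f := fun a => p a * √(sqNorm W a))
        (fun a ha => mul_nonneg (hp0 a ha) (Real.sqrt_nonneg _)) hs
  have h6 : 2 * √β / √M * (1 / Z) ≤ 2 * √β / (I.αemp * √M) := by
    rw [mul_comm I.αemp, ← div_div, div_eq_mul_one_div _ I.αemp]
    gcongr
  have h7 : √β * √(Real.log M) * √2 * √(sqNorm W ahat)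
      ≤ √β * √(Real.log M) * √2 * (1 / I.αemp * ∑ a ∈ s, p a * √(sqNorm W a)) := by gcongr
  refine (add_le_add (add_le_add_left h7 _) h6).trans (le_of_eq ?_)
  ring

/-- The expected regret of a round in which all arms are explored and `θ` lies in the true
confidence ellipsoid, in terms of the mean squared prediction error `∑ p ⟨ε, a⟩²` and the mean
width `∑ p ‖a‖_{V⁻¹}` of the sampled arm. The best arm is controlled by the design applied to the
functional `⟨ε, ·⟩` rather than to the norm `‖·‖_{V⁻¹}`; this avoids an extra factor `√d`. -/
theorem sum_baseProb_mul_gap_le {Copt Csupp : ℝ} {j : ℕ} {oracle : Finset (Vec d) → Vec d → ℝ}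
    (hO : IsApproxDesign Copt Csupp j oracle) (hC : 0 ≤ Copt) (hI : I.Valid) (hs : ahat ∈ s)
    (hdes : IsAugmentedDesign oracle I.ver s (weight I A Y t ahat) qopt)
    (hbest : ∀ a ∈ s, ⟪ridge I.lam A Y (t - 1), a⟫ ≤ ⟪ridge I.lam A Y (t - 1), ahat⟫)
    (hreg : ∀ a ∈ s, sqNorm (gram I.lam A (t - 1))⁻¹ a ≤ 1)
    (hgood : sqNorm (gram I.lam A (t - 1)) (errVec I.lam θ A Y (t - 1))
      ≤ radius I.lam sigStar ‖θ‖ A (t - 1))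
    (hver : I.ver = Version.eliminate →
      radius I.lam sigStar ‖θ‖ A (t - 1) ≤ radius I.lam I.sig I.S A (t - 1))
    {H : ℝ} (hH : Real.exp (radius I.lam sigStar ‖θ‖ A (t - 1)
      / radius I.lam I.sig I.S A (t - 1)) ≤ H)
    {β M : ℝ} (hβ : radius I.lam I.sig I.S A (t - 1) ≤ β) (hM : 1 ≤ M) :
    ∑ a ∈ s, baseProb I A Y t s qopt ahat a * gap θ s a
      ≤ (√(Real.exp 1 * (Copt * d * Real.log d) / I.αopt) + 1)
          * √(H * ∑ a ∈ s, baseProb I A Y t s qopt ahat a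
              * ⟪errVec I.lam θ A Y (t - 1), a⟫ ^ 2)
        + (√β * √(Real.log M) * (√2 * (1 + 1 / I.αemp))
          * ∑ a ∈ s, baseProb I A Y t s qopt ahat a * √(sqNorm (gram I.lam A (t - 1))⁻¹ a)
        + 2 * √β / (I.αemp * √M)) := by
  have hq : ∀ a ∈ s, 0 ≤ qopt a := fun a ha => IsAugmentedDesign.nonneg hO hdes ha
  have hq1 : ∑ a ∈ s, qopt a = 1 :=
    IsAugmentedDesign.sum_eq_one hO hdes hs (weight_self I A Y t ahat)
  have hest := sum_baseProb_mul_estGap_le (Y := Y) hI hq hq1 hs hreg hβ hM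
  obtain ⟨b, hb, hgap⟩ := exists_gap_eq θ ⟨ahat, hs⟩
  set r := ridge I.lam A Y (t - 1) with hr
  set ε := errVec I.lam θ A Y (t - 1) with hε
  set p := baseProb I A Y t s qopt ahat with hp
  set K := Copt * d * Real.log d with hK
  have hK0 : 0 ≤ K := mul_nonneg (mul_nonneg hC d.cast_nonneg) (Real.log_natCast_nonneg d)
  have hp0 : ∀ a ∈ s, 0 ≤ p a := fun a ha => baseProb_nonneg hI hq hs ha
  have hp1 : ∑ a ∈ s, p a = 1 := sum_baseProb hI hq hs
  set X := ∑ a ∈ s, p a * ⟪ε, a⟫ ^ 2 with hX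
  have hX0 : 0 ≤ X := Finset.sum_nonneg fun a ha => mul_nonneg (hp0 a ha) (sq_nonneg _)
  set ρ := radius I.lam sigStar ‖θ‖ A (t - 1) / radius I.lam I.sig I.S A (t - 1) with hρ
  have hβ0 := radius_pos hI.lam_pos hI.sig_pos.le hI.S_pos A (t - 1)
  have hρ0 : 0 ≤ ρ := div_nonneg (radius_nonneg _ _ _ _ _) hβ0.le
  have hH1 : 1 ≤ H := (Real.one_le_exp hρ0).trans hH
  have hbeat : ⟪θ, ahat⟫ ≤ ⟪θ, b⟫ := by linarith [hgap ahat, gap_nonneg (θ := θ) hs]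
  have hfb := exp_neg_le_weight (sigStar := sigStar) hI hbest hgood hb hbeat
  have hαo := hI.αopt_pos
  -- the design bound for the best arm
  have hb1 : weight I A Y t ahat b * ⟪ε, b⟫ ^ 2 ≤ Real.exp 1 * K / I.αopt * X := by
    refine (IsAugmentedDesign.weighted_inner_sq_le hO hC hdes
      (fun a _ => ⟨weight_pos _ _ _ _ _ _, weight_le_one hI _ _ _ _ _⟩) ε hb ?_).trans ?_
    · intro hv
      refine le_trans ?_ hfb
      rw [one_div, ← Real.exp_neg, Real.exp_le_exp, neg_le_neg_iff, div_le_one hβ0]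
      exact hver hv
    · have h0 : Real.exp 1 * K / I.αopt * X = Real.exp 1 * K * (X / I.αopt) := by ring
      rw [h0]
      refine mul_le_mul_of_nonneg_left ?_ (mul_nonneg (Real.exp_pos 1).le hK0)
      rw [le_div_iff₀ hαo, hX, Finset.sum_mul]
      refine Finset.sum_le_sum fun a ha => ?_
      have h1 := baseProb_ge (A := A) (Y := Y) (t := t) hI hq hq1 hs ha
      have h2 : I.αopt * qopt a * weight I A Y t ahat a ≤ p a :=
        le_trans (mul_le_mul_of_nonneg_right (mixture_ge_opt hI) (weight_pos _ _ _ _ _ _).le) h1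
      calc _ = I.αopt * qopt a * weight I A Y t ahat a * ⟪ε, a⟫ ^ 2 := by ring
        _ ≤ _ := mul_le_mul_of_nonneg_right h2 (sq_nonneg _)
  have hb2 : ⟪ε, b⟫ ^ 2 ≤ Real.exp 1 * K / I.αopt * (H * X) := by
    have h1 : 1 ≤ H * weight I A Y t ahat b := by
      calc (1 : ℝ) = Real.exp ρ * Real.exp (-ρ) := by rw [← Real.exp_add]; simp
        _ ≤ _ := mul_le_mul hH hfb (Real.exp_pos _).le (by linarith)
    calc ⟪ε, b⟫ ^ 2 ≤ H * weight I A Y t ahat b * ⟪ε, b⟫ ^ 2 :=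
          le_mul_of_one_le_left (sq_nonneg _) h1
      _ = H * (weight I A Y t ahat b * ⟪ε, b⟫ ^ 2) := by ring
      _ ≤ H * (Real.exp 1 * K / I.αopt * X) := by gcongr
      _ = _ := by ring
  have hb3 : ⟪ε, b⟫ ≤ √(Real.exp 1 * K / I.αopt) * √(H * X) := by
    rw [← Real.sqrt_mul (by positivity)]
    exact Real.le_sqrt_of_sq_le hb2
  have hmean : -∑ a ∈ s, p a * ⟪ε, a⟫ ≤ √(H * X) := by
    have h1 : (∑ a ∈ s, p a * ⟪ε, a⟫) ^ 2 ≤ X := by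
      have h2 := Finset.sum_sq_le_sum_mul_sum_of_sq_le_mul s (r := fun a => p a * ⟪ε, a⟫)
        (f := p) (g := fun a => p a * ⟪ε, a⟫ ^ 2) hp0
        (fun a ha => mul_nonneg (hp0 a ha) (sq_nonneg _)) (fun a _ => le_of_eq (by ring))
      rwa [hp1, one_mul] at h2
    refine Real.le_sqrt_of_sq_le ?_
    rw [neg_sq]
    nlinarith
  have hdecomp : ∑ a ∈ s, p a * gap θ s a
      ≤ ⟪ε, b⟫ - ∑ a ∈ s, p a * ⟪ε, a⟫ + ∑ a ∈ s, p a * ⟪r, ahat - a⟫ := by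
    have h1 : ∀ a ∈ s, p a * gap θ s a
        ≤ p a * ⟪ε, b⟫ - p a * ⟪ε, a⟫ + p a * ⟪r, ahat - a⟫ := by
      intro a ha
      have h2 : ε = θ - r := rfl
      rw [hgap a, ← mul_sub, ← mul_add]
      refine mul_le_mul_of_nonneg_left ?_ (hp0 a ha)
      rw [h2, inner_sub_left, inner_sub_left, inner_sub_right]
      linarith [hbest b hb]
    refine (Finset.sum_le_sum h1).trans (le_of_eq ?_)
    rw [Finset.sum_add_distrib, Finset.sum_sub_distrib, ← Finset.sum_mul, hp1, one_mul]
  rw [add_mul, one_mul]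
  linarith

end Round

/-! ### Conditionally sub-Gaussian noise -/

section Subgaussian

variable {Ω : Type*} {m mΩ : MeasurableSpace Ω} {P : Measure Ω} {η : Ω → ℝ} {σ : ℝ}

theorem one_add_sq_half_le_cosh (x : ℝ) : 1 + x ^ 2 / 2 ≤ Real.cosh x := by
  rw [← Real.cosh_abs, ← sq_abs]
  have h6 : |x| / 2 ≤ Real.sinh (|x| / 2) := Real.self_le_sinh_iff.2 (by positivity)
  have h7 : Real.cosh |x| = 1 + 2 * Real.sinh (|x| / 2) ^ 2 := by
    have := Real.cosh_two_mul (|x| / 2)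
    rw [mul_div_cancel₀ |x| two_ne_zero, Real.cosh_sq] at this
    linarith
  rw [h7]
  have : 0 ≤ |x| / 2 := by positivity
  nlinarith

theorem integrable_sq_of_integrable_exp (hη : Measurable η)
    (hint : ∀ x : ℝ, Integrable (fun ω => Real.exp (x * η ω)) P) :
    Integrable (fun ω => η ω ^ 2) P := by
  refine ((hint 1).add (hint (-1))).mono' (hη.pow_const 2).aestronglyMeasurable ?_
  refine Filter.Eventually.of_forall fun ω => ?_
  have := one_add_sq_half_le_cosh (η ω)
  rw [Real.cosh_eq] at this
  simp only [Pi.add_apply, one_mul, neg_mul, Real.norm_eq_abs, abs_pow, sq_abs]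
  linarith

theorem memLp_two_of_integrable_exp (hη : Measurable η)
    (hint : ∀ x : ℝ, Integrable (fun ω => Real.exp (x * η ω)) P) : MemLp η 2 P :=
  (memLp_two_iff_integrable_sq hη.aestronglyMeasurable).2
    (integrable_sq_of_integrable_exp hη hint)

variable [IsProbabilityMeasure P]

theorem exp_sub_one_le_mul_exp (y : ℝ) : Real.exp y - 1 ≤ y * Real.exp y := by
  have h1 := Real.add_one_le_exp (-y)
  have h2 : Real.exp (-y) * Real.exp y = 1 := by rw [← Real.exp_add]; simp
  nlinarith [Real.exp_pos y]

/-- The sub-Gaussian bound forces the noise to be centered: compare the terms of first order in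
`x → 0`. -/
theorem condExp_eq_zero_of_subgaussian (hm : m ≤ mΩ) (hη : Measurable η)
    (hint : ∀ x : ℝ, Integrable (fun ω => Real.exp (x * η ω)) P)
    (hsub : ∀ x : ℝ, P[fun ω => Real.exp (x * η ω) | m]
      ≤ᵐ[P] fun _ => Real.exp (x ^ 2 * σ ^ 2 / 2)) :
    P[η | m] =ᵐ[P] 0 := by
  have hηi : Integrable η P := (memLp_two_of_integrable_exp hη hint).integrable one_le_two
  have hlin : ∀ x : ℝ, ∀ᵐ ω ∂P, x * P[η | m] ω ≤ x ^ 2 * σ ^ 2 / 2 * Real.exp (x ^ 2 * σ ^ 2 / 2) := by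
    intro x
    have h1 : P[fun ω => x * η ω | m] =ᵐ[P] fun ω => x * P[η | m] ω := by
      have := condExp_smul (μ := P) x η m
      exact this
    have h2 : P[(fun _ => (1 : ℝ)) + fun ω => x * η ω | m]
        =ᵐ[P] P[fun _ => (1 : ℝ) | m] + P[fun ω => x * η ω | m] :=
      condExp_add (integrable_const _) (hηi.const_mul x) m
    have h3 : P[(fun _ => (1 : ℝ)) + fun ω => x * η ω | m]
        ≤ᵐ[P] P[fun ω => Real.exp (x * η ω) | m] := by
      refine condExp_mono ((integrable_const _).add (hηi.const_mul x)) (hint x) ?_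
      refine Filter.Eventually.of_forall fun ω => ?_
      have := Real.add_one_le_exp (x * η ω)
      simp only [Pi.add_apply]
      linarith
    rw [condExp_const hm] at h2
    filter_upwards [h1, h2, h3, hsub x] with ω g1 g2 g3 g4
    simp only [Pi.add_apply] at g2
    have := exp_sub_one_le_mul_exp (x ^ 2 * σ ^ 2 / 2)
    linarith
  have hseq : ∀ᵐ ω ∂P, ∀ k : ℕ,
      |P[η | m] ω| ≤ (1 / ((k : ℝ) + 1)) * σ ^ 2 / 2 * Real.exp ((1 / ((k : ℝ) + 1)) ^ 2 * σ ^ 2 / 2) := by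
    refine ae_all_iff.2 fun k => ?_
    filter_upwards [hlin (1 / ((k : ℝ) + 1)), hlin (-(1 / ((k : ℝ) + 1)))] with ω h1 h2
    have hx : 0 < 1 / ((k : ℝ) + 1) := by positivity
    set x := 1 / ((k : ℝ) + 1)
    rw [neg_sq] at h2
    have e1 : x ^ 2 * σ ^ 2 / 2 * Real.exp (x ^ 2 * σ ^ 2 / 2)
        = x * (x * σ ^ 2 / 2 * Real.exp (x ^ 2 * σ ^ 2 / 2)) := by ring
    rw [e1] at h1 h2
    rw [neg_mul, ← mul_neg] at h2
    exact abs_le'.2 ⟨le_of_mul_le_mul_left h1 hx, le_of_mul_le_mul_left h2 hx⟩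
  have hlim : Filter.Tendsto (fun k : ℕ => (1 / ((k : ℝ) + 1)) * σ ^ 2 / 2
      * Real.exp ((1 / ((k : ℝ) + 1)) ^ 2 * σ ^ 2 / 2)) Filter.atTop (nhds 0) := by
    have hc : Continuous fun x : ℝ => x * σ ^ 2 / 2 * Real.exp (x ^ 2 * σ ^ 2 / 2) := by fun_prop
    have := (hc.tendsto 0).comp (tendsto_one_div_add_atTop_nhds_zero_nat (𝕜 := ℝ))
    simpa [Function.comp_def] using this
  filter_upwards [hseq] with ω hω
  exact abs_nonpos_iff.1 (ge_of_tendsto' hlim hω)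

theorem integral_mul_eq_zero_of_subgaussian (hm : m ≤ mΩ) (hη : Measurable η)
    (hint : ∀ x : ℝ, Integrable (fun ω => Real.exp (x * η ω)) P)
    (hsub : ∀ x : ℝ, P[fun ω => Real.exp (x * η ω) | m]
      ≤ᵐ[P] fun _ => Real.exp (x ^ 2 * σ ^ 2 / 2))
    {Z : Ω → ℝ} (hZ : StronglyMeasurable[m] Z) (hZ2 : MemLp Z 2 P) :
    ∫ ω, Z ω * η ω ∂P = 0 := by
  have hη2 := memLp_two_of_integrable_exp hη hint
  have h1 := condExp_mul_of_stronglyMeasurable_left hZ (hZ2.integrable_mul hη2)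
    (hη2.integrable one_le_two)
  have h2 := condExp_eq_zero_of_subgaussian hm hη hint hsub
  calc ∫ ω, Z ω * η ω ∂P = ∫ ω, P[Z * η | m] ω ∂P := (integral_condExp hm).symm
    _ = ∫ ω, 0 ∂P := by
        refine integral_congr_ae ?_
        filter_upwards [h1, h2] with ω g1 g2
        rw [g1, Pi.mul_apply, g2]; simp
    _ = 0 := by simp

theorem integral_mul_exp_le_of_subgaussian (hm : m ≤ mΩ)
    (hint : ∀ x : ℝ, Integrable (fun ω => Real.exp (x * η ω)) P)
    (hsub : ∀ x : ℝ, P[fun ω => Real.exp (x * η ω) | m]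
      ≤ᵐ[P] fun _ => Real.exp (x ^ 2 * σ ^ 2 / 2))
    {Z : Ω → ℝ} (hZ : StronglyMeasurable[m] Z) (hZ0 : ∀ ω, 0 ≤ Z ω) (hZ1 : ∀ ω, Z ω ≤ 1) (x : ℝ) :
    Integrable (fun ω => Z ω * Real.exp (x * η ω)) P ∧
    ∫ ω, Z ω * Real.exp (x * η ω) ∂P ≤ Real.exp (x ^ 2 * σ ^ 2 / 2) * ∫ ω, Z ω ∂P := by
  have hZm : AEStronglyMeasurable Z P := (hZ.mono hm).aestronglyMeasurable
  have hb : ∀ᵐ ω ∂P, ‖Z ω‖ ≤ 1 := Filter.Eventually.of_forall fun ω => by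
    rw [Real.norm_of_nonneg (hZ0 ω)]; exact hZ1 ω
  have hZi : Integrable Z P := (integrable_const (1 : ℝ)).mono' hZm hb
  have hi : Integrable (Z * fun ω => Real.exp (x * η ω)) P := (hint x).bdd_mul hZm hb
  refine ⟨hi, ?_⟩
  have h1 := condExp_mul_of_stronglyMeasurable_left hZ hi (hint x)
  calc ∫ ω, Z ω * Real.exp (x * η ω) ∂P
      = ∫ ω, P[Z * fun ω => Real.exp (x * η ω) | m] ω ∂P := (integral_condExp hm).symm
    _ ≤ ∫ ω, Real.exp (x ^ 2 * σ ^ 2 / 2) * Z ω ∂P := by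
        refine integral_mono_ae integrable_condExp (hZi.const_mul _) ?_
        filter_upwards [h1, hsub x] with ω g1 g2
        rw [g1, Pi.mul_apply, mul_comm]
        exact mul_le_mul_of_nonneg_right g2 (hZ0 ω)
    _ = _ := integral_const_mul _ _

/-- The conditional second moment is bounded through `1 + x² / 2 ≤ cosh x`. -/
theorem integral_mul_sq_le_of_subgaussian (hm : m ≤ mΩ) (hσ : 0 ≤ σ) (hη : Measurable η)
    (hint : ∀ x : ℝ, Integrable (fun ω => Real.exp (x * η ω)) P)
    (hsub : ∀ x : ℝ, P[fun ω => Real.exp (x * η ω) | m]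
      ≤ᵐ[P] fun _ => Real.exp (x ^ 2 * σ ^ 2 / 2))
    {Z : Ω → ℝ} (hZ : StronglyMeasurable[m] Z) (hZ0 : ∀ ω, 0 ≤ Z ω) (hZ1 : ∀ ω, Z ω ≤ 1) :
    ∫ ω, Z ω * η ω ^ 2 ∂P ≤ 2 * σ ^ 2 * ∫ ω, Z ω ∂P := by
  have hZm : AEStronglyMeasurable Z P := (hZ.mono hm).aestronglyMeasurable
  have hb : ∀ᵐ ω ∂P, ‖Z ω‖ ≤ 1 := Filter.Eventually.of_forall fun ω => by
    rw [Real.norm_of_nonneg (hZ0 ω)]; exact hZ1 ω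
  have hZi : Integrable Z P := (integrable_const (1 : ℝ)).mono' hZm hb
  have hη2 := integrable_sq_of_integrable_exp hη hint
  have hZη : Integrable (fun ω => Z ω * η ω ^ 2) P := hη2.bdd_mul hZm hb
  have hI0 : 0 ≤ ∫ ω, Z ω ∂P := integral_nonneg hZ0
  -- any `x > 0` with `x σ ≤ 1` serves in the exponential bounds
  set x := 1 / (σ + 1) with hx
  have hx0 : 0 < x := by positivity
  obtain ⟨i1, h1⟩ := integral_mul_exp_le_of_subgaussian hm hint hsub hZ hZ0 hZ1 x
  obtain ⟨i2, h2⟩ := integral_mul_exp_le_of_subgaussian hm hint hsub hZ hZ0 hZ1 (-x)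
  rw [neg_sq] at h2
  have h3 : ∫ ω, (Z ω + x ^ 2 / 2 * (Z ω * η ω ^ 2)) ∂P
      ≤ ∫ ω, (Z ω * Real.exp (x * η ω) + Z ω * Real.exp (-x * η ω)) / 2 ∂P := by
    refine integral_mono (hZi.add (hZη.const_mul _)) ((i1.add i2).div_const 2) fun ω => ?_
    have h4 := one_add_sq_half_le_cosh (x * η ω)
    rw [Real.cosh_eq] at h4
    have h5 := mul_le_mul_of_nonneg_left h4 (hZ0 ω)
    simp only [neg_mul] at h5 ⊢
    nlinarith
  rw [integral_add hZi (hZη.const_mul _), integral_const_mul, integral_div,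
    integral_add i1 i2] at h3
  set y := x ^ 2 * σ ^ 2 / 2 with hy
  have hxσ : x * σ ≤ 1 := by
    rw [hx, one_div, inv_mul_le_iff₀ (by positivity)]; linarith
  have hy1 : y ≤ 1 / 2 := by
    have : (x * σ) ^ 2 ≤ 1 := pow_le_one₀ (by positivity) hxσ
    rw [hy]; nlinarith
  have hey : Real.exp y ≤ 2 := by
    have h6 : Real.exp y ≤ Real.exp (1 / 2) := Real.exp_le_exp.2 hy1
    have h7 : Real.exp (1 / 2) * Real.exp (1 / 2) = Real.exp 1 := by
      rw [← Real.exp_add]; norm_num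
    have h8 := Real.exp_one_lt_d9
    nlinarith [Real.exp_pos (1 / 2)]
  have h9 := exp_sub_one_le_mul_exp y
  have hy0 : 0 ≤ y := by positivity
  have h10 : x ^ 2 / 2 * ∫ ω, Z ω * η ω ^ 2 ∂P ≤ x ^ 2 / 2 * (2 * σ ^ 2 * ∫ ω, Z ω ∂P) := by
    have h11 : Real.exp y - 1 ≤ 2 * y := by nlinarith
    have h12 := mul_le_mul_of_nonneg_right h11 hI0
    have h13 : x ^ 2 / 2 * (2 * σ ^ 2 * ∫ ω, Z ω ∂P) = 2 * y * ∫ ω, Z ω ∂P := by rw [hy]; ring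
    rw [h13]
    linarith
  exact le_of_mul_le_mul_left h10 (by positivity)

/-- The sub-Gaussian bound integrated against an arbitrary nonnegative factor known beforehand. -/
theorem lintegral_mul_exp_le_of_subgaussian (hm : m ≤ mΩ) (hη : Measurable η)
    (hint : ∀ x : ℝ, Integrable (fun ω => Real.exp (x * η ω)) P)
    (hsub : ∀ x : ℝ, P[fun ω => Real.exp (x * η ω) | m]
      ≤ᵐ[P] fun _ => Real.exp (x ^ 2 * σ ^ 2 / 2))
    {Z : Ω → ENNReal} (hZ : Measurable[m] Z) (x : ℝ) :
    ∫⁻ ω, Z ω * ENNReal.ofReal (Real.exp (x * η ω - x ^ 2 * σ ^ 2 / 2)) ∂P ≤ ∫⁻ ω, Z ω ∂P := by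
  set g : Ω → ENNReal := fun ω => ENNReal.ofReal (Real.exp (x * η ω - x ^ 2 * σ ^ 2 / 2)) with hg
  have hgm : Measurable g := by
    refine ENNReal.measurable_ofReal.comp (Real.measurable_exp.comp ?_)
    exact (hη.const_mul x).sub_const _
  have hle : (P.withDensity g).trim hm ≤ P.trim hm := by
    refine Measure.le_iff.2 fun s hs => ?_
    rw [trim_measurableSet_eq hm hs, trim_measurableSet_eq hm hs, withDensity_apply _ (hm s hs)]
    obtain ⟨i1, h1⟩ := integral_mul_exp_le_of_subgaussian hm hint hsub
      (Z := s.indicator fun _ => 1) (stronglyMeasurable_const.indicator hs)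
      (fun ω => Set.indicator_nonneg (fun _ _ => zero_le_one) ω)
      (fun ω => Set.indicator_le_self' (fun _ _ => zero_le_one) ω) x
    rw [integral_indicator_const _ (hm s hs), smul_eq_mul, mul_one] at h1
    have h2 : ∫⁻ ω in s, g ω ∂P = ENNReal.ofReal (Real.exp (-(x ^ 2 * σ ^ 2 / 2))
        * ∫ ω, s.indicator (fun _ => (1 : ℝ)) ω * Real.exp (x * η ω) ∂P) := by
      rw [← integral_const_mul, ofReal_integral_eq_lintegral_ofReal (i1.const_mul _),
        ← lintegral_indicator (hm s hs)]
      · refine lintegral_congr fun ω => ?_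
        by_cases hω : ω ∈ s
        · simp only [Set.indicator_of_mem hω, hg, one_mul]
          rw [← Real.exp_add]; congr 2; ring
        · simp [Set.indicator_of_notMem hω]
      · refine Filter.Eventually.of_forall fun ω => ?_
        exact mul_nonneg (Real.exp_pos _).le (mul_nonneg
          (Set.indicator_nonneg (fun _ _ => zero_le_one) ω) (Real.exp_pos _).le)
    rw [h2, ← ofReal_measureReal]
    refine ENNReal.ofReal_le_ofReal ?_
    calc _ ≤ Real.exp (-(x ^ 2 * σ ^ 2 / 2)) * (Real.exp (x ^ 2 * σ ^ 2 / 2) * P.real s) := by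
          gcongr
      _ = P.real s := by rw [← mul_assoc, ← Real.exp_add]; simp
  have h3 : ∫⁻ ω, Z ω * g ω ∂P = ∫⁻ ω, Z ω ∂(P.withDensity g) := by
    rw [lintegral_withDensity_eq_lintegral_mul P hgm (hZ.mono hm le_rfl)]
    exact lintegral_congr fun ω => by rw [Pi.mul_apply, mul_comm]
  rw [h3, ← lintegral_trim hm hZ, ← lintegral_trim hm hZ]
  exact lintegral_mono' hle le_rfl

end Subgaussian

/-! ### A Gaussian integral -/

theorem lintegral_exp_neg_mul_dotProduct_ne_top {c : ℝ} (hc : 0 < c) :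
    ∫⁻ x : Fin d → ℝ, ENNReal.ofReal (Real.exp (-(c * (x ⬝ᵥ x)))) ≠ ⊤ := by
  have h : Integrable (fun x : Fin d → ℝ => ∏ i, Real.exp (-c * x i ^ 2)) :=
    Integrable.fintype_prod (f := fun _ y => Real.exp (-c * y ^ 2))
      fun _ => integrable_exp_neg_mul_sq hc
  have h2 : (fun x : Fin d → ℝ => Real.exp (-(c * (x ⬝ᵥ x))))
      = fun x => ∏ i, Real.exp (-c * x i ^ 2) := by
    funext x
    rw [← Real.exp_sum, dotProduct, Finset.mul_sum, ← Finset.sum_neg_distrib]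
    congr 1
    exact Finset.sum_congr rfl fun i _ => by ring
  rw [← h2] at h
  exact h.lintegral_lt_top.ne

theorem lintegral_exp_neg_mul_dotProduct_ne_zero (c : ℝ) :
    ∫⁻ x : Fin d → ℝ, ENNReal.ofReal (Real.exp (-(c * (x ⬝ᵥ x)))) ≠ 0 := by
  have hm : Measurable fun x : Fin d → ℝ => ENNReal.ofReal (Real.exp (-(c * (x ⬝ᵥ x)))) := by
    unfold dotProduct
    fun_prop
  rw [Ne, lintegral_eq_zero_iff hm]
  intro h
  have : ∀ᵐ _x : Fin d → ℝ, False := by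
    filter_upwards [h] with x hx
    simp only [Pi.zero_apply, ENNReal.ofReal_eq_zero] at hx
    exact absurd hx (not_le.2 (Real.exp_pos _))
  rw [Filter.eventually_false_iff_eq_bot, ae_eq_bot] at this
  exact IsOpen.measure_ne_zero volume isOpen_univ Set.univ_nonempty (by rw [this]; simp)

open scoped MatrixOrder Matrix.Norms.L2Operator in
theorem exists_eq_transpose_mul_self {V : Matrix (Fin d) (Fin d) ℝ} (hV : V.PosSemidef) :
    ∃ R : Matrix (Fin d) (Fin d) ℝ, V = Rᵀ * R := by
  obtain ⟨R, hR⟩ := CStarAlgebra.nonneg_iff_eq_star_mul_self.mp hV.nonneg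
  exact ⟨R, by
    rw [hR, Matrix.star_eq_conjTranspose, Matrix.conjTranspose_eq_transpose_of_trivial]⟩

/-- Completing the square and substituting `x ↦ V^{1/2} x`. -/
theorem lintegral_exp_quadratic {V : Matrix (Fin d) (Fin d) ℝ} (hV : V.PosDef) (b : Vec d)
    {c : ℝ} (hc : 0 < c) :
    ∫⁻ x : Fin d → ℝ, ENNReal.ofReal (Real.exp (x ⬝ᵥ b.ofLp - c * (x ⬝ᵥ (V *ᵥ x))))
      = ENNReal.ofReal (Real.exp (sqNorm V⁻¹ b / (4 * c)) / √V.det)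
        * ∫⁻ x : Fin d → ℝ, ENNReal.ofReal (Real.exp (-(c * (x ⬝ᵥ x)))) := by
  obtain ⟨R, hR⟩ := exists_eq_transpose_mul_self hV.posSemidef
  have hdet : V.det = R.det ^ 2 := by rw [hR, Matrix.det_mul, Matrix.det_transpose, sq]
  have hRdet : R.det ≠ 0 := fun h => hV.det_pos.ne' (by rw [hdet, h]; simp)
  set z : Fin d → ℝ := (1 / (2 * c)) • (V⁻¹ *ᵥ b.ofLp) with hz
  have hVz : V *ᵥ z = (1 / (2 * c)) • b.ofLp := by
    rw [hz, Matrix.mulVec_smul, mulVec_inv_mulVec hV]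
  have hzb : z ⬝ᵥ b.ofLp = 1 / (2 * c) * sqNorm V⁻¹ b := by
    rw [hz, smul_dotProduct, smul_eq_mul, sqNorm, dotProduct_comm]
  have hsq : ∀ x : Fin d → ℝ, (x + z) ⬝ᵥ b.ofLp - c * ((x + z) ⬝ᵥ (V *ᵥ (x + z)))
      = sqNorm V⁻¹ b / (4 * c) + -(c * ((R *ᵥ x) ⬝ᵥ (R *ᵥ x))) := by
    intro x
    have h1 : (R *ᵥ x) ⬝ᵥ (R *ᵥ x) = x ⬝ᵥ (V *ᵥ x) := by
      rw [hR, ← Matrix.mulVec_mulVec, Matrix.dotProduct_mulVec x, Matrix.vecMul_transpose]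
    have h2 : z ⬝ᵥ (V *ᵥ x) = x ⬝ᵥ (V *ᵥ z) := dotProduct_mulVec_comm hV.1 _ _
    rw [h1, Matrix.mulVec_add, add_dotProduct, add_dotProduct, dotProduct_add, dotProduct_add,
      h2, hVz, dotProduct_smul, dotProduct_smul, hzb]
    simp only [smul_eq_mul]
    field_simp
    ring
  rw [← lintegral_add_right_eq_self _ z]
  simp only [hsq, Real.exp_add]
  simp only [ENNReal.ofReal_mul (Real.exp_pos _).le]
  have hm : Measurable fun x : Fin d → ℝ => ENNReal.ofReal (Real.exp (-(c * (x ⬝ᵥ x)))) := by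
    unfold dotProduct
    fun_prop
  rw [lintegral_const_mul']
  swap
  · exact ENNReal.ofReal_ne_top
  have h3 : ∫⁻ x : Fin d → ℝ, ENNReal.ofReal (Real.exp (-(c * ((R *ᵥ x) ⬝ᵥ (R *ᵥ x)))))
      = ENNReal.ofReal |R.det⁻¹|
        * ∫⁻ x : Fin d → ℝ, ENNReal.ofReal (Real.exp (-(c * (x ⬝ᵥ x)))) := by
    have h4 := Real.map_matrix_volume_pi_eq_smul_volume_pi hRdet
    have h5 : Measurable (Matrix.toLin' R) := (LinearMap.continuous_of_finiteDimensional _).measurable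
    rw [← smul_eq_mul, ← lintegral_smul_measure, ← h4, lintegral_map hm h5]
    rfl
  rw [h3, ← mul_assoc, ← ENNReal.ofReal_mul (Real.exp_pos _).le, hdet, Real.sqrt_sq_eq_abs,
    abs_inv, ← div_eq_mul_inv]

/-! ### Measurability -/

section Measurability

variable {Ω : Type*} [MeasurableSpace Ω]

theorem measurable_coord {x : Ω → Vec d} (hx : Measurable x) (i : Fin d) :
    Measurable fun ω => x ω i := by fun_prop

theorem measurable_vec {x : Ω → Vec d} (hx : ∀ i, Measurable fun ω => x ω i) : Measurable x :=
  (WithLp.measurable_toLp 2 (Fin d → ℝ)).comp (measurable_pi_iff.2 hx)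

theorem measurable_det {M : Ω → Matrix (Fin d) (Fin d) ℝ}
    (hM : ∀ i j, Measurable fun ω => M ω i j) : Measurable fun ω => (M ω).det := by
  simp only [Matrix.det_apply]
  exact Finset.measurable_sum _ fun p _ =>
    (Finset.measurable_prod _ fun i _ => hM _ _).const_smul _

theorem measurable_inv_entry {M : Ω → Matrix (Fin d) (Fin d) ℝ}
    (hM : ∀ i j, Measurable fun ω => M ω i j) (i j : Fin d) :
    Measurable fun ω => (M ω)⁻¹ i j := by
  simp only [Matrix.inv_def, Ring.inverse_eq_inv', Matrix.smul_apply, smul_eq_mul,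
    Matrix.adjugate_apply]
  refine (measurable_det hM).inv.mul (measurable_det fun k l => ?_)
  simp only [Matrix.updateRow_apply]
  split_ifs
  · exact measurable_const
  · exact hM k l

theorem measurable_sqNorm {M : Ω → Matrix (Fin d) (Fin d) ℝ}
    (hM : ∀ i j, Measurable fun ω => M ω i j) {x : Ω → Vec d} (hx : Measurable x) :
    Measurable fun ω => sqNorm (M ω) (x ω) := by
  simp only [sqNorm, dotProduct, Matrix.mulVec]
  exact Finset.measurable_sum _ fun i _ => (measurable_coord hx i).mul
    (Finset.measurable_sum _ fun j _ => (hM i j).mul (measurable_coord hx j))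

variable {A : ℕ → Ω → Vec d} {Y : ℕ → Ω → ℝ} {t : ℕ}

theorem measurable_gram_entry (lam : ℝ) (hA : ∀ s ∈ Finset.Icc 1 t, Measurable (A s))
    (i j : Fin d) : Measurable fun ω => gram lam (fun s => A s ω) t i j := by
  simp only [gram, Matrix.add_apply, Matrix.sum_apply, outer, Matrix.vecMulVec_apply]
  exact measurable_const.add (Finset.measurable_sum _ fun s hs =>
    (measurable_coord (hA s hs) i).mul (measurable_coord (hA s hs) j))

theorem measurable_ridge (lam : ℝ) (hA : ∀ s ∈ Finset.Icc 1 t, Measurable (A s))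
    (hY : ∀ s ∈ Finset.Icc 1 t, Measurable (Y s)) :
    Measurable fun ω => ridge lam (fun s => A s ω) (fun s => Y s ω) t := by
  refine measurable_vec fun i => ?_
  simp only [ridge, Matrix.mulVec, dotProduct, Finset.sum_apply, Pi.smul_apply, smul_eq_mul]
  exact Finset.measurable_sum _ fun j _ =>
    (measurable_inv_entry (measurable_gram_entry lam hA) i j).mul
      (Finset.measurable_sum _ fun s hs => (hY s hs).mul (measurable_coord (hA s hs) j))

theorem measurable_errVec (lam : ℝ) (θ : Vec d) (hA : ∀ s ∈ Finset.Icc 1 t, Measurable (A s))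
    (hY : ∀ s ∈ Finset.Icc 1 t, Measurable (Y s)) :
    Measurable fun ω => errVec lam θ (fun s => A s ω) (fun s => Y s ω) t :=
  (measurable_ridge lam hA hY).const_sub θ

theorem measurable_logDet (lam : ℝ) (hA : ∀ s ∈ Finset.Icc 1 t, Measurable (A s)) :
    Measurable fun ω => logDet lam (fun s => A s ω) t := by
  simp only [logDet, gram_zero]
  exact Real.measurable_log.comp
    ((measurable_det (measurable_gram_entry lam hA)).div measurable_const)

theorem measurable_radius (lam s R : ℝ) (hA : ∀ s ∈ Finset.Icc 1 t, Measurable (A s)) :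
    Measurable fun ω => radius lam s R (fun s => A s ω) t :=
  (((((measurable_logDet lam hA).add_const _).sqrt).const_mul s).add_const _).pow_const 2

theorem measurable_hMax (lam sig S sigStar SStar : ℝ) {n : ℕ} (hn : 1 ≤ n)
    (hA : ∀ s, Measurable (A s)) :
    Measurable fun ω => hMax lam sig S sigStar SStar (fun s => A s ω) n := by
  have hne : (Finset.Icc 1 n).Nonempty := ⟨1, Finset.mem_Icc.2 ⟨le_rfl, hn⟩⟩
  have h := Finset.measurable_sup' hne (f := fun t ω => Real.exp
    (radius lam sigStar SStar (fun s => A s ω) (t - 1) / radius lam sig S (fun s => A s ω) (t - 1)))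
    fun t _ => Real.measurable_exp.comp
      ((measurable_radius lam _ _ fun s _ => hA s).div (measurable_radius lam _ _ fun s _ => hA s))
  convert h using 1
  funext ω
  rw [Finset.sup'_apply, Finset.sup'_eq_csSup_image, Finset.coe_Icc]
  rfl

end Measurability

/-! ### Histories -/

section Histories

variable {Ω : Type*} {A : ℕ → Ω → Vec d} {Y : ℕ → Ω → ℝ}

theorem measurable_hist_arm {s t : ℕ} (hs : s ∈ Finset.Icc 1 t) : Measurable[hist A Y t] (A s) :=
  Measurable.mono (comap_measurable (A s))
    (le_trans le_sup_left (le_iSup₂ (f := fun s (_ : s ∈ Finset.Icc 1 t) =>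
      MeasurableSpace.comap (A s) inferInstance ⊔ MeasurableSpace.comap (Y s) inferInstance) s hs))
    le_rfl

theorem measurable_hist_reward {s t : ℕ} (hs : s ∈ Finset.Icc 1 t) :
    Measurable[hist A Y t] (Y s) :=
  Measurable.mono (comap_measurable (Y s))
    (le_trans le_sup_right (le_iSup₂ (f := fun s (_ : s ∈ Finset.Icc 1 t) =>
      MeasurableSpace.comap (A s) inferInstance ⊔ MeasurableSpace.comap (Y s) inferInstance) s hs))
    le_rfl

theorem measurable_preReward_arm (t : ℕ) : Measurable[preReward A Y t] (A t) :=
  Measurable.mono (comap_measurable (A t)) le_sup_right le_rfl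

theorem hist_le_preReward (t : ℕ) : hist A Y (t - 1) ≤ preReward A Y t := le_sup_left

variable [mΩ : MeasurableSpace Ω]

theorem hist_le (hA : ∀ t, Measurable (A t)) (hY : ∀ t, Measurable (Y t)) (t : ℕ) :
    hist A Y t ≤ mΩ :=
  iSup₂_le fun s _ => sup_le (hA s).comap_le (hY s).comap_le

theorem preReward_le (hA : ∀ t, Measurable (A t)) (hY : ∀ t, Measurable (Y t)) (t : ℕ) :
    preReward A Y t ≤ mΩ :=
  sup_le (hist_le hA hY _) (hA t).comap_le

end Histories

/-! ### The confidence ellipsoid -/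

section Confidence

variable {Ω : Type*} [mΩ : MeasurableSpace Ω] {P : Measure Ω}
  {θ : Vec d} {sigStar : ℝ} {arms : ℕ → Finset (Vec d)} {A : ℕ → Ω → Vec d} {Y : ℕ → Ω → ℝ}

theorem noiseSum_eq {Ω : Type*} (θ : Vec d) (A : ℕ → Ω → Vec d) (Y : ℕ → Ω → ℝ) (t : ℕ) (ω : Ω) :
    noiseSum θ (fun s => A s ω) (fun s => Y s ω) t
      = ∑ s ∈ Finset.Icc 1 t, noise θ A Y s ω • A s ω := rfl

theorem IsLinearBandit.measurable_noise (h : IsLinearBandit P θ sigStar arms A Y) (t : ℕ) :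
    Measurable (noise θ A Y t) :=
  (h.measurable_reward t).sub (Measurable.inner measurable_const (h.measurable_arm t))

theorem IsLinearBandit.measurable_noiseSum (h : IsLinearBandit P θ sigStar arms A Y) (t : ℕ) :
    Measurable fun ω => noiseSum θ (fun s => A s ω) (fun s => Y s ω) t := by
  simp only [noiseSum_eq]
  exact Finset.measurable_sum _ fun s _ => (h.measurable_noise s).smul (h.measurable_arm s)

variable [IsProbabilityMeasure P]

/-- The exponential supermartingale of the noise in a fixed direction `x`. -/
theorem IsLinearBandit.lintegral_exp_le_one (h : IsLinearBandit P θ sigStar arms A Y)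
    (x : Vec d) (t : ℕ) :
    ∫⁻ ω, ENNReal.ofReal (Real.exp (∑ s ∈ Finset.Icc 1 t,
      (⟪x, A s ω⟫ * noise θ A Y s ω - ⟪x, A s ω⟫ ^ 2 * sigStar ^ 2 / 2))) ∂P ≤ 1 := by
  induction t with
  | zero => simp
  | succ t ih =>
    refine le_trans ?_ ih
    have hpre := preReward_le h.measurable_arm h.measurable_reward (t + 1)
    set Z : Ω → ENNReal := fun ω => ENNReal.ofReal (Real.exp (∑ s ∈ Finset.Icc 1 t,
      (⟪x, A s ω⟫ * noise θ A Y s ω - ⟪x, A s ω⟫ ^ 2 * sigStar ^ 2 / 2))) with hZ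
    have hZm : Measurable[preReward A Y (t + 1)] Z := by
      refine Measurable.mono ?_ (hist_le_preReward (t + 1)) le_rfl
      rw [Nat.add_sub_cancel]
      refine ENNReal.measurable_ofReal.comp (Real.measurable_exp.comp ?_)
      refine Finset.measurable_sum _ fun s hs => ?_
      have hAs : Measurable[hist A Y t] (A s) := measurable_hist_arm hs
      have hYs : Measurable[hist A Y t] (Y s) := measurable_hist_reward hs
      have hi : ∀ y : Vec d, Measurable[hist A Y t] fun ω => ⟪y, A s ω⟫ := fun y =>
        (innerSL ℝ y).continuous.measurable.comp hAs
      exact ((hi x).mul (hYs.sub (hi θ))).sub ((((hi x).pow_const 2).mul_const _).div_const _)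
    have hAset : ∀ a : Vec d, MeasurableSet[preReward A Y (t + 1)] {ω | A (t + 1) ω = a} :=
      fun a => measurable_preReward_arm (A := A) (Y := Y) (t + 1) (measurableSet_singleton a)
    have hstep : ∀ a : Vec d, ∫⁻ ω, ({ω | A (t + 1) ω = a}.indicator Z ω)
        * ENNReal.ofReal (Real.exp (⟪x, a⟫ * noise θ A Y (t + 1) ω
            - ⟪x, a⟫ ^ 2 * sigStar ^ 2 / 2)) ∂P
        ≤ ∫⁻ ω, {ω | A (t + 1) ω = a}.indicator Z ω ∂P := fun a =>
      lintegral_mul_exp_le_of_subgaussian hpre (h.measurable_noise (t + 1))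
        (h.integrable_exp (t + 1) (by omega)) (h.subgaussian (t + 1) (by omega))
        (hZm.indicator (hAset a)) ⟪x, a⟫
    have hmem := h.mem_arms (t + 1) (by omega)
    have hsum : ∀ g : Ω → ENNReal, ∀ ω, A (t + 1) ω ∈ arms (t + 1) →
        ∑ a ∈ arms (t + 1), {ω | A (t + 1) ω = a}.indicator g ω = g ω := by
      intro g ω hω
      rw [Finset.sum_eq_single (A (t + 1) ω)]
      · exact Set.indicator_of_mem (by simp) g
      · intro b _ hb
        exact Set.indicator_of_notMem (by simpa using fun h => hb h.symm) g
      · exact fun hn => absurd hω hn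
    calc _ = ∫⁻ ω, ∑ a ∈ arms (t + 1), ({ω | A (t + 1) ω = a}.indicator Z ω)
            * ENNReal.ofReal (Real.exp (⟪x, a⟫ * noise θ A Y (t + 1) ω
            - ⟪x, a⟫ ^ 2 * sigStar ^ 2 / 2)) ∂P := by
          refine lintegral_congr_ae ?_
          filter_upwards [hmem] with ω hω
          rw [← hsum (fun ω => ENNReal.ofReal (Real.exp (∑ s ∈ Finset.Icc 1 (t + 1),
            (⟪x, A s ω⟫ * noise θ A Y s ω - ⟪x, A s ω⟫ ^ 2 * sigStar ^ 2 / 2)))) ω hω]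
          refine Finset.sum_congr rfl fun a _ => ?_
          by_cases ha : A (t + 1) ω = a
          · rw [Set.indicator_of_mem (by exact ha), Set.indicator_of_mem (by exact ha),
              ← ENNReal.ofReal_mul (Real.exp_pos _).le, ← Real.exp_add,
              Finset.sum_Icc_succ_top (by omega), ha]
          · rw [Set.indicator_of_notMem (by exact ha), Set.indicator_of_notMem (by exact ha),
              zero_mul]
      _ = ∑ a ∈ arms (t + 1), ∫⁻ ω, ({ω | A (t + 1) ω = a}.indicator Z ω)
            * ENNReal.ofReal (Real.exp (⟪x, a⟫ * noise θ A Y (t + 1) ω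
            - ⟪x, a⟫ ^ 2 * sigStar ^ 2 / 2)) ∂P := by
          refine lintegral_finsetSum _ fun a _ => ?_
          refine ((hZm.mono hpre le_rfl).indicator (hpre _ (hAset a))).mul ?_
          refine ENNReal.measurable_ofReal.comp (Real.measurable_exp.comp ?_)
          exact ((h.measurable_noise (t + 1)).const_mul _).sub_const _
      _ ≤ ∑ a ∈ arms (t + 1), ∫⁻ ω, {ω | A (t + 1) ω = a}.indicator Z ω ∂P :=
          Finset.sum_le_sum fun a _ => hstep a
      _ = ∫⁻ ω, ∑ a ∈ arms (t + 1), {ω | A (t + 1) ω = a}.indicator Z ω ∂P :=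
          (lintegral_finsetSum _ fun a _ =>
            (hZm.mono hpre le_rfl).indicator (hpre _ (hAset a))).symm
      _ = ∫⁻ ω, Z ω ∂P := by
          refine lintegral_congr_ae ?_
          filter_upwards [hmem] with ω hω
          exact hsum Z ω hω

/-- The method of mixtures: averaging the exponential supermartingale over a Gaussian direction. -/
theorem IsLinearBandit.lintegral_exp_sqNorm_le_one (h : IsLinearBandit P θ sigStar arms A Y)
    {lam : ℝ} (hl : 0 < lam) (hσ : 0 < sigStar) (t : ℕ) :
    ∫⁻ ω, ENNReal.ofReal (Real.exp (sqNorm (gram lam (fun s => A s ω) t)⁻¹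
        (noiseSum θ (fun s => A s ω) (fun s => Y s ω) t) / (2 * sigStar ^ 2)
        - logDet lam (fun s => A s ω) t / 2)) ∂P ≤ 1 := by
  set c := sigStar ^ 2 / 2 with hc
  have hc0 : 0 < c := by positivity
  set G := ∫⁻ x : Fin d → ℝ, ENNReal.ofReal (Real.exp (-(c * (x ⬝ᵥ x)))) with hG
  have hG0 : G ≠ 0 := lintegral_exp_neg_mul_dotProduct_ne_zero c
  have hGt : G ≠ ⊤ := lintegral_exp_neg_mul_dotProduct_ne_top hc0
  set V : Ω → Matrix (Fin d) (Fin d) ℝ := fun ω => gram lam (fun s => A s ω) t with hVdef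
  set S : Ω → Vec d := fun ω => noiseSum θ (fun s => A s ω) (fun s => Y s ω) t with hS
  set V0 : Matrix (Fin d) (Fin d) ℝ := lam • 1 with hV0
  have hV0p : V0.PosDef := Matrix.PosDef.one.smul hl
  have hVp : ∀ ω, (V ω).PosDef := fun ω => gram_posDef hl _ t
  set F : Ω → (Fin d → ℝ) → ENNReal := fun ω x =>
    ENNReal.ofReal (Real.exp (x ⬝ᵥ (S ω).ofLp - c * (x ⬝ᵥ (V ω *ᵥ x)))) with hF
  have hFm : Measurable (Function.uncurry F) := by
    refine ENNReal.measurable_ofReal.comp (Real.measurable_exp.comp ?_)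
    simp only [dotProduct, Matrix.mulVec]
    have hx : ∀ i, Measurable fun p : Ω × (Fin d → ℝ) => p.2 i := fun i => by fun_prop
    have hSm : ∀ i, Measurable fun p : Ω × (Fin d → ℝ) => (S p.1) i := fun i =>
      (measurable_coord (h.measurable_noiseSum t) i).comp measurable_fst
    have hVm : ∀ i j, Measurable fun p : Ω × (Fin d → ℝ) => V p.1 i j := fun i j =>
      (measurable_gram_entry lam (fun s _ => h.measurable_arm s) i j).comp measurable_fst
    refine (Finset.measurable_sum _ fun i _ => (hx i).mul (hSm i)).sub
      ((Finset.measurable_sum _ fun i _ => (hx i).mul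
        (Finset.measurable_sum _ fun j _ => (hVm i j).mul (hx j))).const_mul c)
  -- integrate over the noise first
  have hle : ∫⁻ ω, (∫⁻ x, F ω x) ∂P ≤ ENNReal.ofReal (1 / √V0.det) * G := by
    rw [lintegral_lintegral_swap hFm.aemeasurable]
    have h0 := lintegral_exp_quadratic hV0p (0 : Vec d) hc0
    rw [sqNorm_zero, zero_div, Real.exp_zero] at h0
    rw [hG, ← h0]
    refine lintegral_mono fun x => ?_
    have h1 := h.lintegral_exp_le_one (WithLp.toLp 2 x) t
    have h2 : ∀ ω, F ω x = ENNReal.ofReal (Real.exp (x ⬝ᵥ (0 : Vec d).ofLp - c * (x ⬝ᵥ (V0 *ᵥ x))))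
        * ENNReal.ofReal (Real.exp (∑ s ∈ Finset.Icc 1 t,
          (⟪WithLp.toLp 2 x, A s ω⟫ * noise θ A Y s ω
            - ⟪WithLp.toLp 2 x, A s ω⟫ ^ 2 * sigStar ^ 2 / 2))) := by
      intro ω
      rw [← ENNReal.ofReal_mul (Real.exp_pos _).le, ← Real.exp_add]
      have h3 : x ⬝ᵥ (S ω).ofLp
          = ∑ s ∈ Finset.Icc 1 t, ⟪WithLp.toLp 2 x, A s ω⟫ * noise θ A Y s ω := by
        rw [hS]
        simp only [noiseSum_eq, WithLp.ofLp_sum, WithLp.ofLp_smul, dotProduct_sum,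
          dotProduct_smul, smul_eq_mul, inner_eq_dotProduct]
        exact Finset.sum_congr rfl fun s _ => mul_comm _ _
      have h4 : x ⬝ᵥ (V ω *ᵥ x)
          = x ⬝ᵥ (V0 *ᵥ x) + ∑ s ∈ Finset.Icc 1 t, ⟪WithLp.toLp 2 x, A s ω⟫ ^ 2 := by
        have h5 := sqNorm_gram lam (fun s => A s ω) t (WithLp.toLp 2 x)
        rw [sqNorm, norm_sq_eq_dotProduct] at h5
        simp only [hVdef, hV0, h5, Matrix.smul_mulVec, Matrix.one_mulVec, dotProduct_smul,
          smul_eq_mul, real_inner_comm]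
      simp only [hF, h3, h4, Finset.sum_sub_distrib, ← Finset.sum_div, ← Finset.sum_mul]
      congr 2
      simp only [WithLp.ofLp_zero, dotProduct_zero, hc]
      ring
    simp only [h2]
    rw [lintegral_const_mul']
    · exact mul_le_of_le_one_right zero_le h1
    · exact ENNReal.ofReal_ne_top
  have heq : ∀ ω, ∫⁻ x, F ω x = ENNReal.ofReal (1 / √V0.det) * G
      * ENNReal.ofReal (Real.exp (sqNorm (V ω)⁻¹ (S ω) / (2 * sigStar ^ 2)
        - logDet lam (fun s => A s ω) t / 2)) := by
    intro ω
    have hd := (hVp ω).det_pos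
    have hd0 := hV0p.det_pos
    rw [hF]
    simp only []
    rw [lintegral_exp_quadratic (hVp ω) (S ω) hc0, mul_right_comm,
      ← ENNReal.ofReal_mul (by positivity)]
    congr 2
    have h6 : Real.exp (logDet lam (fun s => A s ω) t / 2) = √(V ω).det / √V0.det := by
      rw [logDet, Real.exp_half, Real.exp_log (div_pos hd (by rw [gram_zero]; exact hd0)),
        gram_zero, Real.sqrt_div' _ hd0.le]
    have h7 : 4 * c = 2 * sigStar ^ 2 := by rw [hc]; ring
    have := Real.sqrt_pos.2 hd
    have := Real.sqrt_pos.2 hd0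
    rw [Real.exp_sub, h6, h7]
    field_simp
  simp only [heq] at hle
  have hk0 : ENNReal.ofReal (1 / √V0.det) * G ≠ 0 := by
    refine mul_ne_zero ?_ hG0
    have := Real.sqrt_pos.2 hV0p.det_pos
    exact (ENNReal.ofReal_pos.2 (by positivity)).ne'
  have hkt : ENNReal.ofReal (1 / √V0.det) * G ≠ ⊤ := ENNReal.mul_ne_top ENNReal.ofReal_ne_top hGt
  rw [lintegral_const_mul' _ _ hkt] at hle
  exact (ENNReal.mul_le_mul_iff_right hk0 hkt).1 (by rwa [mul_one])

theorem IsLinearBandit.noise_ae_eq_zero (h : IsLinearBandit P θ 0 arms A Y) {t : ℕ}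
    (ht : 1 ≤ t) : ∀ᵐ ω ∂P, noise θ A Y t ω = 0 := by
  have h1 := integral_mul_sq_le_of_subgaussian (preReward_le h.measurable_arm h.measurable_reward t)
    le_rfl (h.measurable_noise t) (h.integrable_exp t ht) (h.subgaussian t ht)
    (Z := fun _ => 1) stronglyMeasurable_const (fun _ => zero_le_one) (fun _ => le_rfl)
  have h2 := integrable_sq_of_integrable_exp (h.measurable_noise t) (h.integrable_exp t ht)
  simp only [one_mul, ne_eq, OfNat.ofNat_ne_zero, not_false_eq_true, zero_pow, mul_zero,
    zero_mul] at h1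
  have h3 : ∫ ω, noise θ A Y t ω ^ 2 ∂P = 0 :=
    le_antisymm h1 (integral_nonneg fun _ => sq_nonneg _)
  rw [integral_eq_zero_iff_of_nonneg (fun _ => sq_nonneg _) h2] at h3
  filter_upwards [h3] with ω hω
  simpa using hω

/-- The self-normalized confidence bound at a fixed time. -/
theorem IsLinearBandit.measureReal_radius_lt_le (h : IsLinearBandit P θ sigStar arms A Y)
    (hσ : 0 ≤ sigStar) {lam : ℝ} (hl : 0 < lam) (t : ℕ) :
    P.real {ω | radius lam sigStar ‖θ‖ (fun s => A s ω) t
      < sqNorm (gram lam (fun s => A s ω) t)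
        (errVec lam θ (fun s => A s ω) (fun s => Y s ω) t)} ≤ failureRate t := by
  have hδ : 0 < failureRate t := by unfold failureRate; positivity
  have hbad : ∀ ω, radius lam sigStar ‖θ‖ (fun s => A s ω) t
      < sqNorm (gram lam (fun s => A s ω) t)
        (errVec lam θ (fun s => A s ω) (fun s => Y s ω) t) →
      sigStar ^ 2 * (logDet lam (fun s => A s ω) t + 2 * Real.log (1 / failureRate t))
        < sqNorm (gram lam (fun s => A s ω) t)⁻¹
          (noiseSum θ (fun s => A s ω) (fun s => Y s ω) t) := by
    intro ω hω
    have h1 := hω.trans_le (sqNorm_errVec_le hl θ (fun s => A s ω) (fun s => Y s ω) t)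
    have h2 := lt_of_pow_lt_pow_left₀ 2 (by positivity) h1
    have h3 : sigStar * √(logDet lam (fun s => A s ω) t + 2 * Real.log (1 / failureRate t))
        < √(sqNorm (gram lam (fun s => A s ω) t)⁻¹
          (noiseSum θ (fun s => A s ω) (fun s => Y s ω) t)) := by
      have := lt_of_add_lt_add_right h2
      exact this
    have h4 := (Real.lt_sqrt (by positivity)).1 h3
    rwa [mul_pow, Real.sq_sqrt (logDet_add_log_nonneg hl _ t)] at h4
  rcases hσ.eq_or_lt with h0 | h0
  · subst h0
    have hz : P {ω | radius lam 0 ‖θ‖ (fun s => A s ω) t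
      < sqNorm (gram lam (fun s => A s ω) t)
        (errVec lam θ (fun s => A s ω) (fun s => Y s ω) t)} = 0 := by
      have h1 : ∀ᵐ ω ∂P, ∀ s ∈ Finset.Icc 1 t, noise θ A Y s ω = 0 :=
        (ae_ball_iff (Finset.countable_toSet _)).2 fun s hs =>
          h.noise_ae_eq_zero (Finset.mem_Icc.1 hs).1
      refine measure_mono_null (fun ω hω => ?_) (ae_iff.1 h1)
      intro hn
      have := hbad ω hω
      rw [noiseSum_eq, Finset.sum_eq_zero (fun s hs => by rw [hn s hs, zero_smul]),
        sqNorm_zero] at this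
      simp at this
    rw [measureReal_def, hz]
    exact hδ.le
  · set g : Ω → ENNReal := fun ω => ENNReal.ofReal (Real.exp (sqNorm (gram lam (fun s => A s ω) t)⁻¹
        (noiseSum θ (fun s => A s ω) (fun s => Y s ω) t) / (2 * sigStar ^ 2)
        - logDet lam (fun s => A s ω) t / 2)) with hg
    have hgm : Measurable g := by
      refine ENNReal.measurable_ofReal.comp (Real.measurable_exp.comp ?_)
      exact ((measurable_sqNorm (measurable_inv_entry (measurable_gram_entry lam
        fun s _ => h.measurable_arm s)) (h.measurable_noiseSum t)).div_const _).sub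
        ((measurable_logDet lam fun s _ => h.measurable_arm s).div_const _)
    have hmk := mul_meas_ge_le_lintegral (μ := P) hgm (ENNReal.ofReal (1 / failureRate t))
    have hsub : {ω | radius lam sigStar ‖θ‖ (fun s => A s ω) t
      < sqNorm (gram lam (fun s => A s ω) t)
        (errVec lam θ (fun s => A s ω) (fun s => Y s ω) t)}
        ⊆ {ω | ENNReal.ofReal (1 / failureRate t) ≤ g ω} := by
      intro ω hω
      have h1 := hbad ω hω
      refine ENNReal.ofReal_le_ofReal ?_
      rw [← Real.log_le_iff_le_exp (by positivity)]
      have h2 : logDet lam (fun s => A s ω) t / 2 + Real.log (1 / failureRate t)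
          ≤ sqNorm (gram lam (fun s => A s ω) t)⁻¹
          (noiseSum θ (fun s => A s ω) (fun s => Y s ω) t) / (2 * sigStar ^ 2) := by
        rw [le_div_iff₀ (by positivity)]
        linarith
      linarith
    have h5 : ENNReal.ofReal (1 / failureRate t) * P {ω | radius lam sigStar ‖θ‖ (fun s => A s ω) t
      < sqNorm (gram lam (fun s => A s ω) t)
        (errVec lam θ (fun s => A s ω) (fun s => Y s ω) t)} ≤ 1 :=
      le_trans (mul_le_mul_right (measure_mono hsub) _)
        (hmk.trans (h.lintegral_exp_sqNorm_le_one hl h0 t))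
    have h6 := ENNReal.toReal_mono ENNReal.one_ne_top h5
    rw [ENNReal.toReal_mul, ENNReal.toReal_ofReal (by positivity), ENNReal.toReal_one,
      one_div, inv_mul_le_iff₀ hδ, mul_one] at h6
    exact h6

end Confidence

/-! ### The expected prediction error -/

section Prediction

variable {Ω : Type*} [mΩ : MeasurableSpace Ω] {P : Measure Ω}
  {θ : Vec d} {sigStar B : ℝ} {arms : ℕ → Finset (Vec d)} {A : ℕ → Ω → Vec d} {Y : ℕ → Ω → ℝ}
  {lam : ℝ}

/-- The squared width `‖a‖²_{V_{t-1}⁻¹}` of an arm in round `t`. -/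
noncomputable def width (lam : ℝ) {Ω : Type*} (A : ℕ → Ω → Vec d) (t : ℕ) (a : Vec d) (ω : Ω) : ℝ :=
  sqNorm (gram lam (fun s => A s ω) (t - 1))⁻¹ a

/-- The prediction error `⟨θ - θ̂_{t-1}, a⟩` at an arm in round `t`. -/
noncomputable def predErr (lam : ℝ) (θ : Vec d) {Ω : Type*} (A : ℕ → Ω → Vec d) (Y : ℕ → Ω → ℝ)
    (t : ℕ) (a : Vec d) (ω : Ω) : ℝ :=
  ⟪errVec lam θ (fun s => A s ω) (fun s => Y s ω) (t - 1), a⟫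

/-- The potential `‖θ - θ̂_t‖²_{V_t}`. -/
noncomputable def potential (lam : ℝ) (θ : Vec d) {Ω : Type*} (A : ℕ → Ω → Vec d)
    (Y : ℕ → Ω → ℝ) (t : ℕ) (ω : Ω) : ℝ :=
  sqNorm (gram lam (fun s => A s ω) t) (errVec lam θ (fun s => A s ω) (fun s => Y s ω) t)

theorem width_nonneg {Ω : Type*} (hl : 0 < lam) (A : ℕ → Ω → Vec d) (t : ℕ) (a : Vec d) (ω : Ω) :
    0 ≤ width lam A t a ω := sqNorm_nonneg (gram_posDef hl _ _).inv.posSemidef a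

theorem width_le {Ω : Type*} (hl : 0 < lam) (A : ℕ → Ω → Vec d) (t : ℕ) {a : Vec d}
    (ha : ‖a‖ ≤ 1) (ω : Ω) : width lam A t a ω ≤ 1 / lam := by
  refine (sqNorm_gram_inv_le hl _ _ a).trans ?_
  gcongr
  exact pow_le_one₀ (norm_nonneg _) ha

theorem predErr_sq_le {Ω : Type*} (hl : 0 < lam) (A : ℕ → Ω → Vec d) (Y : ℕ → Ω → ℝ) (t : ℕ)
    (a : Vec d) (ω : Ω) :
    predErr lam θ A Y t a ω ^ 2 ≤ potential lam θ A Y (t - 1) ω * width lam A t a ω :=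
  inner_sq_le (gram_posDef hl _ _) _ _

theorem potential_nonneg {Ω : Type*} (hl : 0 < lam) (A : ℕ → Ω → Vec d) (Y : ℕ → Ω → ℝ) (t : ℕ)
    (ω : Ω) : 0 ≤ potential lam θ A Y t ω := sqNorm_nonneg (gram_posDef hl _ _).posSemidef _

theorem measurable_width (lam : ℝ) {t : ℕ} (hA : ∀ s ∈ Finset.Icc 1 (t - 1), Measurable (A s))
    {x : Ω → Vec d} (hx : Measurable x) : Measurable fun ω => width lam A t (x ω) ω :=
  measurable_sqNorm (measurable_inv_entry (measurable_gram_entry lam hA)) hx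

theorem measurable_predErr (lam : ℝ) (θ : Vec d) {t : ℕ}
    (hA : ∀ s ∈ Finset.Icc 1 (t - 1), Measurable (A s))
    (hY : ∀ s ∈ Finset.Icc 1 (t - 1), Measurable (Y s))
    {x : Ω → Vec d} (hx : Measurable x) : Measurable fun ω => predErr lam θ A Y t (x ω) ω :=
  (measurable_errVec lam θ hA hY).inner hx

theorem measurable_potential (lam : ℝ) (θ : Vec d) {t : ℕ}
    (hA : ∀ s ∈ Finset.Icc 1 t, Measurable (A s)) (hY : ∀ s ∈ Finset.Icc 1 t, Measurable (Y s)) :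
    Measurable (potential lam θ A Y t) :=
  measurable_sqNorm (measurable_gram_entry lam hA) (measurable_errVec lam θ hA hY)

theorem IsLinearBandit.ae_mem_arms (h : IsLinearBandit P θ sigStar arms A Y) :
    ∀ᵐ ω ∂P, ∀ t, 1 ≤ t → A t ω ∈ arms t :=
  ae_all_iff.2 fun t => by
    by_cases ht : 1 ≤ t
    · filter_upwards [h.mem_arms t ht] with ω hω _ using hω
    · exact Filter.Eventually.of_forall fun _ h => absurd h ht

theorem IsLinearBandit.ae_norm_le_one (h : IsLinearBandit P θ sigStar arms A Y)
    (henv : IsBoundedEnv θ arms B) : ∀ᵐ ω ∂P, ∀ t, 1 ≤ t → ‖A t ω‖ ≤ 1 := by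
  filter_upwards [h.ae_mem_arms] with ω hω t ht
  exact henv.norm_le_one t ht _ (hω t ht)

variable [IsProbabilityMeasure P]

theorem IsLinearBandit.integrable_potential (h : IsLinearBandit P θ sigStar arms A Y)
    (hl : 0 < lam) (t : ℕ) : Integrable (potential lam θ A Y t) P := by
  have hi : Integrable (fun ω => lam * ‖θ‖ ^ 2
      + ∑ s ∈ Finset.Icc 1 t, noise θ A Y s ω ^ 2) P := by
    refine (integrable_const _).add (integrable_finsetSum _ fun s hs => ?_)
    exact integrable_sq_of_integrable_exp (h.measurable_noise s)
      (h.integrable_exp s (Finset.mem_Icc.1 hs).1)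
  refine hi.mono' (measurable_potential lam θ (fun s _ => h.measurable_arm s)
    fun s _ => h.measurable_reward s).aestronglyMeasurable ?_
  refine Filter.Eventually.of_forall fun ω => ?_
  rw [Real.norm_of_nonneg (potential_nonneg hl A Y t ω)]
  exact sqNorm_errVec_le_sum hl θ _ _ t

theorem IsLinearBandit.memLp_predErr (h : IsLinearBandit P θ sigStar arms A Y)
    (hl : 0 < lam) (t : ℕ) {x : Ω → Vec d} (hx : Measurable x) (hx1 : ∀ᵐ ω ∂P, ‖x ω‖ ≤ 1) :
    MemLp (fun ω => predErr lam θ A Y t (x ω) ω) 2 P := by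
  have hm := measurable_predErr lam θ (t := t) (fun s _ => h.measurable_arm s)
    (fun s _ => h.measurable_reward s) hx
  refine (memLp_two_iff_integrable_sq hm.aestronglyMeasurable).2 ?_
  refine ((h.integrable_potential (lam := lam) hl (t - 1)).mul_const (1 / lam)).mono'
    (hm.pow_const 2).aestronglyMeasurable ?_
  filter_upwards [hx1] with ω hω
  rw [Real.norm_of_nonneg (sq_nonneg _)]
  exact (predErr_sq_le hl A Y t (x ω) ω).trans
    (mul_le_mul_of_nonneg_left (width_le hl A t hω ω) (potential_nonneg hl A Y _ ω))

theorem integrable_of_bounds {f : Ω → ℝ} (hf : Measurable f) {c : ℝ}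
    (h : ∀ᵐ ω ∂P, 0 ≤ f ω ∧ f ω ≤ c) : Integrable f P := by
  refine (integrable_const c).mono' hf.aestronglyMeasurable ?_
  filter_upwards [h] with ω hω
  rw [Real.norm_of_nonneg hω.1]
  exact hω.2

theorem IsLinearBandit.integrable_predErr_sq_div (h : IsLinearBandit P θ sigStar arms A Y)
    (henv : IsBoundedEnv θ arms B) (hl : 0 < lam) {t : ℕ} (ht : 1 ≤ t) :
    Integrable (fun ω => predErr lam θ A Y t (A t ω) ω ^ 2 / (1 + width lam A t (A t ω) ω)) P := by
  have hm := h.memLp_predErr hl t (h.measurable_arm t)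
    ((h.ae_norm_le_one henv).mono fun ω hω => hω t ht)
  refine hm.integrable_sq.mono' ?_ (Filter.Eventually.of_forall fun ω => ?_)
  · exact (((measurable_predErr lam θ (fun s _ => h.measurable_arm s)
      (fun s _ => h.measurable_reward s) (h.measurable_arm t)).pow_const 2).div
      (measurable_const.add (measurable_width lam (fun s _ => h.measurable_arm s)
        (h.measurable_arm t)))).aestronglyMeasurable
  · have hw := width_nonneg hl A t (A t ω) ω
    rw [Real.norm_of_nonneg (by positivity)]
    exact div_le_self (sq_nonneg _) (by linarith)

theorem IsLinearBandit.integrable_log_width (h : IsLinearBandit P θ sigStar arms A Y)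
    (henv : IsBoundedEnv θ arms B) (hl : 0 < lam) {t : ℕ} (ht : 1 ≤ t) :
    Integrable (fun ω => Real.log (1 + width lam A t (A t ω) ω)) P := by
  refine integrable_of_bounds (c := 1 / lam) (Real.measurable_log.comp (measurable_const.add
    (measurable_width lam (fun s _ => h.measurable_arm s) (h.measurable_arm t)))) ?_
  filter_upwards [h.ae_norm_le_one henv] with ω hω
  have hw := width_nonneg hl A t (A t ω) ω
  refine ⟨Real.log_nonneg (by linarith), ?_⟩
  have := Real.log_le_sub_one_of_pos (show 0 < 1 + width lam A t (A t ω) ω by linarith)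
  linarith [width_le hl A t (hω t ht) ω]

theorem div_one_add_le_log {w : ℝ} (hw : 0 ≤ w) : w / (1 + w) ≤ Real.log (1 + w) := by
  have h := Real.one_sub_inv_le_log_of_pos (show 0 < 1 + w by linarith)
  have h2 : w / (1 + w) = 1 - (1 + w)⁻¹ := by field_simp; ring
  rw [h2]; exact h

/-- One step of the online regression argument, in expectation: the noise is centered and has
conditional second moment at most `2 σ_*²`. -/
theorem IsLinearBandit.integral_potential_succ_le (h : IsLinearBandit P θ sigStar arms A Y)
    (henv : IsBoundedEnv θ arms B) (hσ : 0 ≤ sigStar) (hl : 0 < lam) (t : ℕ) :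
    ∫ ω, potential lam θ A Y (t + 1) ω ∂P
        + ∫ ω, predErr lam θ A Y (t + 1) (A (t + 1) ω) ω ^ 2
          / (1 + width lam A (t + 1) (A (t + 1) ω) ω) ∂P
      ≤ ∫ ω, potential lam θ A Y t ω ∂P
        + 2 * sigStar ^ 2 * ∫ ω, Real.log (1 + width lam A (t + 1) (A (t + 1) ω) ω) ∂P := by
  have ht : 1 ≤ t + 1 := by omega
  set y : Ω → ℝ := fun ω => predErr lam θ A Y (t + 1) (A (t + 1) ω) ω with hy
  set w : Ω → ℝ := fun ω => width lam A (t + 1) (A (t + 1) ω) ω with hw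
  set η : Ω → ℝ := noise θ A Y (t + 1) with hη
  have hw0 : ∀ ω, 0 ≤ w ω := fun ω => width_nonneg hl A _ _ ω
  have hpre := preReward_le h.measurable_arm h.measurable_reward (t + 1)
  have hAs : ∀ s ∈ Finset.Icc 1 (t + 1 - 1), Measurable[preReward A Y (t + 1)] (A s) := fun s hs =>
    (measurable_hist_arm hs).mono (hist_le_preReward (t + 1)) le_rfl
  have hYs : ∀ s ∈ Finset.Icc 1 (t + 1 - 1), Measurable[preReward A Y (t + 1)] (Y s) := fun s hs =>
    (measurable_hist_reward hs).mono (hist_le_preReward (t + 1)) le_rfl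
  have hym : Measurable[preReward A Y (t + 1)] y :=
    @measurable_predErr _ _ (preReward A Y (t + 1)) _ _ lam θ _ hAs hYs _
      (measurable_preReward_arm (t + 1))
  have hwm : Measurable[preReward A Y (t + 1)] w :=
    @measurable_width _ _ (preReward A Y (t + 1)) _ lam _ hAs _ (measurable_preReward_arm (t + 1))
  have hw1m : Measurable[preReward A Y (t + 1)] fun ω => 1 + w ω := hwm.const_add 1
  have hy2 : MemLp y 2 P := h.memLp_predErr hl (t + 1) (h.measurable_arm (t + 1))
    ((h.ae_norm_le_one henv).mono fun ω hω => hω (t + 1) ht)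
  have hηm := h.measurable_noise (t + 1)
  have hηint := h.integrable_exp (t + 1) ht
  have hηsub := h.subgaussian (t + 1) ht
  have hη2 : MemLp η 2 P := memLp_two_of_integrable_exp hηm hηint
  -- the cross term
  set Z1 : Ω → ℝ := fun ω => y ω / (1 + w ω) with hZ1
  have hZ1m : Measurable[preReward A Y (t + 1)] Z1 := hym.div hw1m
  have hZ1p : MemLp Z1 2 P := by
    refine hy2.mono (hZ1m.mono hpre le_rfl).aestronglyMeasurable
      (Filter.Eventually.of_forall fun ω => ?_)
    have := hw0 ω
    rw [hZ1, norm_div, Real.norm_of_nonneg (show 0 ≤ 1 + w ω by linarith)]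
    exact div_le_self (norm_nonneg _) (by linarith)
  have hcross := integral_mul_eq_zero_of_subgaussian hpre hηm hηint hηsub hZ1m.stronglyMeasurable
    hZ1p
  have hcrossi : Integrable (fun ω => Z1 ω * η ω) P := hZ1p.integrable_mul hη2
  -- the quadratic term
  set Z2 : Ω → ℝ := fun ω => w ω / (1 + w ω) with hZ2
  have hZ2m : Measurable[preReward A Y (t + 1)] Z2 := hwm.div hw1m
  have hZ20 : ∀ ω, 0 ≤ Z2 ω := fun ω => div_nonneg (hw0 ω) (by linarith [hw0 ω])
  have hZ21 : ∀ ω, Z2 ω ≤ 1 := fun ω => by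
    have := hw0 ω
    rw [hZ2, div_le_one (by linarith)]
    linarith
  have hquad := integral_mul_sq_le_of_subgaussian hpre hσ hηm hηint hηsub hZ2m.stronglyMeasurable
    hZ20 hZ21
  have hZ2i : Integrable Z2 P := integrable_of_bounds (hZ2m.mono hpre le_rfl)
    (Filter.Eventually.of_forall fun ω => ⟨hZ20 ω, hZ21 ω⟩)
  have hquadi : Integrable (fun ω => Z2 ω * η ω ^ 2) P := by
    refine hη2.integrable_sq.bdd_mul (c := 1) (hZ2m.mono hpre le_rfl).aestronglyMeasurable
      (Filter.Eventually.of_forall fun ω => ?_)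
    rw [Real.norm_of_nonneg (hZ20 ω)]; exact hZ21 ω
  have hlogi := h.integrable_log_width henv hl ht
  have hlog : ∫ ω, Z2 ω ∂P ≤ ∫ ω, Real.log (1 + w ω) ∂P :=
    integral_mono hZ2i hlogi fun ω => div_one_add_le_log (hw0 ω)
  have hDi := h.integrable_potential hl t
  have hDi' := h.integrable_potential hl (t + 1)
  have hyi := h.integrable_predErr_sq_div henv hl ht
  have hrec : ∀ ω, potential lam θ A Y (t + 1) ω + y ω ^ 2 / (1 + w ω)
      = potential lam θ A Y t ω + ((-2) * (Z1 ω * η ω) + Z2 ω * η ω ^ 2) := by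
    intro ω
    have h1 := sqNorm_errVec_succ hl θ (fun s => A s ω) (fun s => Y s ω) t
      (y := y ω) (w := w ω) (η := η ω) rfl rfl rfl
    have h2 : (1 + w ω) ≠ 0 := by linarith [hw0 ω]
    rw [potential, potential, h1, hZ1, hZ2]
    field_simp
    ring
  have hsum : ∫ ω, potential lam θ A Y (t + 1) ω ∂P + ∫ ω, y ω ^ 2 / (1 + w ω) ∂P
      = ∫ ω, (potential lam θ A Y t ω + ((-2) * (Z1 ω * η ω) + Z2 ω * η ω ^ 2)) ∂P := by
    rw [← integral_add hDi' hyi]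
    exact integral_congr_ae (Filter.Eventually.of_forall hrec)
  have hci : Integrable (fun ω => (-2) * (Z1 ω * η ω)) P := hcrossi.const_mul _
  have hsi : Integrable (fun ω => (-2) * (Z1 ω * η ω) + Z2 ω * η ω ^ 2) P := hci.add hquadi
  rw [hsum, integral_add hDi hsi, integral_add hci hquadi, integral_const_mul, hcross]
  have := mul_le_mul_of_nonneg_left hlog (show 0 ≤ 2 * sigStar ^ 2 by positivity)
  linarith

theorem IsLinearBandit.sum_integral_log_width_le (h : IsLinearBandit P θ sigStar arms A Y)
    (henv : IsBoundedEnv θ arms B) (hl : 0 < lam) (n : ℕ) :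
    ∑ t ∈ Finset.Icc 1 n, ∫ ω, Real.log (1 + width lam A t (A t ω) ω) ∂P
      ≤ d * Real.log (d + n / lam) := by
  have hi : ∀ t ∈ Finset.Icc 1 n,
      Integrable (fun ω => Real.log (1 + width lam A t (A t ω) ω)) P := fun t ht =>
    h.integrable_log_width henv hl (Finset.mem_Icc.1 ht).1
  rw [← integral_finsetSum _ hi]
  refine (integral_mono_ae (integrable_finsetSum _ hi)
    (integrable_const (d * Real.log (d + n / lam))) ?_).trans (by simp)
  filter_upwards [h.ae_norm_le_one henv] with ω hω
  have h1 := logDet_eq_sum hl (fun s => A s ω) n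
  have h2 := logDet_le hl (fun s => A s ω) n fun s hs => hω s (Finset.mem_Icc.1 hs).1
  rw [h1] at h2
  exact h2

/-- The total squared prediction error along the trajectory is, in expectation, of the order of
the true squared radius; there is no further factor `d`. -/
theorem IsLinearBandit.sum_integral_predErr_sq_le (h : IsLinearBandit P θ sigStar arms A Y)
    (henv : IsBoundedEnv θ arms B) (hσ : 0 ≤ sigStar) (hl : 0 < lam) (n : ℕ) :
    ∑ t ∈ Finset.Icc 1 n, ∫ ω, predErr lam θ A Y t (A t ω) ω ^ 2
        / (1 + width lam A t (A t ω) ω) ∂P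
      ≤ lam * ‖θ‖ ^ 2 + 2 * sigStar ^ 2 * (d * Real.log (d + n / lam)) := by
  have hind : ∀ n : ℕ, ∫ ω, potential lam θ A Y n ω ∂P
      + ∑ t ∈ Finset.Icc 1 n, ∫ ω, predErr lam θ A Y t (A t ω) ω ^ 2
        / (1 + width lam A t (A t ω) ω) ∂P
      ≤ lam * ‖θ‖ ^ 2 + 2 * sigStar ^ 2
        * ∑ t ∈ Finset.Icc 1 n, ∫ ω, Real.log (1 + width lam A t (A t ω) ω) ∂P := by
    intro n
    induction n with
    | zero => simp [potential, sqNorm_errVec_zero]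
    | succ n ih =>
      have := h.integral_potential_succ_le henv hσ hl n
      rw [Finset.sum_Icc_succ_top (by omega), Finset.sum_Icc_succ_top (by omega)]
      linarith
  have h1 := hind n
  have h2 : 0 ≤ ∫ ω, potential lam θ A Y n ω ∂P :=
    integral_nonneg fun ω => potential_nonneg hl A Y n ω
  have h3 := mul_le_mul_of_nonneg_left (h.sum_integral_log_width_le henv hl n)
    (show 0 ≤ 2 * sigStar ^ 2 by positivity)
  linarith

end Prediction

/-! ### Averaging over the sampled arm -/

section Rounds

variable {Ω : Type*} [mΩ : MeasurableSpace Ω] {P : Measure Ω}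
  {θ : Vec d} {sigStar B : ℝ} {arms : ℕ → Finset (Vec d)} {A : ℕ → Ω → Vec d} {Y : ℕ → Ω → ℝ}
  {I : Input} {oracle : Finset (Vec d) → Vec d → ℝ}
  {ahat : ℕ → Ω → Vec d} {qopt : ℕ → Ω → Vec d → ℝ} {bsel : ℕ → Ω → Vec d}

/-- The sampling probability of an arm in round `t`, as a random variable. -/
noncomputable def armProb (I : Input) (arms : ℕ → Finset (Vec d)) {Ω : Type*} (A : ℕ → Ω → Vec d)
    (Y : ℕ → Ω → ℝ) (ahat : ℕ → Ω → Vec d) (qopt : ℕ → Ω → Vec d → ℝ) (bsel : ℕ → Ω → Vec d)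
    (t : ℕ) (a : Vec d) (ω : Ω) : ℝ :=
  sampleProb I (fun s => A s ω) (fun s => Y s ω) t (arms t) (qopt t ω) (ahat t ω) (bsel t ω) a

theorem armProb_nonneg {Ω : Type*} {A : ℕ → Ω → Vec d} {Y : ℕ → Ω → ℝ}
    {ahat : ℕ → Ω → Vec d} {qopt : ℕ → Ω → Vec d → ℝ} {bsel : ℕ → Ω → Vec d}
    {Copt Csupp : ℝ} {j : ℕ} (hO : IsApproxDesign Copt Csupp j oracle)
    (hI : I.Valid) {t : ℕ} {ω : Ω} (hdes : IsAugmentedDesign oracle I.ver (arms t)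
      (weight I (fun s => A s ω) (fun s => Y s ω) t (ahat t ω)) (qopt t ω))
    (hs : ahat t ω ∈ arms t) {a : Vec d} (ha : a ∈ arms t) :
    0 ≤ armProb I arms A Y ahat qopt bsel t a ω :=
  sampleProb_nonneg hI (fun _ ha => IsAugmentedDesign.nonneg hO hdes ha) hs ha

variable [IsProbabilityMeasure P]

/-- Averages of the sampled arm, for a random function of the arm determined by the history. -/
theorem IsRun.integral_comp_arm (hrun : IsRun P I oracle arms A Y ahat qopt bsel)
    (h : IsLinearBandit P θ sigStar arms A Y) {t : ℕ} (ht : 1 ≤ t) {g : Vec d → Ω → ℝ}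
    (hg : ∀ a ∈ arms t, Measurable[hist A Y (t - 1)] (g a))
    (hgi : ∀ a ∈ arms t, Integrable (g a) P) :
    Integrable (fun ω => g (A t ω) ω) P ∧
    (∀ a ∈ arms t,
      Integrable (fun ω => armProb I arms A Y ahat qopt bsel t a ω * g a ω) P) ∧
    ∫ ω, g (A t ω) ω ∂P
      = ∫ ω, ∑ a ∈ arms t, armProb I arms A Y ahat qopt bsel t a ω * g a ω ∂P := by
  have hm := hist_le h.measurable_arm h.measurable_reward (t - 1)
  have hset : ∀ a, MeasurableSet {ω | A t ω = a} := fun a =>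
    h.measurable_arm t (measurableSet_singleton a)
  set J : Vec d → Ω → ℝ := fun a => Set.indicator {ω | A t ω = a} fun _ => (1 : ℝ) with hJ
  have hJm : ∀ a, Measurable (J a) := fun a => measurable_const.indicator (hset a)
  have hJ1 : ∀ a ω, A t ω = a → J a ω = 1 := fun a ω hω =>
    Set.indicator_of_mem (s := {ω | A t ω = a}) hω _
  have hJ0 : ∀ a ω, A t ω ≠ a → J a ω = 0 := fun a ω hω =>
    Set.indicator_of_notMem (s := {ω | A t ω = a}) hω _
  have hJb : ∀ a ω, ‖J a ω‖ ≤ 1 := fun a ω => by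
    by_cases hω : A t ω = a
    · rw [hJ1 a ω hω]; simp
    · rw [hJ0 a ω hω]; simp
  have hJi : ∀ a, Integrable (J a) P := fun a => (integrable_const (1 : ℝ)).mono'
    (hJm a).aestronglyMeasurable (Filter.Eventually.of_forall (hJb a))
  have hgJ : ∀ a ∈ arms t, Integrable (g a * J a) P := fun a ha => by
    rw [mul_comm]
    exact (hgi a ha).bdd_mul (hJm a).aestronglyMeasurable (Filter.Eventually.of_forall (hJb a))
  have hcond : ∀ a ∈ arms t, P[g a * J a | hist A Y (t - 1)]
      =ᵐ[P] fun ω => armProb I arms A Y ahat qopt bsel t a ω * g a ω := by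
    intro a ha
    filter_upwards [condExp_mul_of_stronglyMeasurable_left (hg a ha).stronglyMeasurable (hgJ a ha)
      (hJi a), hrun.sampling t ht a ha] with ω h1 h2
    rw [h1, Pi.mul_apply, h2, mul_comm]
    rfl
  have hpi : ∀ a ∈ arms t,
      Integrable (fun ω => armProb I arms A Y ahat qopt bsel t a ω * g a ω) P := fun a ha =>
    integrable_condExp.congr (hcond a ha)
  have hsum : (fun ω => ∑ a ∈ arms t, (g a * J a) ω) =ᵐ[P] fun ω => g (A t ω) ω := by
    filter_upwards [h.mem_arms t ht] with ω hω
    rw [Finset.sum_eq_single (A t ω)]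
    · rw [Pi.mul_apply, hJ1 _ _ rfl, mul_one]
    · intro b _ hb
      rw [Pi.mul_apply, hJ0 _ _ hb.symm, mul_zero]
    · exact fun hn => absurd hω hn
  refine ⟨(integrable_finsetSum _ hgJ).congr hsum, hpi, ?_⟩
  rw [← integral_congr_ae hsum, integral_finsetSum _ hgJ, integral_finsetSum _ hpi]
  refine Finset.sum_congr rfl fun a ha => ?_
  rw [← integral_condExp hm, integral_congr_ae (hcond a ha)]

/-- The arms of round `t` are all explored. -/
def exploredEvent (lam : ℝ) (arms : ℕ → Finset (Vec d)) {Ω : Type*} (A : ℕ → Ω → Vec d) (t : ℕ) :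
    Set Ω := {ω | ∀ a ∈ arms t, width lam A t a ω ≤ 1}

/-- `θ` lies in the true confidence ellipsoid of round `t`. -/
def confidenceEvent (lam sigStar : ℝ) (θ : Vec d) {Ω : Type*} (A : ℕ → Ω → Vec d)
    (Y : ℕ → Ω → ℝ) (t : ℕ) : Set Ω :=
  {ω | potential lam θ A Y (t - 1) ω ≤ radius lam sigStar ‖θ‖ (fun s => A s ω) (t - 1)}

theorem measurableSet_exploredEvent (lam : ℝ) (arms : ℕ → Finset (Vec d)) {Ω : Type*}
    [MeasurableSpace Ω] {A : ℕ → Ω → Vec d} {t : ℕ}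
    (hA : ∀ s ∈ Finset.Icc 1 (t - 1), Measurable (A s)) :
    MeasurableSet (exploredEvent lam arms A t) := by
  have : exploredEvent lam arms A t = ⋂ a ∈ arms t, {ω | width lam A t a ω ≤ 1} := by
    ext ω; simp [exploredEvent]
  rw [this]
  exact Finset.measurableSet_biInter _ fun a _ =>
    measurableSet_le (measurable_width lam hA measurable_const) measurable_const

theorem measurableSet_confidenceEvent (lam sigStar : ℝ) (θ : Vec d) {Ω : Type*}
    [MeasurableSpace Ω] {A : ℕ → Ω → Vec d} {Y : ℕ → Ω → ℝ} {t : ℕ}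
    (hA : ∀ s ∈ Finset.Icc 1 (t - 1), Measurable (A s))
    (hY : ∀ s ∈ Finset.Icc 1 (t - 1), Measurable (Y s)) :
    MeasurableSet (confidenceEvent lam sigStar θ A Y t) :=
  measurableSet_le (measurable_potential lam θ hA hY) (measurable_radius lam _ _ hA)

theorem measurable_gap (θ : Vec d) (s : Finset (Vec d)) : Measurable (gap θ s) :=
  measurable_const.sub (innerSL ℝ θ).continuous.measurable

theorem IsBoundedEnv.bound_nonneg (henv : IsBoundedEnv θ arms B) : 0 ≤ B := by
  obtain ⟨a, ha⟩ := henv.nonempty 1 le_rfl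
  exact (gap_nonneg ha).trans (henv.gap_le 1 le_rfl a ha)

theorem IsLinearBandit.integrable_gap (h : IsLinearBandit P θ sigStar arms A Y)
    (henv : IsBoundedEnv θ arms B) {t : ℕ} (ht : 1 ≤ t) :
    Integrable (fun ω => gap θ (arms t) (A t ω)) P := by
  refine integrable_of_bounds (c := B) ((measurable_gap θ _).comp (h.measurable_arm t)) ?_
  filter_upwards [h.mem_arms t ht] with ω hω
  exact ⟨gap_nonneg hω, henv.gap_le t ht _ hω⟩

/-- The event that some arm of the round is unexplored is paid for by the growth of the
determinant: then, with probability at least one half, an arm is played that doubles it. -/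
theorem IsRun.measureReal_unexplored_le {Copt Csupp : ℝ} {j : ℕ}
    (hrun : IsRun P I oracle arms A Y ahat qopt bsel) (hO : IsApproxDesign Copt Csupp j oracle)
    (hI : I.Valid) (h : IsLinearBandit P θ sigStar arms A Y) (henv : IsBoundedEnv θ arms B)
    {t : ℕ} (ht : 1 ≤ t) :
    P.real (exploredEvent I.lam arms A t)ᶜ
      ≤ 3 * ∫ ω, Real.log (1 + width I.lam A t (A t ω) ω) ∂P := by
  have hm := hist_le h.measurable_arm h.measurable_reward (t - 1)
  have hAs : ∀ s ∈ Finset.Icc 1 (t - 1), Measurable[hist A Y (t - 1)] (A s) := fun s hs =>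
    measurable_hist_arm hs
  have hg : ∀ a ∈ arms t,
      Measurable[hist A Y (t - 1)] fun ω => Real.log (1 + width I.lam A t a ω) := fun a _ =>
    Real.measurable_log.comp (Measurable.const_add (@measurable_width _ _ (hist A Y (t - 1)) _ I.lam
      _ hAs _ measurable_const) 1)
  have hw0 := fun a ω => width_nonneg hI.lam_pos A t a ω
  have hlog0 : ∀ a ω, 0 ≤ Real.log (1 + width I.lam A t a ω) := fun a ω =>
    Real.log_nonneg (by linarith [hw0 a ω])
  have hgi : ∀ a ∈ arms t, Integrable (fun ω => Real.log (1 + width I.lam A t a ω)) P := by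
    intro a ha
    refine integrable_of_bounds (c := 1 / I.lam) ((hg a ha).mono hm le_rfl)
      (Filter.Eventually.of_forall fun ω => ⟨hlog0 a ω, ?_⟩)
    have := Real.log_le_sub_one_of_pos (show 0 < 1 + width I.lam A t a ω by linarith [hw0 a ω])
    linarith [width_le hI.lam_pos A t (henv.norm_le_one t ht a ha) ω]
  obtain ⟨-, hpi, heq⟩ := hrun.integral_comp_arm h ht hg hgi
  have hE : MeasurableSet (exploredEvent I.lam arms A t)ᶜ :=
    (measurableSet_exploredEvent I.lam arms fun s _ => h.measurable_arm s).compl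
  have hle : ∫ ω, (exploredEvent I.lam arms A t)ᶜ.indicator (fun _ => Real.log 2 / 2) ω ∂P
      ≤ ∫ ω, Real.log (1 + width I.lam A t (A t ω) ω) ∂P := by
    rw [heq]
    refine integral_mono ((integrable_const _).indicator hE) (integrable_finsetSum _ hpi) fun ω => ?_
    have hp0 : ∀ a ∈ arms t, 0 ≤ armProb I arms A Y ahat qopt bsel t a ω := fun a ha =>
      armProb_nonneg hO hI (hrun.qopt_design t ht ω) (hrun.ahat_mem t ht ω) ha
    have hnn : ∀ a ∈ arms t, 0 ≤ armProb I arms A Y ahat qopt bsel t a ω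
        * Real.log (1 + width I.lam A t a ω) := fun a ha => mul_nonneg (hp0 a ha) (hlog0 a ω)
    by_cases hω : ω ∈ (exploredEvent I.lam arms A t)ᶜ
    · rw [Set.indicator_of_mem hω]
      have hne : (unexplored I.lam (fun s => A s ω) t (arms t)).Nonempty := by
        simp only [exploredEvent, Set.mem_compl_iff, Set.mem_ofPred_eq, not_forall, not_le] at hω
        obtain ⟨a, ha, haw⟩ := hω
        exact ⟨a, ha, haw⟩
      obtain ⟨hb, hbw⟩ := hrun.bsel_mem t ht ω hne
      have hpb : 1 / 2 ≤ armProb I arms A Y ahat qopt bsel t (bsel t ω) ω := by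
        have := baseProb_nonneg (A := fun s => A s ω) (Y := fun s => Y s ω) (t := t) hI
          (fun a ha => IsAugmentedDesign.nonneg hO (hrun.qopt_design t ht ω) ha)
          (hrun.ahat_mem t ht ω) hb
        rw [armProb, sampleProb, if_pos hne, if_pos rfl]
        linarith
      have hlb : Real.log 2 ≤ Real.log (1 + width I.lam A t (bsel t ω) ω) := by
        refine Real.log_le_log two_pos ?_
        have : 1 < width I.lam A t (bsel t ω) ω := hbw
        linarith
      calc Real.log 2 / 2 = 1 / 2 * Real.log 2 := by ring
        _ ≤ armProb I arms A Y ahat qopt bsel t (bsel t ω) ω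
            * Real.log (1 + width I.lam A t (bsel t ω) ω) :=
          mul_le_mul hpb hlb (Real.log_nonneg one_le_two) (by linarith)
        _ ≤ _ := Finset.single_le_sum (f := fun a => armProb I arms A Y ahat qopt bsel t a ω
            * Real.log (1 + width I.lam A t a ω)) hnn hb
    · rw [Set.indicator_of_notMem hω]
      exact Finset.sum_nonneg hnn
  rw [integral_indicator_const _ hE, smul_eq_mul] at hle
  have h2 := Real.log_two_gt_d9
  have h3 : 0 ≤ P.real (exploredEvent I.lam arms A t)ᶜ := measureReal_nonneg
  nlinarith

theorem radius_div_radius_le (hI : I.Valid) (hσ : 0 ≤ sigStar) {R : ℝ} (hR : 0 ≤ R)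
    (A : ℕ → Vec d) (t : ℕ) :
    radius I.lam sigStar R A t / radius I.lam I.sig I.S A t
      ≤ (sigStar / I.sig + R / I.S) ^ 2 := by
  have hl := Real.sqrt_pos.2 hI.lam_pos
  have hs := hI.sig_pos
  have hS := hI.S_pos
  have hβ := radius_pos hI.lam_pos hI.sig_pos.le hI.S_pos A t
  rw [div_le_iff₀ hβ, radius, radius, ← mul_pow]
  set x := √(Real.log ((gram I.lam A t).det / (gram I.lam A 0).det)
      + 2 * Real.log (1 / failureRate t))
  have hx : 0 ≤ x := Real.sqrt_nonneg _
  refine pow_le_pow_left₀ (by positivity) ?_ 2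
  have e1 : (sigStar / I.sig + R / I.S) * (I.sig * x + √I.lam * I.S)
      = sigStar * x + √I.lam * R + (sigStar / I.sig * (√I.lam * I.S) + R / I.S * (I.sig * x)) := by
    field_simp
    ring
  rw [e1]
  have : 0 ≤ sigStar / I.sig * (√I.lam * I.S) + R / I.S * (I.sig * x) := by positivity
  linarith

theorem exp_radius_div_le_hMax (lam sig S sigStar SStar : ℝ) (A : ℕ → Vec d) {n t : ℕ}
    (ht : t ∈ Finset.Icc 1 n) :
    Real.exp (radius lam sigStar SStar A (t - 1) / radius lam sig S A (t - 1))
      ≤ hMax lam sig S sigStar SStar A n :=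
  le_csSup ((Set.finite_Icc 1 n).image _).bddAbove ⟨t, Finset.mem_Icc.1 ht, rfl⟩

theorem hMax_nonneg (lam sig S sigStar SStar : ℝ) (A : ℕ → Vec d) (n : ℕ) :
    0 ≤ hMax lam sig S sigStar SStar A n := by
  refine Real.sSup_nonneg ?_
  rintro _ ⟨t, -, rfl⟩
  exact (Real.exp_pos _).le

/-- The ratio of the radii is bounded, hence so is `H_max`. -/
theorem IsLinearBandit.integrable_hMax (h : IsLinearBandit P θ sigStar arms A Y) (hI : I.Valid)
    (hσ : 0 ≤ sigStar) {n : ℕ} (hn : 1 ≤ n) :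
    Integrable (fun ω => hMax I.lam I.sig I.S sigStar ‖θ‖ (fun s => A s ω) n) P := by
  refine integrable_of_bounds (c := Real.exp ((sigStar / I.sig + ‖θ‖ / I.S) ^ 2))
    (measurable_hMax _ _ _ _ _ hn h.measurable_arm) (Filter.Eventually.of_forall fun ω => ?_)
  refine ⟨hMax_nonneg _ _ _ _ _ _ _, ?_⟩
  refine csSup_le ⟨_, 1, ⟨le_rfl, hn⟩, rfl⟩ ?_
  rintro _ ⟨t, -, rfl⟩
  exact Real.exp_le_exp.2 (radius_div_radius_le hI hσ (norm_nonneg _) _ _)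

/-- The expected regret of one round. The free parameters `a` and `c` come from the inequality of
arithmetic and geometric means; they are deterministic because `H_max` may depend on the prediction
errors. -/
theorem IsRun.integral_gap_le {Copt Csupp : ℝ} {j : ℕ}
    (hrun : IsRun P I oracle arms A Y ahat qopt bsel) (hO : IsApproxDesign Copt Csupp j oracle)
    (hC : 0 ≤ Copt) (hI : I.Valid) (h : IsLinearBandit P θ sigStar arms A Y)
    (henv : IsBoundedEnv θ arms B) (hσ : 0 ≤ sigStar)
    (hver : I.ver = Version.eliminate → sigStar ≤ I.sig ∧ ‖θ‖ ≤ I.S)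
    {n t : ℕ} (htn : t ∈ Finset.Icc 1 n) {β N : ℝ} (hN : 1 ≤ N)
    (hβ : ∀ᵐ ω ∂P, radius I.lam I.sig I.S (fun s => A s ω) (t - 1) ≤ β)
    {a c m M R : ℝ} (ha : 0 < a) (hc : 0 < c)
    (hm : m = √(Real.exp 1 * (Copt * d * Real.log d) / I.αopt) + 1)
    (hM : M = √β * √(Real.log N) * (√2 * (1 + 1 / I.αemp)))
    (hR : R = 2 * √β / (I.αemp * √N)) :
    ∫ ω, gap θ (arms t) (A t ω) ∂P
      ≤ B * (3 * ∫ ω, Real.log (1 + width I.lam A t (A t ω) ω) ∂P + 1 / (t : ℝ))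
        + a * ∫ ω, hMax I.lam I.sig I.S sigStar ‖θ‖ (fun s => A s ω) n ∂P
        + 2 * m ^ 2 / a * ∫ ω, predErr I.lam θ A Y t (A t ω) ω ^ 2
            / (1 + width I.lam A t (A t ω) ω) ∂P
        + M * c + 2 * M / c * ∫ ω, Real.log (1 + width I.lam A t (A t ω) ω) ∂P + R := by
  have ht := (Finset.mem_Icc.1 htn).1
  have hl := hI.lam_pos
  have hn : 1 ≤ n := ht.trans (Finset.mem_Icc.1 htn).2
  have hαe := hI.αemp_pos
  have hM0 : 0 ≤ M := by rw [hM]; positivity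
  have hR0 : 0 ≤ R := by rw [hR]; positivity
  have hm0 : 0 ≤ m := by rw [hm]; positivity
  have hB := henv.bound_nonneg
  set E := exploredEvent I.lam arms A t with hEdef
  set F := confidenceEvent I.lam sigStar θ A Y t with hFdef
  set G := E ∩ F with hGdef
  set H : Ω → ℝ := fun ω => hMax I.lam I.sig I.S sigStar ‖θ‖ (fun s => A s ω) n with hHdef
  set p := armProb I arms A Y ahat qopt bsel t with hp
  have hHi : Integrable H P := h.integrable_hMax hI hσ hn
  have hH0 : ∀ ω, 0 ≤ H ω := fun ω => hMax_nonneg _ _ _ _ _ _ _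
  have hle := hist_le h.measurable_arm h.measurable_reward (t - 1)
  have hAs : ∀ s ∈ Finset.Icc 1 (t - 1), Measurable[hist A Y (t - 1)] (A s) := fun s hs =>
    measurable_hist_arm hs
  have hYs : ∀ s ∈ Finset.Icc 1 (t - 1), Measurable[hist A Y (t - 1)] (Y s) := fun s hs =>
    measurable_hist_reward hs
  have hEm : MeasurableSet[hist A Y (t - 1)] E :=
    @measurableSet_exploredEvent _ I.lam arms _ (hist A Y (t - 1)) _ _ hAs
  have hFm : MeasurableSet[hist A Y (t - 1)] F :=
    @measurableSet_confidenceEvent _ I.lam sigStar θ _ (hist A Y (t - 1)) _ _ _ hAs hYs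
  have hGm : MeasurableSet[hist A Y (t - 1)] G := hEm.inter hFm
  have hw0 := fun b ω => width_nonneg hl A t b ω
  have hbest := hrun.ahat_best t ht
  -- the three functions of the arm that are averaged
  set g1 : Vec d → Ω → ℝ := fun b => G.indicator fun _ => gap θ (arms t) b with hg1
  set g2 : Vec d → Ω → ℝ := fun b => G.indicator fun ω => predErr I.lam θ A Y t b ω ^ 2 with hg2
  set g3 : Vec d → Ω → ℝ := fun b => G.indicator fun ω => width I.lam A t b ω with hg3
  have hg1m : ∀ b ∈ arms t, Measurable[hist A Y (t - 1)] (g1 b) := fun b _ =>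
    measurable_const.indicator hGm
  have hg2m : ∀ b ∈ arms t, Measurable[hist A Y (t - 1)] (g2 b) := fun b _ =>
    ((@measurable_predErr _ _ (hist A Y (t - 1)) _ _ I.lam θ _ hAs hYs _
      measurable_const).pow_const 2).indicator hGm
  have hg3m : ∀ b ∈ arms t, Measurable[hist A Y (t - 1)] (g3 b) := fun b _ =>
    (@measurable_width _ _ (hist A Y (t - 1)) _ I.lam _ hAs _ measurable_const).indicator hGm
  have hg1i : ∀ b ∈ arms t, Integrable (g1 b) P := fun b _ =>
    (integrable_const _).indicator (hle _ hGm)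
  have hg2i : ∀ b ∈ arms t, Integrable (g2 b) P := fun b hb =>
    (h.memLp_predErr hl t measurable_const
      (Filter.Eventually.of_forall fun _ => henv.norm_le_one t ht b hb)).integrable_sq.indicator
      (hle _ hGm)
  have hg3i : ∀ b ∈ arms t, Integrable (g3 b) P := fun b hb =>
    (integrable_of_bounds (c := 1 / I.lam) (measurable_width I.lam (fun s _ => h.measurable_arm s)
      measurable_const) (Filter.Eventually.of_forall fun ω => ⟨hw0 b ω,
        width_le hl A t (henv.norm_le_one t ht b hb) ω⟩)).indicator (hle _ hGm)
  obtain ⟨i1, j1, e1⟩ := hrun.integral_comp_arm h ht hg1m hg1i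
  obtain ⟨i2, j2, e2⟩ := hrun.integral_comp_arm h ht hg2m hg2i
  obtain ⟨i3, j3, e3⟩ := hrun.integral_comp_arm h ht hg3m hg3i
  -- the pointwise bound on the good event
  have hpoint : ∀ᵐ ω ∂P, ∑ b ∈ arms t, p b ω * g1 b ω
      ≤ a * H ω + m ^ 2 / a * ∑ b ∈ arms t, p b ω * g2 b ω
        + (M * c + M / c * ∑ b ∈ arms t, p b ω * g3 b ω + R) := by
    filter_upwards [hβ] with ω hβω
    have hah := hrun.ahat_mem t ht ω
    have hdes := hrun.qopt_design t ht ω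
    by_cases hω : ω ∈ G
    · simp only [hg1, hg2, hg3, Set.indicator_of_mem hω]
      have hreg : ∀ b ∈ arms t, sqNorm (gram I.lam (fun s => A s ω) (t - 1))⁻¹ b ≤ 1 := hω.1
      have hq : ∀ b ∈ arms t, 0 ≤ qopt t ω b := fun b hb => IsAugmentedDesign.nonneg hO hdes hb
      have hpb : ∀ b, p b ω = baseProb I (fun s => A s ω) (fun s => Y s ω) t (arms t) (qopt t ω)
          (ahat t ω) b := fun b => sampleProb_eq_baseProb hreg
      have hp0 : ∀ b ∈ arms t, 0 ≤ p b ω := fun b hb => armProb_nonneg hO hI hdes hah hb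
      have hp1 : ∑ b ∈ arms t, p b ω = 1 := by
        simp only [hpb]; exact sum_baseProb hI hq hah
      have hverr : I.ver = Version.eliminate →
          radius I.lam sigStar ‖θ‖ (fun s => A s ω) (t - 1)
            ≤ radius I.lam I.sig I.S (fun s => A s ω) (t - 1) := by
        intro hv
        obtain ⟨h1, h2⟩ := hver hv
        unfold radius
        gcongr
      have hround := sum_baseProb_mul_gap_le hO hC hI hah hdes (hbest ω) hreg hω.2 hverr
        (exp_radius_div_le_hMax I.lam I.sig I.S sigStar ‖θ‖ (fun s => A s ω) htn) hβω hN
      rw [← hm, ← hM, ← hR] at hround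
      simp only [← hpb] at hround
      set X := ∑ b ∈ arms t, p b ω * predErr I.lam θ A Y t b ω ^ 2 with hX
      have hX0 : 0 ≤ X := Finset.sum_nonneg fun b hb => mul_nonneg (hp0 b hb) (sq_nonneg _)
      have hamgm : m * √(H ω * X) ≤ a * H ω + m ^ 2 / a * X := by
        rw [Real.sqrt_mul (hH0 ω)]
        have hu := Real.sq_sqrt (hH0 ω)
        have hv := Real.sq_sqrt hX0
        set u := √(H ω)
        set v := √X
        rw [← hu, ← hv]
        have e : a * u ^ 2 + m ^ 2 / a * v ^ 2 = ((a * u) ^ 2 + (m * v) ^ 2) / a := by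
          field_simp
        rw [e, le_div_iff₀ ha]
        nlinarith [sq_nonneg (a * u - m * v), sq_nonneg (a * u), sq_nonneg (m * v)]
      have hwid : ∑ b ∈ arms t, p b ω * √(width I.lam A t b ω)
          ≤ c + 1 / c * ∑ b ∈ arms t, p b ω * width I.lam A t b ω := by
        have h1 : ∀ b ∈ arms t, p b ω * √(width I.lam A t b ω)
            ≤ p b ω * c + 1 / c * (p b ω * width I.lam A t b ω) := by
          intro b hb
          have hs := Real.sq_sqrt (hw0 b ω)
          have hs0 := Real.sqrt_nonneg (width I.lam A t b ω)
          set v := √(width I.lam A t b ω)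
          rw [← hs]
          have h2 : v ≤ c + 1 / c * v ^ 2 := by
            have e : c + 1 / c * v ^ 2 = (c ^ 2 + v ^ 2) / c := by field_simp
            rw [e, le_div_iff₀ hc]
            nlinarith [sq_nonneg (c - v)]
          calc p b ω * v ≤ p b ω * (c + 1 / c * v ^ 2) :=
                mul_le_mul_of_nonneg_left h2 (hp0 b hb)
            _ = _ := by ring
        refine (Finset.sum_le_sum h1).trans (le_of_eq ?_)
        rw [Finset.sum_add_distrib, ← Finset.sum_mul, hp1, one_mul, ← Finset.mul_sum]
      have hwid' := mul_le_mul_of_nonneg_left hwid hM0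
      have e5 : M * (c + 1 / c * ∑ b ∈ arms t, p b ω * width I.lam A t b ω)
          = M * c + M / c * ∑ b ∈ arms t, p b ω * width I.lam A t b ω := by ring
      rw [e5] at hwid'
      change ∑ b ∈ arms t, p b ω * gap θ (arms t) b ≤ m * √(H ω * X)
        + (M * ∑ b ∈ arms t, p b ω * √(width I.lam A t b ω) + R) at hround
      linarith
    · simp only [hg1, hg2, hg3, Set.indicator_of_notMem hω, mul_zero, Finset.sum_const_zero,
        add_zero]
      have := hH0 ω
      positivity
  have k2 : Integrable (fun ω => ∑ b ∈ arms t, p b ω * g2 b ω) P := integrable_finsetSum _ j2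
  have k3 : Integrable (fun ω => ∑ b ∈ arms t, p b ω * g3 b ω) P := integrable_finsetSum _ j3
  have l1 : Integrable (fun ω => a * H ω + m ^ 2 / a * ∑ b ∈ arms t, p b ω * g2 b ω) P :=
    (hHi.const_mul a).add (k2.const_mul _)
  have l2 : Integrable (fun ω => M * c + M / c * ∑ b ∈ arms t, p b ω * g3 b ω) P :=
    (integrable_const _).add (k3.const_mul _)
  have l3 : Integrable (fun ω => M * c + M / c * ∑ b ∈ arms t, p b ω * g3 b ω + R) P :=
    l2.add (integrable_const _)
  have hint : ∫ ω, g1 (A t ω) ω ∂P ≤ a * ∫ ω, H ω ∂P + m ^ 2 / a * ∫ ω, g2 (A t ω) ω ∂P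
      + (M * c + M / c * ∫ ω, g3 (A t ω) ω ∂P + R) := by
    rw [e1, e2, e3]
    refine (integral_mono_ae (integrable_finsetSum _ j1) (l1.add l3) hpoint).trans (le_of_eq ?_)
    have e6 : ∫ ω, ((fun ω => a * H ω + m ^ 2 / a * ∑ b ∈ arms t, p b ω * g2 b ω)
        + fun ω => M * c + M / c * ∑ b ∈ arms t, p b ω * g3 b ω + R) ω ∂P
        = ∫ ω, (a * H ω + m ^ 2 / a * ∑ b ∈ arms t, p b ω * g2 b ω) ∂P
          + ∫ ω, (M * c + M / c * ∑ b ∈ arms t, p b ω * g3 b ω + R) ∂P := integral_add l1 l3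
    rw [e6, integral_add (hHi.const_mul a) (k2.const_mul _), integral_add l2 (integrable_const _),
      integral_add (integrable_const _) (k3.const_mul _)]
    simp only [integral_const_mul, integral_const, probReal_univ, one_smul]
    rfl
  have hn2 : ∫ ω, g2 (A t ω) ω ∂P ≤ 2 * ∫ ω, predErr I.lam θ A Y t (A t ω) ω ^ 2
      / (1 + width I.lam A t (A t ω) ω) ∂P := by
    rw [← integral_const_mul]
    refine integral_mono_ae i2 ((h.integrable_predErr_sq_div henv hl ht).const_mul 2) ?_
    filter_upwards [h.mem_arms t ht] with ω hA
    have hw := hw0 (A t ω) ω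
    by_cases hω : ω ∈ G
    · simp only [hg2, Set.indicator_of_mem hω]
      have hw1 : width I.lam A t (A t ω) ω ≤ 1 := hω.1 _ hA
      rw [← mul_div_assoc, le_div_iff₀ (by linarith)]
      nlinarith [sq_nonneg (predErr I.lam θ A Y t (A t ω) ω)]
    · simp only [hg2, Set.indicator_of_notMem hω]
      positivity
  have hn3 : ∫ ω, g3 (A t ω) ω ∂P
      ≤ 2 * ∫ ω, Real.log (1 + width I.lam A t (A t ω) ω) ∂P := by
    rw [← integral_const_mul]
    refine integral_mono_ae i3 ((h.integrable_log_width henv hl ht).const_mul 2) ?_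
    filter_upwards [h.mem_arms t ht] with ω hA
    have hw := hw0 (A t ω) ω
    have hlog := div_one_add_le_log hw
    by_cases hω : ω ∈ G
    · simp only [hg3, Set.indicator_of_mem hω]
      have hw1 : width I.lam A t (A t ω) ω ≤ 1 := hω.1 _ hA
      have : width I.lam A t (A t ω) ω / 2
          ≤ width I.lam A t (A t ω) ω / (1 + width I.lam A t (A t ω) ω) := by
        gcongr; linarith
      linarith
    · simp only [hg3, Set.indicator_of_notMem hω]
      have : 0 ≤ Real.log (1 + width I.lam A t (A t ω) ω) := Real.log_nonneg (by linarith)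
      positivity
  -- rounds outside the good event cost at most `B`
  have hsplit : ∫ ω, gap θ (arms t) (A t ω) ∂P
      ≤ ∫ ω, g1 (A t ω) ω ∂P + (B * P.real Eᶜ + B * P.real Fᶜ) := by
    have q1 : Integrable (Eᶜ.indicator fun _ => B) P :=
      (integrable_const B).indicator (hle _ hEm.compl)
    have q2 : Integrable (Fᶜ.indicator fun _ => B) P :=
      (integrable_const B).indicator (hle _ hFm.compl)
    have e7 : B * P.real Eᶜ + B * P.real Fᶜ
        = ∫ ω, (Eᶜ.indicator (fun _ => B) ω + Fᶜ.indicator (fun _ => B) ω) ∂P := by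
      rw [integral_add q1 q2, integral_indicator_const _ (hle _ hEm.compl),
        integral_indicator_const _ (hle _ hFm.compl)]
      simp only [smul_eq_mul, mul_comm]
    have q3 : Integrable (fun ω => Eᶜ.indicator (fun _ => B) ω + Fᶜ.indicator (fun _ => B) ω) P :=
      q1.add q2
    rw [e7, ← integral_add i1 q3]
    refine integral_mono_ae (h.integrable_gap henv ht) (i1.add q3) ?_
    filter_upwards [h.mem_arms t ht] with ω hA
    have hgB := henv.gap_le t ht _ hA
    have hi1 : 0 ≤ Eᶜ.indicator (fun _ => B) ω := Set.indicator_nonneg (fun _ _ => hB) ω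
    have hi2 : 0 ≤ Fᶜ.indicator (fun _ => B) ω := Set.indicator_nonneg (fun _ _ => hB) ω
    by_cases hE : ω ∈ E
    · by_cases hF : ω ∈ F
      · have hω : ω ∈ G := ⟨hE, hF⟩
        simp only [hg1, Set.indicator_of_mem hω]
        linarith
      · have hω : ω ∉ G := fun hω => hF hω.2
        simp only [hg1, Set.indicator_of_notMem hω, Set.indicator_of_mem (show ω ∈ Fᶜ from hF)]
        linarith
    · have hω : ω ∉ G := fun hω => hE hω.1
      simp only [hg1, Set.indicator_of_notMem hω, Set.indicator_of_mem (show ω ∈ Eᶜ from hE)]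
      linarith
  have hPE := hrun.measureReal_unexplored_le hO hI h henv ht
  have hPF : P.real Fᶜ ≤ 1 / (t : ℝ) := by
    have h1 := h.measureReal_radius_lt_le hσ hl (t - 1)
    have h2 : failureRate (t - 1) = 1 / (t : ℝ) := by
      rw [failureRate, Nat.cast_sub ht]; simp
    rw [h2] at h1
    refine le_trans (le_of_eq ?_) h1
    congr 1
    ext ω
    simp only [hFdef, confidenceEvent, potential, Set.mem_compl_iff, Set.mem_ofPred_eq, not_le]
  have hBE := mul_le_mul_of_nonneg_left hPE hB
  have hBF := mul_le_mul_of_nonneg_left hPF hB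
  have hma := mul_le_mul_of_nonneg_left hn2 (show 0 ≤ m ^ 2 / a by positivity)
  have hMc := mul_le_mul_of_nonneg_left hn3 (show 0 ≤ M / c by positivity)
  have e8 : ∀ x : ℝ, m ^ 2 / a * (2 * x) = 2 * m ^ 2 / a * x := fun x => by ring
  have e9 : ∀ x : ℝ, M / c * (2 * x) = 2 * M / c * x := fun x => by ring
  rw [e8] at hma
  rw [e9] at hMc
  have e10 : ∀ x y : ℝ, B * (x + y) = B * x + B * y := fun x y => by ring
  rw [e10]
  linarith

end Rounds

/-! ### Summation over the rounds -/

section Total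

variable {Ω : Type*} [mΩ : MeasurableSpace Ω] {P : Measure Ω} [IsProbabilityMeasure P]
  {θ : Vec d} {sigStar B : ℝ} {arms : ℕ → Finset (Vec d)} {A : ℕ → Ω → Vec d} {Y : ℕ → Ω → ℝ}
  {I : Input} {oracle : Finset (Vec d) → Vec d → ℝ}
  {ahat : ℕ → Ω → Vec d} {qopt : ℕ → Ω → Vec d → ℝ} {bsel : ℕ → Ω → Vec d}

theorem sum_one_div_le (n : ℕ) : ∑ t ∈ Finset.Icc 1 n, 1 / (t : ℝ) ≤ 1 + Real.log n := by
  have h := harmonic_le_one_add_log n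
  rw [harmonic_eq_sum_Icc] at h
  push_cast at h
  simpa only [one_div] using h

theorem IsLinearBandit.integral_regret_eq (h : IsLinearBandit P θ sigStar arms A Y)
    (henv : IsBoundedEnv θ arms B) (n : ℕ) :
    Integrable (fun ω => regret θ arms (fun s => A s ω) n) P ∧
    ∫ ω, regret θ arms (fun s => A s ω) n ∂P
      = ∑ t ∈ Finset.Icc 1 n, ∫ ω, gap θ (arms t) (A t ω) ∂P := by
  have hi : ∀ t ∈ Finset.Icc 1 n, Integrable (fun ω => gap θ (arms t) (A t ω)) P := fun t ht =>
    h.integrable_gap henv (Finset.mem_Icc.1 ht).1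
  exact ⟨integrable_finsetSum _ hi, integral_finsetSum _ hi⟩

theorem le_two_mul_sqrt_of_forall {x p q : ℝ} (hp : 0 < p) (hq : 0 ≤ q)
    (h : ∀ a, 0 < a → x ≤ a * p + q / a) : x ≤ 2 * √(p * q) := by
  rcases hq.eq_or_lt with h0 | h0
  · subst h0
    rw [mul_zero, Real.sqrt_zero, mul_zero]
    refine le_of_forall_pos_le_add fun ε hε => ?_
    have := h (ε / p) (by positivity)
    rw [div_mul_cancel₀ _ hp.ne', zero_div] at this
    linarith
  · have h1 := h (√q / √p) (by positivity)
    have hsp := Real.sqrt_pos.2 hp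
    have hsq := Real.sqrt_pos.2 h0
    have e1 : √q / √p * p = √p * √q := by
      nth_rewrite 2 [← Real.mul_self_sqrt hp.le]
      field_simp
    have e2 : q / (√q / √p) = √p * √q := by
      nth_rewrite 1 [← Real.mul_self_sqrt h0.le]
      field_simp
    rw [e1, e2, ← Real.sqrt_mul hp.le] at h1
    linarith

/-- The regret bound before the parameters of the problem are separated from the horizon: `L`
bounds `log (det V_n / det V_0)` and `β` bounds the radii. -/
theorem IsRun.integral_regret_le {Copt Csupp : ℝ} {j : ℕ}
    (hrun : IsRun P I oracle arms A Y ahat qopt bsel) (hO : IsApproxDesign Copt Csupp j oracle)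
    (hC : 0 ≤ Copt) (hI : I.Valid) (h : IsLinearBandit P θ sigStar arms A Y)
    (henv : IsBoundedEnv θ arms B) (hσ : 0 ≤ sigStar)
    (hver : I.ver = Version.eliminate → sigStar ≤ I.sig ∧ ‖θ‖ ≤ I.S)
    {n : ℕ} (hn : 1 ≤ n) {β L m M EH : ℝ} (hL0 : 0 < L)
    (hL : d * Real.log (d + n / I.lam) ≤ L)
    (hβ : 2 * I.sig ^ 2 * (L + 2 * Real.log n) + 2 * (I.lam * I.S ^ 2) ≤ β)
    (hm : m = √(Real.exp 1 * (Copt * d * Real.log d) / I.αopt) + 1)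
    (hM : M = √β * √(Real.log n) * (√2 * (1 + 1 / I.αemp)))
    (hEH : EH = ∫ ω, hMax I.lam I.sig I.S sigStar ‖θ‖ (fun s => A s ω) n ∂P) :
    ∫ ω, regret θ arms (fun s => A s ω) n ∂P
      ≤ B * (3 * L + (1 + Real.log n))
        + 2 * √(n * EH * (2 * m ^ 2 * (I.lam * ‖θ‖ ^ 2 + 2 * sigStar ^ 2 * L)))
        + 3 * (M * √(L * n)) + 2 * √n * √β / I.αemp := by
  have hl := hI.lam_pos
  have hn0 : (0 : ℝ) < n := by exact_mod_cast hn
  have hn1 : (1 : ℝ) ≤ n := by exact_mod_cast hn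
  have hB := henv.bound_nonneg
  have hαe := hI.αemp_pos
  have hM0 : 0 ≤ M := by rw [hM]; positivity
  set R := 2 * √β / (I.αemp * √n) with hR
  set c := √(L / n) with hc
  have hc0 : 0 < c := Real.sqrt_pos.2 (by positivity)
  have hβ' : ∀ t ∈ Finset.Icc 1 n,
      ∀ᵐ ω ∂P, radius I.lam I.sig I.S (fun s => A s ω) (t - 1) ≤ β := by
    intro t ht
    obtain ⟨ht1, htn⟩ := Finset.mem_Icc.1 ht
    filter_upwards [h.ae_norm_le_one henv] with ω hω
    refine le_trans ?_ hβ
    have h1 : logDet I.lam (fun s => A s ω) (t - 1) ≤ L :=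
      (logDet_mono hl _ (by omega)).trans
        ((logDet_le hl (fun s => A s ω) n fun s hs => hω s (Finset.mem_Icc.1 hs).1).trans hL)
    have h2 : Real.log (1 / failureRate (t - 1)) ≤ Real.log n := by
      rw [failureRate, one_div_one_div, Nat.cast_sub ht1]
      have ht0 : (0 : ℝ) < t := by exact_mod_cast ht1
      simp only [Nat.cast_one, sub_add_cancel]
      exact Real.log_le_log ht0 (by exact_mod_cast htn)
    have h3 := logDet_add_log_nonneg hl (fun s => A s ω) (t - 1)
    have h4 := Real.sq_sqrt h3
    have h5 := Real.sq_sqrt hl.le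
    have h6 : radius I.lam I.sig I.S (fun s => A s ω) (t - 1)
        = (I.sig * √(logDet I.lam (fun s => A s ω) (t - 1)
          + 2 * Real.log (1 / failureRate (t - 1))) + √I.lam * I.S) ^ 2 := rfl
    rw [h6]
    set x := √(logDet I.lam (fun s => A s ω) (t - 1)
      + 2 * Real.log (1 / failureRate (t - 1)))
    calc (I.sig * x + √I.lam * I.S) ^ 2
        ≤ 2 * I.sig ^ 2 * x ^ 2 + 2 * (√I.lam ^ 2 * I.S ^ 2) := by
          nlinarith [sq_nonneg (I.sig * x - √I.lam * I.S)]
      _ ≤ _ := by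
          rw [h4, h5]
          have : 0 ≤ 2 * I.sig ^ 2 := by positivity
          nlinarith
  have hEH1 : 1 ≤ EH := by
    have h1 : ∫ _ω, (1 : ℝ) ∂P ≤ EH := by
      rw [hEH]
      refine integral_mono (integrable_const _) (h.integrable_hMax hI hσ hn) fun ω => ?_
      refine le_trans (Real.one_le_exp ?_)
        (exp_radius_div_le_hMax I.lam I.sig I.S sigStar ‖θ‖ (fun s => A s ω)
          (Finset.mem_Icc.2 ⟨le_rfl, hn⟩))
      exact div_nonneg (radius_nonneg _ _ _ _ _) (radius_nonneg _ _ _ _ _)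
    simpa using h1
  have hlog := h.sum_integral_log_width_le henv hl n
  have hpred := h.sum_integral_predErr_sq_le henv hσ hl n
  set SL := ∑ t ∈ Finset.Icc 1 n, ∫ ω, Real.log (1 + width I.lam A t (A t ω) ω) ∂P with hSL
  set SP := ∑ t ∈ Finset.Icc 1 n, ∫ ω, predErr I.lam θ A Y t (A t ω) ω ^ 2
        / (1 + width I.lam A t (A t ω) ω) ∂P with hSP
  have hSLL : SL ≤ L := hlog.trans hL
  have hSPQ : SP ≤ I.lam * ‖θ‖ ^ 2 + 2 * sigStar ^ 2 * L := by
    refine hpred.trans ?_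
    gcongr
  have hQ0 : 0 ≤ 2 * m ^ 2 * (I.lam * ‖θ‖ ^ 2 + 2 * sigStar ^ 2 * L) := by positivity
  have hall : ∀ a, 0 < a → ∫ ω, regret θ arms (fun s => A s ω) n ∂P
        - (B * (3 * L + (1 + Real.log n)) + 3 * (M * √(L * n)) + 2 * √n * √β / I.αemp)
      ≤ a * (n * EH) + (2 * m ^ 2 * (I.lam * ‖θ‖ ^ 2 + 2 * sigStar ^ 2 * L)) / a := by
    intro a ha
    have hsum := Finset.sum_le_sum fun t ht =>
      hrun.integral_gap_le hO hC hI h henv hσ hver (t := t) ht hn1 (hβ' t ht) ha hc0 hm hM hR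
    rw [← (h.integral_regret_eq henv n).2] at hsum
    simp only [Finset.sum_add_distrib, ← Finset.mul_sum, Finset.sum_const, Nat.card_Icc,
      Nat.add_sub_cancel, nsmul_eq_mul, ← hEH] at hsum
    rw [← hSL, ← hSP] at hsum
    have h1 := mul_le_mul_of_nonneg_left
      (add_le_add (mul_le_mul_of_nonneg_left hSLL (show (0 : ℝ) ≤ 3 by norm_num))
        (sum_one_div_le n)) hB
    have h2 := mul_le_mul_of_nonneg_left hSPQ (show 0 ≤ 2 * m ^ 2 / a by positivity)
    have h3 := mul_le_mul_of_nonneg_left hSLL (show 0 ≤ 2 * M / c by positivity)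
    have e1 : 2 * m ^ 2 / a * (I.lam * ‖θ‖ ^ 2 + 2 * sigStar ^ 2 * L)
        = (2 * m ^ 2 * (I.lam * ‖θ‖ ^ 2 + 2 * sigStar ^ 2 * L)) / a := by ring
    have hsL := Real.sqrt_pos.2 hL0
    have hsn := Real.sqrt_pos.2 hn0
    have e2 : M * ((n : ℝ) * c) = M * √(L * n) := by
      rw [hc, Real.sqrt_div hL0.le, Real.sqrt_mul hL0.le]
      nth_rewrite 1 [← Real.mul_self_sqrt hn0.le]
      field_simp
    have e3 : 2 * M / c * L = 2 * (M * √(L * n)) := by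
      rw [hc, Real.sqrt_div hL0.le, Real.sqrt_mul hL0.le]
      nth_rewrite 2 [← Real.mul_self_sqrt hL0.le]
      field_simp
    have e4 : (n : ℝ) * R = 2 * √n * √β / I.αemp := by
      rw [hR]
      nth_rewrite 1 [← Real.mul_self_sqrt hn0.le]
      field_simp
    rw [e1] at h2
    rw [e3] at h3
    rw [e2, e4] at hsum
    linarith
  have := le_two_mul_sqrt_of_forall (by positivity) hQ0 hall
  linarith

end Total

/-! ### Separating the parameters from the horizon -/

section Numeric

/-- The inequality of arithmetic and geometric means that splits `√(E δ b')` into the two main terms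
of the minimax bound, using that `b` dominates `δ σ² ℓ`. -/
theorem two_mul_sqrt_le {δ ℓ σ E b b' : ℝ} (hδ : 0 ≤ δ) (hℓ : 0 < ℓ) (hσ : 0 < σ) (hE : 0 ≤ E)
    (hb : δ * σ ^ 2 * ℓ ≤ b) (hb' : 0 ≤ b') :
    2 * √(E * δ * b') ≤ √ℓ * (b / σ) + E / (σ * (ℓ * √ℓ)) * b' := by
  have hs := Real.sqrt_pos.2 hℓ
  have hx : δ * σ * ℓ * √ℓ ≤ √ℓ * (b / σ) := by
    rw [← mul_div_assoc, le_div_iff₀ hσ]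
    calc δ * σ * ℓ * √ℓ * σ = √ℓ * (δ * σ ^ 2 * ℓ) := by ring
      _ ≤ _ := by gcongr
  have hxy : E * δ * b' = (δ * σ * ℓ * √ℓ) * (E / (σ * (ℓ * √ℓ)) * b') := by field_simp
  set x := δ * σ * ℓ * √ℓ with hxd
  have hx0 : 0 ≤ x := by positivity
  set y := E / (σ * (ℓ * √ℓ)) * b' with hyd
  have hy0 : 0 ≤ y := by positivity
  have h1 : √(E * δ * b') ≤ (x + y) / 2 := by
    rw [hxy]
    refine Real.sqrt_le_iff.2 ⟨by positivity, ?_⟩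
    nlinarith [sq_nonneg (x - y)]
  linarith

theorem sqrt_mul_le_sqrt_mul_div {δ ℓ σ b : ℝ} (hδ : 0 ≤ δ) (hℓ : 0 < ℓ) (hσ : 0 < σ)
    (hb : δ * σ ^ 2 * ℓ ≤ b) : √(b * δ * ℓ ^ 2) ≤ √ℓ * (b / σ) := by
  have hb0 : 0 ≤ b := le_trans (by positivity) hb
  refine Real.sqrt_le_iff.2 ⟨by positivity, ?_⟩
  rw [mul_pow, Real.sq_sqrt hℓ.le, div_pow, ← mul_div_assoc, le_div_iff₀ (by positivity)]
  calc b * δ * ℓ ^ 2 * σ ^ 2 = ℓ * b * (δ * σ ^ 2 * ℓ) := by ring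
    _ ≤ ℓ * b * b := by gcongr
    _ = _ := by ring

theorem sqrt_le_two_mul_sqrt_mul_div {δ ℓ σ b : ℝ} (hδ : 1 ≤ δ) (hℓ : 1 / 2 ≤ ℓ) (hσ : 0 < σ)
    (hb : δ * σ ^ 2 * ℓ ≤ b) : √b ≤ 2 * (√ℓ * (b / σ)) := by
  have hb0 : 0 ≤ b := le_trans (by positivity) hb
  have hℓ0 : 0 < ℓ := by linarith
  refine Real.sqrt_le_iff.2 ⟨by positivity, ?_⟩
  rw [mul_pow, mul_pow, Real.sq_sqrt hℓ0.le, div_pow, ← mul_div_assoc, ← mul_div_assoc,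
    le_div_iff₀ (by positivity)]
  have h1 : σ ^ 2 ≤ 4 * ℓ * b := by
    have h2 : 1 ≤ 4 * ℓ * (δ * ℓ) := by
      have : ℓ ≤ δ * ℓ := le_mul_of_one_le_left hℓ0.le hδ
      nlinarith
    calc σ ^ 2 = 1 * σ ^ 2 := (one_mul _).symm
      _ ≤ 4 * ℓ * (δ * ℓ) * σ ^ 2 := by gcongr
      _ = 4 * ℓ * (δ * σ ^ 2 * ℓ) := by ring
      _ ≤ _ := by gcongr
  nlinarith

end Numeric

/-! ### The minimax bound -/

theorem one_le_paramLog (d : ℕ) {I : Input} (hI : I.Valid) {sigStar SStar : ℝ}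
    (hσ : 0 ≤ sigStar) (hS : 0 ≤ SStar) : 1 ≤ paramLog d I sigStar SStar := by
  have h1 := hI.lam_pos
  have h2 := hI.sig_pos
  have h3 := hI.S_pos
  have h4 : (0 : ℝ) ≤ d + 1 / I.lam + I.S / I.sig + sigStar / I.sig + SStar / I.sig := by positivity
  rw [paramLog, Real.le_log_iff_exp_le (by positivity)]
  linarith

theorem log_add_le_paramLog (d : ℕ) {I : Input} (hI : I.Valid) {sigStar SStar : ℝ}
    (hσ : 0 ≤ sigStar) (hS : 0 ≤ SStar) :
    Real.log (d + 1 / I.lam) ≤ paramLog d I sigStar SStar := by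
  have h1 := hI.lam_pos
  have h2 := hI.sig_pos
  have h3 := hI.S_pos
  have h4 : (0 : ℝ) ≤ Real.exp 1 + I.S / I.sig + sigStar / I.sig + SStar / I.sig := by positivity
  refine Real.log_le_log (by positivity) ?_
  linarith

theorem log_le_paramLog {d : ℕ} (hd : 1 ≤ d) {I : Input} (hI : I.Valid) {sigStar SStar : ℝ}
    (hσ : 0 ≤ sigStar) (hS : 0 ≤ SStar) : Real.log d ≤ paramLog d I sigStar SStar := by
  refine le_trans (Real.log_le_log (by exact_mod_cast hd) ?_) (log_add_le_paramLog d hI hσ hS)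
  have := hI.lam_pos
  have : 0 < 1 / I.lam := by positivity
  linarith

section Final

variable {Ω : Type*} [mΩ : MeasurableSpace Ω] {P : Measure Ω} [IsProbabilityMeasure P]
  {θ : Vec d} {sigStar B : ℝ} {arms : ℕ → Finset (Vec d)} {A : ℕ → Ω → Vec d} {Y : ℕ → Ω → ℝ}
  {I : Input} {oracle : Finset (Vec d) → Vec d → ℝ}
  {ahat : ℕ → Ω → Vec d} {qopt : ℕ → Ω → Vec d → ℝ} {bsel : ℕ → Ω → Vec d}

/-- The constant of the minimax bound. Its summands come from the prediction errors, the widths of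
the played arms, the truncation of the weights, and the exceptional rounds. -/
noncomputable def minimaxConst (αopt αemp Copt : ℝ) : ℝ :=
  √(24 * (Real.exp 1 * Copt / αopt + 1)) + 3 * (√2 * (1 + 1 / αemp)) * √30
    + 4 * √10 / αemp + 12

set_option maxHeartbeats 1600000 in
/-- The minimax bound for horizons `n ≥ 2` in positive dimension. -/
theorem IsRun.integral_regret_le_minimax {Copt Csupp : ℝ} {j : ℕ}
    (hrun : IsRun P I oracle arms A Y ahat qopt bsel) (hO : IsApproxDesign Copt Csupp j oracle)
    (hC : 0 ≤ Copt) (hI : I.Valid) (h : IsLinearBandit P θ sigStar arms A Y)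
    (henv : IsBoundedEnv θ arms B) (hσ : 0 ≤ sigStar)
    (hver : I.ver = Version.eliminate → sigStar ≤ I.sig ∧ ‖θ‖ ≤ I.S)
    (hd : 1 ≤ d) {n : ℕ} (hn : 2 ≤ n) {EH : ℝ}
    (hEH : EH = ∫ ω, hMax I.lam I.sig I.S sigStar ‖θ‖ (fun s => A s ω) n ∂P) :
    ∫ ω, regret θ arms (fun s => A s ω) n ∂P
      ≤ minimaxConst I.αopt I.αemp Copt * paramLog d I sigStar ‖θ‖ *
        (√n * (√(Real.log n) * ((d * I.sig ^ 2 * Real.log n + I.lam * I.S ^ 2) / I.sig)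
            + EH / (I.sig * (Real.log n * √(Real.log n)))
              * (d * sigStar ^ 2 * Real.log n + I.lam * ‖θ‖ ^ 2))
          + d * B * Real.log (n + 1)) := by
  have hl := hI.lam_pos
  have hs := hI.sig_pos
  have hS := hI.S_pos
  have hαo := hI.αopt_pos
  have hαe := hI.αemp_pos
  have hB := henv.bound_nonneg
  have hn2 : (2 : ℝ) ≤ n := by exact_mod_cast hn
  have hd1 : (1 : ℝ) ≤ d := by exact_mod_cast hd
  have hEH0 : 0 ≤ EH := by
    rw [hEH]; exact integral_nonneg fun ω => hMax_nonneg _ _ _ _ _ _ _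
  have hΛ1 := one_le_paramLog d hI hσ (norm_nonneg θ)
  have hΛlam := log_add_le_paramLog d hI hσ (norm_nonneg θ)
  have hΛd := log_le_paramLog hd hI hσ (norm_nonneg θ)
  set Λ := paramLog d I sigStar ‖θ‖
  set ℓ := Real.log n with hℓ
  set δ : ℝ := (d : ℝ) with hδ
  have hℓ2 : Real.log 2 ≤ ℓ := Real.log_le_log two_pos hn2
  have hlog2 := Real.log_two_gt_d9
  have hℓ0 : 0 < ℓ := by linarith
  have hℓn : ℓ ≤ Real.log (n + 1) := Real.log_le_log (by linarith) (by linarith)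
  have hδΛ : 1 ≤ δ * Λ := one_le_mul_of_one_le_of_one_le hd1 hΛ1
  have hδ0 : 0 < δ := by linarith
  have hΛ0 : 0 < Λ := by linarith
  set b := δ * I.sig ^ 2 * ℓ + I.lam * I.S ^ 2 with hb
  set b' := δ * sigStar ^ 2 * ℓ + I.lam * ‖θ‖ ^ 2 with hb'
  have hbb : δ * I.sig ^ 2 * ℓ ≤ b := by
    have : 0 ≤ I.lam * I.S ^ 2 := by positivity
    linarith
  have hb0 : 0 < b := by positivity
  have hb'0 : 0 ≤ b' := by positivity
  set L := 3 * (δ * Λ * ℓ) with hL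
  have hL0 : 0 < L := by positivity
  have hΛℓ : Λ ≤ 2 * (Λ * ℓ) := by nlinarith
  have hLle : δ * Real.log (δ + n / I.lam) ≤ L := by
    have h1 : Real.log (δ + n / I.lam) ≤ Λ + ℓ := by
      calc Real.log (δ + n / I.lam) ≤ Real.log ((δ + 1 / I.lam) * n) := by
            refine Real.log_le_log (by positivity) ?_
            have e : (δ + 1 / I.lam) * n = δ * n + n / I.lam := by ring
            rw [e]
            nlinarith
        _ = Real.log (δ + 1 / I.lam) + ℓ := Real.log_mul (by positivity) (by positivity)
        _ ≤ _ := by linarith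
    have h2 : Λ + ℓ ≤ 3 * (Λ * ℓ) := by nlinarith
    calc δ * Real.log (δ + n / I.lam) ≤ δ * (3 * (Λ * ℓ)) := by gcongr; linarith
      _ = L := by rw [hL]; ring
  have hβ : 2 * I.sig ^ 2 * (L + 2 * Real.log n) + 2 * (I.lam * I.S ^ 2) ≤ 10 * Λ * b := by
    have h1 : ℓ ≤ δ * Λ * ℓ := le_mul_of_one_le_left hℓ0.le hδΛ
    have h2 : 2 * I.sig ^ 2 * (L + 2 * ℓ) ≤ 2 * I.sig ^ 2 * (5 * (δ * Λ * ℓ)) := by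
      gcongr; linarith
    have h3 : I.lam * I.S ^ 2 ≤ Λ * (I.lam * I.S ^ 2) :=
      le_mul_of_one_le_left (by positivity) hΛ1
    have h4 : 0 ≤ Λ * (I.lam * I.S ^ 2) := by positivity
    have h5 : 10 * Λ * b = 2 * I.sig ^ 2 * (5 * (δ * Λ * ℓ)) + 10 * (Λ * (I.lam * I.S ^ 2)) := by
      rw [hb]; ring
    rw [h5, ← hℓ]
    linarith
  have hmain := hrun.integral_regret_le hO hC hI h henv hσ hver (by omega : 1 ≤ n) hL0 hLle hβ
    rfl rfl hEH
  rw [← hℓ] at hmain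
  set T1 := √ℓ * (b / I.sig) with hT1
  set T2 := EH / (I.sig * (ℓ * √ℓ)) * b' with hT2
  have hT10 : 0 ≤ T1 := by positivity
  have hT20 : 0 ≤ T2 := by positivity
  set κ := Real.exp 1 * Copt / I.αopt + 1 with hκ
  have hκ0 : 0 < κ := by positivity
  set m := √(Real.exp 1 * (Copt * δ * Real.log δ) / I.αopt) + 1 with hm
  have hm2 : m ^ 2 ≤ 2 * κ * (δ * Λ) := by
    have hK0 : 0 ≤ Real.exp 1 * (Copt * δ * Real.log δ) / I.αopt := by
      have := Real.log_nonneg hd1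
      positivity
    have h1 := Real.sq_sqrt hK0
    have h2 : Real.exp 1 * (Copt * δ * Real.log δ) / I.αopt
        ≤ Real.exp 1 * Copt / I.αopt * (δ * Λ) := by
      have e : Real.exp 1 * (Copt * δ * Real.log δ) / I.αopt
        = Real.exp 1 * Copt / I.αopt * (δ * Real.log δ) := by ring
      rw [e]
      gcongr
    set x := √(Real.exp 1 * (Copt * δ * Real.log δ) / I.αopt)
    have h3 : m ^ 2 ≤ 2 * x ^ 2 + 2 := by
      have e3 : 2 * x ^ 2 + 2 = m ^ 2 + (x - 1) ^ 2 := by rw [hm]; ring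
      rw [e3]
      exact le_add_of_nonneg_right (sq_nonneg _)
    have e2 : 2 * κ * (δ * Λ) = 2 * (Real.exp 1 * Copt / I.αopt * (δ * Λ)) + 2 * (δ * Λ) := by
      rw [hκ]; ring
    linarith
  -- the contribution of the prediction errors
  have hterm1 : 2 * √(n * EH * (2 * m ^ 2 * (I.lam * ‖θ‖ ^ 2 + 2 * sigStar ^ 2 * L)))
      ≤ √(24 * κ) * Λ * (√n * (T1 + T2)) := by
    have h1 : I.lam * ‖θ‖ ^ 2 + 2 * sigStar ^ 2 * L ≤ 6 * Λ * b' := by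
      have h2 : I.lam * ‖θ‖ ^ 2 ≤ Λ * (I.lam * ‖θ‖ ^ 2) :=
        le_mul_of_one_le_left (by positivity) hΛ1
      have h3 : 0 ≤ Λ * (I.lam * ‖θ‖ ^ 2) := by positivity
      have h4 : 6 * Λ * b' = 6 * (Λ * (I.lam * ‖θ‖ ^ 2)) + 2 * sigStar ^ 2 * L := by
        rw [hb', hL]; ring
      rw [h4]
      linarith
    have h5 : n * EH * (2 * m ^ 2 * (I.lam * ‖θ‖ ^ 2 + 2 * sigStar ^ 2 * L))
        ≤ (√(24 * κ) * Λ * √n) ^ 2 * (EH * δ * b') := by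
      calc n * EH * (2 * m ^ 2 * (I.lam * ‖θ‖ ^ 2 + 2 * sigStar ^ 2 * L))
          ≤ n * EH * (2 * (2 * κ * (δ * Λ)) * (6 * Λ * b')) := by gcongr
        _ = _ := by
          rw [mul_pow, mul_pow, Real.sq_sqrt (by positivity), Real.sq_sqrt (by positivity)]
          ring
    have h6 := Real.sqrt_le_sqrt h5
    rw [Real.sqrt_mul (sq_nonneg (√(24 * κ) * Λ * √n)), Real.sqrt_sq (by positivity)] at h6
    have h7 := two_mul_sqrt_le hδ0.le hℓ0 hs hEH0 hbb hb'0
    calc _ ≤ 2 * (√(24 * κ) * Λ * √n * √(EH * δ * b')) := by gcongr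
      _ = √(24 * κ) * Λ * √n * (2 * √(EH * δ * b')) := by ring
      _ ≤ √(24 * κ) * Λ * √n * (T1 + T2) := by gcongr
      _ = _ := by ring
  -- the contribution of the widths of the played arms
  have hterm2 : 3 * (√(10 * Λ * b) * √ℓ * (√2 * (1 + 1 / I.αemp)) * √(L * n))
      ≤ 3 * (√2 * (1 + 1 / I.αemp)) * √30 * Λ * (√n * T1) := by
    have h1 : √(10 * Λ * b) * √ℓ * √(L * n) = √30 * Λ * √n * √(b * δ * ℓ ^ 2) := by
      rw [← Real.sqrt_mul (by positivity), ← Real.sqrt_mul (by positivity)]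
      have e : 10 * Λ * b * ℓ * (L * n) = (√30 * Λ * √n) ^ 2 * (b * δ * ℓ ^ 2) := by
        rw [mul_pow, mul_pow, Real.sq_sqrt (by positivity), Real.sq_sqrt (by positivity), hL]
        ring
      rw [e, Real.sqrt_mul (by positivity), Real.sqrt_sq (by positivity)]
    have h2 := sqrt_mul_le_sqrt_mul_div hδ0.le hℓ0 hs hbb
    calc _ = 3 * (√2 * (1 + 1 / I.αemp)) * (√(10 * Λ * b) * √ℓ * √(L * n)) := by ring
      _ = 3 * (√2 * (1 + 1 / I.αemp)) * (√30 * Λ * √n * √(b * δ * ℓ ^ 2)) := by rw [h1]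
      _ ≤ 3 * (√2 * (1 + 1 / I.αemp)) * (√30 * Λ * √n * T1) := by gcongr
      _ = _ := by ring
  -- the truncated weights
  have hterm3 : 2 * √n * √(10 * Λ * b) / I.αemp ≤ 4 * √10 / I.αemp * Λ * (√n * T1) := by
    have h1 : √(10 * Λ * b) ≤ √10 * Λ * √b := by
      rw [Real.sqrt_mul (by positivity), Real.sqrt_mul (by positivity)]
      gcongr
      exact Real.sqrt_le_iff.2 ⟨hΛ0.le, le_self_pow₀ hΛ1 two_ne_zero⟩
    have h2 := sqrt_le_two_mul_sqrt_mul_div hd1 (by linarith : 1 / 2 ≤ ℓ) hs hbb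
    calc _ ≤ 2 * √n * (√10 * Λ * (2 * T1)) / I.αemp := by
          gcongr
          exact h1.trans (by gcongr)
      _ = _ := by ring
  -- rounds with unexplored arms or outside the confidence ellipsoid
  have hterm4 : B * (3 * L + (1 + ℓ)) ≤ 12 * Λ * (δ * B * Real.log (n + 1)) := by
    have h1 : ℓ ≤ δ * Λ * ℓ := le_mul_of_one_le_left hℓ0.le hδΛ
    have h2 : 3 * L + (1 + ℓ) ≤ 12 * (δ * Λ * ℓ) := by rw [hL]; linarith
    calc B * (3 * L + (1 + ℓ)) ≤ B * (12 * (δ * Λ * ℓ)) := by gcongr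
      _ = 12 * Λ * (δ * B * ℓ) := by ring
      _ ≤ _ := by gcongr
  have hT4 : 0 ≤ δ * B * Real.log (n + 1) := by
    have : 0 ≤ Real.log ((n : ℝ) + 1) := by linarith
    positivity
  have hc1 : 0 ≤ √(24 * κ) := Real.sqrt_nonneg _
  have hc2 : 0 ≤ 3 * (√2 * (1 + 1 / I.αemp)) * √30 := by positivity
  have hc3 : 0 ≤ 4 * √10 / I.αemp := by positivity
  rw [minimaxConst, ← hκ]
  set c1 := √(24 * κ)
  set c2 := 3 * (√2 * (1 + 1 / I.αemp)) * √30
  set c3 := 4 * √10 / I.αemp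
  set T4 := δ * B * Real.log (n + 1)
  have hU1 : 0 ≤ √n * T1 := by positivity
  have hU2 : 0 ≤ √n * T2 := by positivity
  calc _ ≤ _ := hmain
    _ ≤ 12 * Λ * T4 + c1 * Λ * (√n * (T1 + T2)) + c2 * Λ * (√n * T1) + c3 * Λ * (√n * T1) := by
      linarith
    _ = Λ * (12 * T4 + c1 * (√n * T1) + c1 * (√n * T2) + c2 * (√n * T1) + c3 * (√n * T1)) := by ring
    _ ≤ Λ * ((c1 + c2 + c3 + 12) * (√n * T1) + (c1 + c2 + c3 + 12) * (√n * T2)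
        + (c1 + c2 + c3 + 12) * T4) := by
      have := mul_nonneg hc1 hT4
      have := mul_nonneg hc2 hT4
      have := mul_nonneg hc3 hT4
      have := mul_nonneg hc2 hU2
      have := mul_nonneg hc3 hU2
      refine mul_le_mul_of_nonneg_left ?_ hΛ0.le
      linarith
    _ = _ := by ring

end Final

end LinMED

theorem theorem2 :
    ∃ k : ℕ, ∀ (αopt αemp Copt Csupp : ℝ) (j : ℕ),
      0 < αopt → 0 < αemp → αopt + αemp ≤ 1 → 0 < Copt → 0 < Csupp →
    ∃ C : ℝ, 0 < C ∧
      ∀ (d : ℕ) (I : LinMED.Input), I.Valid → I.αopt = αopt → I.αemp = αemp →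
      ∀ (oracle : Finset (LinMED.Vec d) → LinMED.Vec d → ℝ),
        LinMED.IsApproxDesign Copt Csupp j oracle →
      ∀ (θ : LinMED.Vec d) (sigStar B : ℝ) (arms : ℕ → Finset (LinMED.Vec d)),
        0 ≤ sigStar → LinMED.IsBoundedEnv θ arms B →
        (I.ver = LinMED.Version.eliminate → sigStar ≤ I.sig ∧ ‖θ‖ ≤ I.S) →
      ∀ (Ω : Type u) [MeasurableSpace Ω] (P : Measure Ω) [IsProbabilityMeasure P]
        (A : ℕ → Ω → LinMED.Vec d) (Y : ℕ → Ω → ℝ)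
        (ahat : ℕ → Ω → LinMED.Vec d) (qopt : ℕ → Ω → LinMED.Vec d → ℝ)
        (bsel : ℕ → Ω → LinMED.Vec d),
        LinMED.IsLinearBandit P θ sigStar arms A Y →
        LinMED.IsRun P I oracle arms A Y ahat qopt bsel →
      ∀ n : ℕ, 1 ≤ n →
        Integrable (fun ω => LinMED.regret θ arms (fun s => A s ω) n) P ∧
        Integrable (fun ω => LinMED.hMax I.lam I.sig I.S sigStar ‖θ‖ (fun s => A s ω) n) P ∧
        ∫ ω, LinMED.regret θ arms (fun s => A s ω) n ∂P ≤
          C * LinMED.paramLog d I sigStar ‖θ‖ ^ k *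
            (√(n : ℝ) *
              (Real.log n ^ (1 / 2 : ℝ) * (d * I.sig * Real.log n + I.lam * I.S ^ 2 / I.sig)
                + (∫ ω, LinMED.hMax I.lam I.sig I.S sigStar ‖θ‖ (fun s => A s ω) n ∂P) /
                    (I.sig * Real.log n ^ (3 / 2 : ℝ)) *
                  (d * sigStar ^ 2 * Real.log n + I.lam * ‖θ‖ ^ 2))
              + d * B * Real.log (n + 1)) := by
  refine ⟨1, fun αopt αemp Copt Csupp j hαo hαe _ hC _ =>
    ⟨LinMED.minimaxConst αopt αemp Copt, ?_, ?_⟩⟩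
  · unfold LinMED.minimaxConst
    positivity
  intro d I hI ho he oracle hO θ sigStar B arms hσ henv hver Ω _ P _ A Y ahat qopt bsel h hrun n hn
  have hreg := h.integral_regret_eq henv n
  refine ⟨hreg.1, h.integrable_hMax hI hσ hn, ?_⟩
  rw [pow_one]
  have hl := hI.lam_pos
  have hs := hI.sig_pos
  have hS := hI.S_pos
  have hB := henv.bound_nonneg
  have hΛ1 := LinMED.one_le_paramLog d hI hσ (norm_nonneg θ)
  have hH0 : 0 ≤ ∫ ω, LinMED.hMax I.lam I.sig I.S sigStar ‖θ‖ (fun s => A s ω) n ∂P :=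
    integral_nonneg fun ω => LinMED.hMax_nonneg _ _ _ _ _ _ _
  have hn1 : (1 : ℝ) ≤ n := by exact_mod_cast hn
  have hℓ0 : 0 ≤ Real.log n := Real.log_nonneg hn1
  have hC12 : 12 ≤ LinMED.minimaxConst αopt αemp Copt := by
    have : 0 ≤ √(24 * (Real.exp 1 * Copt / αopt + 1)) + 3 * (√2 * (1 + 1 / αemp)) * √30
      + 4 * √10 / αemp := by positivity
    unfold LinMED.minimaxConst
    linarith
  rcases Nat.eq_zero_or_pos d with hd | hd
  · -- in dimension zero all arms coincide
    subst hd
    have hgap : ∀ t, 1 ≤ t → ∀ a, LinMED.gap θ (arms t) a = 0 := by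
      intro t ht a
      obtain ⟨b, -, hb⟩ := LinMED.exists_gap_eq θ (henv.nonempty t ht)
      rw [hb a, Subsingleton.elim b a, sub_self]
    have h0 : ∫ ω, LinMED.regret θ arms (fun s => A s ω) n ∂P = 0 := by
      refine integral_eq_zero_of_ae (Filter.Eventually.of_forall fun ω => ?_)
      exact Finset.sum_eq_zero fun t ht => hgap t (Finset.mem_Icc.1 ht).1 _
    have hlog : 0 ≤ Real.log ((n : ℝ) + 1) := Real.log_nonneg (by linarith)
    rw [h0]
    positivity
  rcases hn.eq_or_lt with h1 | h2
  · -- one round costs at most `B`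
    subst h1
    have hle : ∫ ω, LinMED.regret θ arms (fun s => A s ω) 1 ∂P ≤ B := by
      refine (integral_mono_ae hreg.1 (integrable_const B) ?_).trans (by simp)
      filter_upwards [h.mem_arms 1 le_rfl] with ω hω
      simpa [LinMED.regret] using henv.gap_le 1 le_rfl _ hω
    refine hle.trans ?_
    have hd1 : (1 : ℝ) ≤ d := by exact_mod_cast hd
    have hlog2 := Real.log_two_gt_d9
    have e : ((1 : ℕ) : ℝ) + 1 = 2 := by norm_num
    have h12 : 1 ≤ LinMED.minimaxConst αopt αemp Copt * LinMED.paramLog d I sigStar ‖θ‖ * d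
        * Real.log 2 := by
      calc (1 : ℝ) ≤ 12 * 1 * 1 * (1 / 2) := by norm_num
        _ ≤ _ := by gcongr; linarith
    rw [e, Nat.cast_one, Real.log_one, Real.zero_rpow (by norm_num), Real.zero_rpow (by norm_num),
      mul_zero, mul_zero, div_zero, zero_mul, zero_mul, add_zero, mul_zero, zero_add]
    calc B = 1 * B := (one_mul B).symm
      _ ≤ LinMED.minimaxConst αopt αemp Copt * LinMED.paramLog d I sigStar ‖θ‖ * d
        * Real.log 2 * B := by gcongr
      _ = _ := by ring
  · have hfin := hrun.integral_regret_le_minimax hO hC.le hI h henv hσ hver hd h2 rfl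
    have hℓpos : 0 < Real.log n := Real.log_pos (by exact_mod_cast h2)
    have e1 : Real.log n ^ (1 / 2 : ℝ) = √(Real.log n) := (Real.sqrt_eq_rpow _).symm
    have e2 : Real.log n ^ (3 / 2 : ℝ) = Real.log n * √(Real.log n) := by
      rw [Real.sqrt_eq_rpow, show (3 / 2 : ℝ) = 1 + 1 / 2 by norm_num, Real.rpow_add hℓpos,
        Real.rpow_one]
    have e3 : d * I.sig * Real.log n + I.lam * I.S ^ 2 / I.sig
        = (d * I.sig ^ 2 * Real.log n + I.lam * I.S ^ 2) / I.sig := by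
      field_simp
    rw [e1, e2, e3, ← ho, ← he]
    exact hfin
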